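/- **Setting.** Let $(G,H,t,\alpha)$ be a smooth crossed module: $G,H$ are Lie groups with Lie algebras $\mathfrak g,\mathfrak h$, $t\colon H\to G$ is a smooth homomorphism, $\alpha\colon G\to\mathrm{Aut}(H)$ is a smooth action, $t(\alpha_g h)=g\,t(h)\,g^{-1}$ and $\alpha_{t(h)}h'=hh'h^{-1}$. It defines the 2-group $G\ltimes H\rightrightarrows G$ with source $(g,h)\mapsto g$, target $(g,h)\mapsto t(h)g$, product $(g,h)(g',h')=(gg',h\,\alpha_g(h'))$ and composition $(t(h)g,h')\circ(g,h)=(g,h'h)$. Write $t_*\colon\mathfrak h\to\mathfrak g$, $(\alpha_g)_*\colon\mathfrak h\to\mathfrak h$ and $\alpha_*\colon\mathfrak g\times\mathfrak h\to\mathfrak h$ for the derivatives. Let $P_1\rightrightarrows P$ be a principal 2-bundle over a manifold $M$ for this 2-group, that is, a Lie groupoid with a functorial smooth right action of the 2-group ($G$ acts on $P$ and $G\ltimes H$ on $P_1$) and an invariant surjective submersion functor $\pi$ to $M$, such that $(\mathrm{pr}_1,R)\colon \mathcal P\times\mathcal G\to\mathcal P\times_M\mathcal P$ is an isomorphism. For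 $X,Y$ in the same fibre of $P$ or of $P_1$, let $Y:X$ be the unique group element with $X\cdot(Y:X)=Y$. Let $(A,B)$ be a 2-connection: $A\in\Omega^1(P,\mathfrak g)$ is a connection, and $B\in\Omega^2(P,\mathfrak h)$ is horizontal (it vanishes on the vertical vectors of the $G$-action) and satisfies $R_g^*B=(\alpha_g^{-1})_*B$ and $t_*B=F_A=dA+\tfrac12[A,A]$. Its 2-curvature is $$\tilde K=dB+\alpha_*(A\wedge B)\in\Omega^3(P,\mathfrak h),$$ $$\alpha_*(A\wedge B)(X,Y,Z)=\alpha_*(A(X),B(Y,Z))-\alpha_*(A(Y),B(X,Z))+\alpha_*(A(Z),B(X,Y)).$$ A bigon $\Gamma\colon\gamma_0\Rightarrow\gamma_1$ between paths from $x$ to $y$ is a smooth map $\Gamma\colon I^2\to M$, $I=[0,1]$, with $\Gamma(s,0)=x$, $\Gamma(s,1)=y$ and $\Gamma(i,\cdot)=\gamma_i$. For $p\in P_x$ let $\tilde\Gamma(s,\cdot)$ be the $A$-horizontal lift of $\Gamma(s,\cdot)$ starting at $p$, and let $\mathrm{tra}^1(\gamma_0)(p)=\tilde\Gamma(0,1)$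 be the parallel transport. The 2-transport is $$\mathrm{tra}^2(\Gamma)(p)=\mathrm{id}_{\mathrm{tra}^1(\gamma_0)(p)}\cdot(1,k(1))\in P_1,\qquad k'(s)=k(s)\cdot b(s),\quad k(0)=1,\quad b(s)=-\int_0^1(\tilde\Gamma^*B)(\partial_s,\partial_t)\,dt .$$ A homotopy of bigons $h\colon h_0\Rrightarrow h_1$ is a smooth map $h\colon I^3\to M$ such that every $h_u=h(u,\cdot,\cdot)$ is a bigon $\gamma_0\Rightarrow\gamma_1$ (with fixed $\gamma_0,\gamma_1,x,y$). The cube $I^3$, with coordinates $(u,s,t)$, is oriented by $du\wedge ds\wedge dt$. **Theorem (higher non-Abelian Stokes).** 1. $\tilde K$ takes values in $\ker t_*$. 2. If $(\alpha_g)_*$ fixes all values of $\tilde K$ for every $g\in G$ (for instance, if $G$ acts trivially on $\ker t_*$), then $\tilde K$ is basic: there is a unique $K\in\Omega^3(M,\ker t_*)$ with $\pi^*K=\tilde K$. 3. Let $h\colon h_0\Rrightarrow h_1$ be a homotopy of bigons as above, let $p\in P_x$, and let $\tilde h(u,s,\cdot)$ be the horizontal lift of $h(u,s,\cdot)$ starting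 at $p$. Then $$\mathrm{tra}^2(h_1)(p):\mathrm{tra}^2(h_0)(p)=\exp\int_{I^3}-\tilde h^*\tilde K .$$ Consequently, whenever $K\in\Omega^3(M,\ker t_*)$ satisfies $\pi^*K=\tilde K$, $$\mathrm{tra}^2(h_1)(p):\mathrm{tra}^2(h_0)(p)=\exp\int_{I^3}-h^*K .$$ (Here $H$ is regarded as the subgroup $\{1\}\times H$ of $G\ltimes H$.) -/

import Mathlib

open Set
open scoped Manifold ContDiff

/-! ### Differential forms on manifolds -/

section Forms

variable {E : Type*} [NormedAddCommGroup E] [NormedSpace ℝ E]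
  {N : Type*} [TopologicalSpace N] [ChartedSpace E N]
  {V : Type*} [NormedAddCommGroup V] [NormedSpace ℝ V] {k : ℕ}

/-- A (not necessarily smooth) differential `k`-form on the manifold `N`, with values in the
vector space `V`. -/
abbrev MForm (E : Type*) [NormedAddCommGroup E] [NormedSpace ℝ E]
    (N : Type*) [TopologicalSpace N] [ChartedSpace E N] (k : ℕ)
    (V : Type*) [NormedAddCommGroup V] [NormedSpace ℝ V] : Type _ :=
  (p : N) → (TangentSpace 𝓘(ℝ, E) p) [⋀^Fin k]→L[ℝ] V

namespace MForm

/-- The expression of a form in the preferred chart at `p₀`: its pullback under the inverse of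
that chart, a form on (an open subset of) the model vector space. -/
noncomputable def inChart (θ : MForm E N k V) (p₀ : N) : E → E [⋀^Fin k]→L[ℝ] V := fun y =>
  (θ ((extChartAt 𝓘(ℝ, E) p₀).symm y)).compContinuousLinearMap
    (mfderiv 𝓘(ℝ, E) 𝓘(ℝ, E) (extChartAt 𝓘(ℝ, E) p₀).symm y)

/-- A form is smooth if all its chart expressions are. -/
def IsSmooth (θ : MForm E N k V) : Prop :=
  ∀ p₀ : N, ContDiffOn ℝ ∞ (θ.inChart p₀) (extChartAt 𝓘(ℝ, E) p₀).target

/-- The exterior derivative, computed at `p` in the preferred chart at `p`. -/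
noncomputable def d (θ : MForm E N k V) : MForm E N (k + 1) V := fun p =>
  (extDeriv (θ.inChart p) (extChartAt 𝓘(ℝ, E) p p)).compContinuousLinearMap
    (mfderiv 𝓘(ℝ, E) 𝓘(ℝ, E) (extChartAt 𝓘(ℝ, E) p) p)

end MForm

/-- The velocity at the time `t ∈ [0, 1]` of a curve `c` parametrised by `[0, 1]`
(one-sided at the end points). -/
noncomputable def velocity (c : ℝ → N) (t : ℝ) : TangentSpace 𝓘(ℝ, E) (c t) :=
  mfderivWithin 𝓘(ℝ, ℝ) 𝓘(ℝ, E) c (Icc 0 1) t (1 : ℝ)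

end Forms

/-! ### Path ordered exponentials -/

section PathOrderedExp

variable {E : Type*} [NormedAddCommGroup E] [NormedSpace ℝ E]
  {H : Type*} [TopologicalSpace H] [ChartedSpace E H] [Group H]

/-- `k : [0, 1] → H` solves `k' = k · b`, `k 0 = 1`, where `b` is a curve in the Lie algebra. -/
def IsPathOrderedExp (b : ℝ → GroupLieAlgebra 𝓘(ℝ, E) H) (k : ℝ → H) : Prop :=
  k 0 = 1 ∧ ∀ s ∈ Icc (0 : ℝ) 1,
    HasMFDerivWithinAt 𝓘(ℝ, ℝ) 𝓘(ℝ, E) k (Icc 0 1) s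
      ((ContinuousLinearMap.id ℝ ℝ).smulRight
        (mulInvariantVectorField (I := 𝓘(ℝ, E)) (b s) (k s) : E))

open Classical in
/-- The path ordered exponential `Pexp ∫₀¹ b(s) ds`: the value at `1` of the solution of
`k' = k · b`, `k 0 = 1`. -/
noncomputable def pathOrderedExp (b : ℝ → GroupLieAlgebra 𝓘(ℝ, E) H) : H :=
  if hb : ∃ k : ℝ → H, IsPathOrderedExp b k then hb.choose 1 else 1

/-- The exponential map of a Lie group: the value at `1` of the one-parameter subgroup with
the given velocity. -/
noncomputable def lieExp (ξ : GroupLieAlgebra 𝓘(ℝ, E) H) : H :=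
  pathOrderedExp fun _ => ξ

end PathOrderedExp

/-! ### Smooth crossed modules -/

/-- A smooth crossed module `(G, H, t, α)`. -/
structure LieCrossedModule (EG EH G H : Type*)
    [NormedAddCommGroup EG] [NormedSpace ℝ EG] [NormedAddCommGroup EH] [NormedSpace ℝ EH]
    [TopologicalSpace G] [ChartedSpace EG G] [Group G]
    [TopologicalSpace H] [ChartedSpace EH H] [Group H] where
  /-- the target map -/
  t : H →* G
  /-- the action of `G` on `H` -/
  α : G →* MulAut H
  contMDiff_t : ContMDiff 𝓘(ℝ, EH) 𝓘(ℝ, EG) ∞ t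
  contMDiff_α : ContMDiff (𝓘(ℝ, EG).prod 𝓘(ℝ, EH)) 𝓘(ℝ, EH) ∞ fun x : G × H => α x.1 x.2
  t_α : ∀ g h, t (α g h) = g * t h * g⁻¹
  α_t : ∀ h h', α (t h) h' = h * h' * h⁻¹

namespace LieCrossedModule

variable {EG EH G H : Type*}
    [NormedAddCommGroup EG] [NormedSpace ℝ EG] [NormedAddCommGroup EH] [NormedSpace ℝ EH]
    [TopologicalSpace G] [ChartedSpace EG G] [Group G]
    [TopologicalSpace H] [ChartedSpace EH H] [Group H]
    (X : LieCrossedModule EG EH G H)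

/-- The group `G ⋉ H` of arrows of the 2-group. An element `(g, h)` is written `⟨h, g⟩` and
`(g, h) (g', h') = (g g', h α_g(h'))`. -/
abbrev Arr : Type _ := H ⋊[X.α] G

variable {X} in
/-- The source of `(g, h)` is `g`. -/
def arrSrc (a : X.Arr) : G := a.right

variable {X} in
/-- The target of `(g, h)` is `t(h) g`. -/
def arrTgt (a : X.Arr) : G := X.t a.left * a.right

variable {X} in
/-- The composition `(t(h) g, h') ∘ (g, h) = (g, h' h)` (meaningful if `arrSrc a' = arrTgt a`). -/
def arrComp (a' a : X.Arr) : X.Arr := ⟨a'.left * a.left, a.right⟩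

/-- `t_* : 𝔥 → 𝔤`. -/
noncomputable def tStar : EH →L[ℝ] EG := mfderiv 𝓘(ℝ, EH) 𝓘(ℝ, EG) X.t 1

/-- `(α_g)_* : 𝔥 → 𝔥`. -/
noncomputable def αStarGroup (g : G) : EH →L[ℝ] EH :=
  mfderiv 𝓘(ℝ, EH) 𝓘(ℝ, EH) (fun h : H => X.α g h) 1

/-- `α_* : 𝔤 × 𝔥 → 𝔥`, the derivative of `α : G × H → H` in both arguments. -/
noncomputable def αStar (ξ : EG) (η : EH) : EH :=
  mfderiv 𝓘(ℝ, EG) 𝓘(ℝ, EH) (fun g : G => X.αStarGroup g η) 1 ξ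

end LieCrossedModule

/-- The adjoint action `Ad_g : 𝔤 → 𝔤` of a Lie group. -/
noncomputable def lieAd {EG G : Type*} [NormedAddCommGroup EG] [NormedSpace ℝ EG]
    [TopologicalSpace G] [ChartedSpace EG G] [Group G] (g : G) : EG →L[ℝ] EG :=
  mfderiv 𝓘(ℝ, EG) 𝓘(ℝ, EG) (fun x : G => g * x * g⁻¹) 1

/-- The bracket of the Lie algebra `𝔤 = T₁G`, whose underlying vector space is the model
space `EG`. -/
noncomputable def lieBr {EG : Type*} (G : Type*) [NormedAddCommGroup EG] [NormedSpace ℝ EG]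
    [TopologicalSpace G] [ChartedSpace EG G] [Group G] (ξ η : GroupLieAlgebra 𝓘(ℝ, EG) G) : EG :=
  (⁅ξ, η⁆ : GroupLieAlgebra 𝓘(ℝ, EG) G)

/-! ### Principal 2-bundles and 2-connections -/

/-- A principal 2-bundle over `M` for the 2-group `G ⋉ H ⇉ G` of a crossed module: a Lie groupoid
`P₁ ⇉ P` with a functorial right action of the 2-group and an invariant surjective submersion
onto `M`, such that `(pr₁, R) : Q × (G ⋉ H ⇉ G) → Q ×_M Q` is an isomorphism. -/
structure Principal2Bundle {EG EH G H : Type*}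
    [NormedAddCommGroup EG] [NormedSpace ℝ EG] [NormedAddCommGroup EH] [NormedSpace ℝ EH]
    [TopologicalSpace G] [ChartedSpace EG G] [Group G]
    [TopologicalSpace H] [ChartedSpace EH H] [Group H]
    (X : LieCrossedModule EG EH G H)
    (EM EP EP₁ M P P₁ : Type*)
    [NormedAddCommGroup EM] [NormedSpace ℝ EM] [NormedAddCommGroup EP] [NormedSpace ℝ EP]
    [NormedAddCommGroup EP₁] [NormedSpace ℝ EP₁]
    [TopologicalSpace M] [ChartedSpace EM M] [TopologicalSpace P] [ChartedSpace EP P]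
    [TopologicalSpace P₁] [ChartedSpace EP₁ P₁] where
  -- the groupoid `P₁ ⇉ P`; `comp b a` is the composition `b ∘ a` when `src b = tgt a`
  src : P₁ → P
  tgt : P₁ → P
  ident : P → P₁
  comp : P₁ → P₁ → P₁
  inv : P₁ → P₁
  src_ident : ∀ p, src (ident p) = p
  tgt_ident : ∀ p, tgt (ident p) = p
  src_comp : ∀ b a, src b = tgt a → src (comp b a) = src a
  tgt_comp : ∀ b a, src b = tgt a → tgt (comp b a) = tgt b
  comp_ident : ∀ a, comp a (ident (src a)) = a
  ident_comp : ∀ a, comp (ident (tgt a)) a = a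
  comp_assoc : ∀ c b a, src c = tgt b → src b = tgt a → comp (comp c b) a = comp c (comp b a)
  src_inv : ∀ a, src (inv a) = tgt a
  tgt_inv : ∀ a, tgt (inv a) = src a
  inv_comp : ∀ a, comp (inv a) a = ident (src a)
  comp_inv : ∀ a, comp a (inv a) = ident (tgt a)
  -- it is a Lie groupoid
  contMDiff_src : ContMDiff 𝓘(ℝ, EP₁) 𝓘(ℝ, EP) ∞ src
  contMDiff_tgt : ContMDiff 𝓘(ℝ, EP₁) 𝓘(ℝ, EP) ∞ tgt
  contMDiff_ident : ContMDiff 𝓘(ℝ, EP) 𝓘(ℝ, EP₁) ∞ ident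
  contMDiff_inv : ContMDiff 𝓘(ℝ, EP₁) 𝓘(ℝ, EP₁) ∞ inv
  contMDiffOn_comp : ContMDiffOn (𝓘(ℝ, EP₁).prod 𝓘(ℝ, EP₁)) 𝓘(ℝ, EP₁) ∞
    (fun z : P₁ × P₁ => comp z.1 z.2) {z | src z.1 = tgt z.2}
  submersion_src : ∀ a, Function.Surjective (mfderiv 𝓘(ℝ, EP₁) 𝓘(ℝ, EP) src a)
  submersion_tgt : ∀ a, Function.Surjective (mfderiv 𝓘(ℝ, EP₁) 𝓘(ℝ, EP) tgt a)
  -- the right actions of `G` on objects and of `G ⋉ H` on arrows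
  act : P → G → P
  act₁ : P₁ → X.Arr → P₁
  act_one : ∀ p, act p 1 = p
  act_mul : ∀ p g g', act p (g * g') = act (act p g) g'
  act₁_one : ∀ a, act₁ a 1 = a
  act₁_mul : ∀ a k k', act₁ a (k * k') = act₁ (act₁ a k) k'
  contMDiff_act : ContMDiff (𝓘(ℝ, EP).prod 𝓘(ℝ, EG)) 𝓘(ℝ, EP) ∞
    fun z : P × G => act z.1 z.2
  contMDiff_act₁ : ContMDiff (𝓘(ℝ, EP₁).prod (𝓘(ℝ, EG).prod 𝓘(ℝ, EH))) 𝓘(ℝ, EP₁) ∞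
    fun z : P₁ × (G × H) => act₁ z.1 ⟨z.2.2, z.2.1⟩
  -- the action is a functor
  src_act₁ : ∀ a k, src (act₁ a k) = act (src a) (LieCrossedModule.arrSrc k)
  tgt_act₁ : ∀ a k, tgt (act₁ a k) = act (tgt a) (LieCrossedModule.arrTgt k)
  ident_act : ∀ p g, ident (act p g) = act₁ (ident p) (SemidirectProduct.inr g)
  comp_act₁ : ∀ b a k' k, src b = tgt a →
    LieCrossedModule.arrSrc k' = LieCrossedModule.arrTgt k →
    comp (act₁ b k') (act₁ a k) = act₁ (comp b a) (LieCrossedModule.arrComp k' k)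
  -- the projection, a surjective submersion, invariant, and a functor to `M ⇉ M`;
  -- on arrows it is `proj ∘ src = proj ∘ tgt`
  proj : P → M
  contMDiff_proj : ContMDiff 𝓘(ℝ, EP) 𝓘(ℝ, EM) ∞ proj
  surjective_proj : Function.Surjective proj
  submersion_proj : ∀ p, Function.Surjective (mfderiv 𝓘(ℝ, EP) 𝓘(ℝ, EM) proj p)
  proj_act : ∀ p g, proj (act p g) = proj p
  proj_tgt : ∀ a, proj (tgt a) = proj (src a)
  -- the inverse `(y, x) ↦ (x, y : x)` of `(pr₁, R)`, on objects and on arrows: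
  -- `div y x` is `y : x`, the unique element with `x · (y : x) = y`
  div : P → P → G
  div₁ : P₁ → P₁ → X.Arr
  act_div : ∀ y x, proj y = proj x → act x (div y x) = y
  div_act : ∀ x g, div (act x g) x = g
  act₁_div₁ : ∀ b a, proj (src b) = proj (src a) → act₁ a (div₁ b a) = b
  div₁_act₁ : ∀ a k, div₁ (act₁ a k) a = k
  contMDiffOn_div : ContMDiffOn (𝓘(ℝ, EP).prod 𝓘(ℝ, EP)) 𝓘(ℝ, EG) ∞
    (fun z : P × P => div z.1 z.2) {z | proj z.1 = proj z.2}
  contMDiffOn_div₁ : ContMDiffOn (𝓘(ℝ, EP₁).prod 𝓘(ℝ, EP₁)) (𝓘(ℝ, EG).prod 𝓘(ℝ, EH)) ∞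
    (fun z : P₁ × P₁ => ((div₁ z.1 z.2).right, (div₁ z.1 z.2).left))
    {z | proj (src z.1) = proj (src z.2)}

section TwoConnections

variable {EG EH G H : Type*}
    [NormedAddCommGroup EG] [NormedSpace ℝ EG] [NormedAddCommGroup EH] [NormedSpace ℝ EH]
    [TopologicalSpace G] [ChartedSpace EG G] [Group G]
    [TopologicalSpace H] [ChartedSpace EH H] [Group H]
    {X : LieCrossedModule EG EH G H}
    {EM EP EP₁ M P P₁ : Type*}
    [NormedAddCommGroup EM] [NormedSpace ℝ EM] [NormedAddCommGroup EP] [NormedSpace ℝ EP]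
    [NormedAddCommGroup EP₁] [NormedSpace ℝ EP₁]
    [TopologicalSpace M] [ChartedSpace EM M] [TopologicalSpace P] [ChartedSpace EP P]
    [TopologicalSpace P₁] [ChartedSpace EP₁ P₁]

/-- The fundamental vector field `X_ξ` of the action of `G` on `P`. -/
noncomputable def Principal2Bundle.fundamental (Q : Principal2Bundle X EM EP EP₁ M P P₁)
    (ξ : EG) (p : P) : TangentSpace 𝓘(ℝ, EP) p :=
  mfderiv 𝓘(ℝ, EG) 𝓘(ℝ, EP) (fun g : G => Q.act p g) 1 ξ

/-- The differential at `p` of the right translation `R_g : P → P`. -/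
noncomputable def Principal2Bundle.dR (Q : Principal2Bundle X EM EP EP₁ M P P₁)
    (g : G) (p : P) : TangentSpace 𝓘(ℝ, EP) p →L[ℝ] TangentSpace 𝓘(ℝ, EP) (Q.act p g) :=
  mfderiv 𝓘(ℝ, EP) 𝓘(ℝ, EP) (fun q : P => Q.act q g) p

/-- The curvature `F_A = dA + ½ [A, A]` of a `𝔤`-valued 1-form, evaluated at two vectors. -/
noncomputable def curvature2 (G : Type*) [TopologicalSpace G] [ChartedSpace EG G] [Group G]
    (A : MForm EP P 1 EG) (p : P) (v w : TangentSpace 𝓘(ℝ, EP) p) : EG :=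
  A.d p ![v, w] + lieBr G (A p ![v]) (A p ![w])

/-- A 2-connection `(A, B)` on a principal 2-bundle. -/
structure TwoConnection (Q : Principal2Bundle X EM EP EP₁ M P P₁) where
  A : MForm EP P 1 EG
  B : MForm EP P 2 EH
  smooth_A : A.IsSmooth
  smooth_B : B.IsSmooth
  A_fundamental : ∀ p ξ, A p ![Q.fundamental ξ p] = ξ
  A_equivariant : ∀ g p v, A (Q.act p g) ![Q.dR g p v] = lieAd g⁻¹ (A p ![v])
  B_horizontal : ∀ p ξ w, B p ![Q.fundamental ξ p, w] = 0
  B_equivariant : ∀ g p v w,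
    B (Q.act p g) ![Q.dR g p v, Q.dR g p w] = X.αStarGroup g⁻¹ (B p ![v, w])
  fake_flat : ∀ p v w, X.tStar (B p ![v, w]) = curvature2 G A p v w

namespace TwoConnection

variable {Q : Principal2Bundle X EM EP EP₁ M P P₁} (AB : TwoConnection Q)

/-- The 2-curvature `dB + α_*(A ∧ B)`, evaluated at three vectors. -/
noncomputable def curvature3 (p : P) (v : Fin 3 → TangentSpace 𝓘(ℝ, EP) p) : EH :=
  AB.B.d p v
    + X.αStar (AB.A p ![v 0]) (AB.B p ![v 1, v 2])
    - X.αStar (AB.A p ![v 1]) (AB.B p ![v 0, v 2])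
    + X.αStar (AB.A p ![v 2]) (AB.B p ![v 0, v 1])

/-- `c` is a horizontal lift of the path `γ : [0, 1] → M`. -/
def IsHorizontalLift (γ : ℝ → M) (c : ℝ → P) : Prop :=
  ContMDiffOn 𝓘(ℝ, ℝ) 𝓘(ℝ, EP) ∞ c (Icc 0 1) ∧
    ∀ t ∈ Icc (0 : ℝ) 1, Q.proj (c t) = γ t ∧ AB.A (c t) ![velocity c t] = 0

open Classical in
/-- The horizontal lift of the path `γ : [0, 1] → M` that starts at `p`. -/
noncomputable def horLift (γ : ℝ → M) (p : P) : ℝ → P :=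
  if hc : ∃ c : ℝ → P, AB.IsHorizontalLift γ c ∧ c 0 = p then hc.choose else fun _ => p

/-- Parallel transport `tra¹(γ)(p)` along the path `γ`. -/
noncomputable def tra1 (γ : ℝ → M) (p : P) : P := AB.horLift γ p 1

/-- For a bigon `Γ` and `Γ̃(s, t)` the point at time `t` of the horizontal lift of `Γ(s, ·)`
starting at `p`, this is the curve `s ↦ - ∫₀¹ (Γ̃^*B)(∂s, ∂t) dt` in `𝔥`. -/
noncomputable def bigonIntegrand (Γ : ℝ → ℝ → M) (p : P) (s : ℝ) : EH :=
  -∫ t in (0 : ℝ)..1, AB.B (AB.horLift (Γ s) p t)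
    ![velocity (fun s' => AB.horLift (Γ s') p t) s, velocity (AB.horLift (Γ s) p) t]

/-- The 2-transport `tra²(Γ)(p) = id_{tra¹(Γ₀)(p)} · Pexp ∫₀¹ ds (- ∫₀¹ dt (Γ̃^*B)(∂s, ∂t))`
of a bigon `Γ : Γ(0, ·) ⇒ Γ(1, ·)`. -/
noncomputable def tra2 (Γ : ℝ → ℝ → M) (p : P) : P₁ :=
  Q.act₁ (Q.ident (AB.tra1 (Γ 0) p))
    (SemidirectProduct.inl (pathOrderedExp (E := EH) (H := H) (AB.bigonIntegrand Γ p)))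

end TwoConnection

end TwoConnections

/-! ### Bigons and their homotopies -/

section Bigons

variable {EM M : Type*} [NormedAddCommGroup EM] [NormedSpace ℝ EM]
  [TopologicalSpace M] [ChartedSpace EM M]

variable (EM) in
/-- A map on a subset `C` of a vector space is smooth if it is the restriction of a smooth map
on an open set containing `C`. -/
def SmoothNear {V : Type*} [NormedAddCommGroup V] [NormedSpace ℝ V] (f : V → M) (C : Set V) :
    Prop :=
  ∃ U : Set V, IsOpen U ∧ C ⊆ U ∧ ContMDiffOn 𝓘(ℝ, V) 𝓘(ℝ, EM) ∞ f U

variable (EM) in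
/-- `Γ : I² → M` is a bigon `γ₀ ⇒ γ₁` between paths from `x` to `y`. -/
structure IsBigon (Γ : ℝ → ℝ → M) (γ₀ γ₁ : ℝ → M) (x y : M) : Prop where
  smooth : SmoothNear EM (fun z : ℝ × ℝ => Γ z.1 z.2) (Icc 0 1 ×ˢ Icc 0 1)
  start : ∀ s ∈ Icc (0 : ℝ) 1, Γ s 0 = x
  finish : ∀ s ∈ Icc (0 : ℝ) 1, Γ s 1 = y
  source : ∀ t ∈ Icc (0 : ℝ) 1, Γ 0 t = γ₀ t
  target : ∀ t ∈ Icc (0 : ℝ) 1, Γ 1 t = γ₁ t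

variable (EM) in
/-- `h : I³ → M` is a homotopy between the bigons `h 0` and `h 1`, both `γ₀ ⇒ γ₁`. -/
structure IsBigonHomotopy (h : ℝ → ℝ → ℝ → M) (γ₀ γ₁ : ℝ → M) (x y : M) : Prop where
  smooth : SmoothNear EM (fun z : ℝ × ℝ × ℝ => h z.1 z.2.1 z.2.2)
    (Icc 0 1 ×ˢ Icc 0 1 ×ˢ Icc 0 1)
  bigon : ∀ u ∈ Icc (0 : ℝ) 1, IsBigon EM (h u) γ₀ γ₁ x y

/-- The integral over the cube `I³`, oriented by `du ∧ ds ∧ dt`, of the pullback under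
`f : I³ → N` of `θ`, a map assigning a vector to any three tangent vectors at a point. -/
noncomputable def cubeIntegral {E N V : Type*} [NormedAddCommGroup E] [NormedSpace ℝ E]
    [TopologicalSpace N] [ChartedSpace E N] [NormedAddCommGroup V] [NormedSpace ℝ V]
    (θ : (p : N) → (Fin 3 → TangentSpace 𝓘(ℝ, E) p) → V) (f : ℝ → ℝ → ℝ → N) : V :=
  ∫ u in (0 : ℝ)..1, ∫ s in (0 : ℝ)..1, ∫ t in (0 : ℝ)..1,
    θ (f u s t) ![velocity (fun u' => f u' s t) u, velocity (fun s' => f u s' t) s,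
      velocity (fun t' => f u s t') t]

end Bigons

/-! Along a smooth map from a vector space to `P`, the pullbacks of A and B are vector-valued
functions. Fake flatness and the definition of the 2-curvature K̃ become identities between ordinary
derivatives (`tStar_pullB`, `curvature3_pull`).

Values in ker t_*: since t_*B = F_A and t_* intertwines α_* with the bracket of 𝔤, t_*K̃ is dF_A +
[A, F_A], which vanishes by the Bianchi identity (`tStar_curvature3_pull`).

Descent: if a map γ into `P` is replaced by γ·g, then A becomes Ad_{g⁻¹}A + g⁻¹dg and B becomes
α_{g⁻¹}B. The term from differentiating α_{g⁻¹} cancels the one from g⁻¹dg, so K̃ only changes by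
α_{g⁻¹} (`curvature3_act`). This gives equivariance and horizontality at once. If G fixes the
values, K̃ depends only on projected vectors.

Stokes: lift the cube to F, horizontal in t, and put c_e(l,t) = -∫₀ᵗ (F^*B)(e, ∂t). As A(∂t) = 0,
fake flatness reads ∂t A(e) = -t_*B(e, ∂t), hence A(e) = t_* c_e. The Peiffer identity α_*(t_*ξ, η)
= [ξ, η] then makes -K̃(∂u, ∂s, ∂t) the t-derivative of ∂u c_s - ∂s c_u + [c_u, c_s] - B(∂u, ∂s)
(`integral_curvature3_line`). With b = c_s and c = c_u at t = 1, the fixed end points give κ = ∂u b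
- ∂s c + [c, b], where κ is the t-integral of -K̃. Moreover c vanishes at s = 0 and s = 1, where the
boundary paths are fixed. If k solves k⁻¹∂s k = b, the Maurer–Cartan equation says that w = k⁻¹∂u k
satisfies ∂s w = ∂u b + [w, b]. Since t_*κ = 0, the Peiffer identity makes κ central, and w - c - ∫κ
solves a homogeneous linear equation with initial value zero. So w at s = 1 is ∫κ ds
(`logD_variation`, `logD_transport_cube`), and integrating this central logarithmic derivative over
u produces the exponential (`inv_mul_eq_lieExp`).

The analytic input is smooth dependence of solutions on parameters, both for equations in Lie groups
and for horizontal lifts. It comes from the inverse function theorem on the Banach space of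
continuous curves, followed by a gluing argument (`exists_global_solution`). -/

open Filter
open scoped Topology

set_option linter.unusedSectionVars false

universe u

/-! ### Superposition operators on spaces of continuous functions -/

section Superposition

variable {K : Type*} [TopologicalSpace K] [CompactSpace K]

variable (K) in
/-- Pointwise application of a continuous family of linear maps to a continuous function. -/
noncomputable def pointwiseApplyL (E F : Type*) [NormedAddCommGroup E] [NormedSpace ℝ E]
    [NormedAddCommGroup F] [NormedSpace ℝ F] :
    C(K, E →L[ℝ] F) →L[ℝ] C(K, E) →L[ℝ] C(K, F) :=
  LinearMap.mkContinuous₂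
    (LinearMap.mk₂ ℝ (fun (A : C(K, E →L[ℝ] F)) (y : C(K, E)) =>
        (⟨fun t => A t (y t), by fun_prop⟩ : C(K, F)))
      (fun A B y => by ext t; simp) (fun c A y => by ext t; simp)
      (fun A y z => by ext t; simp) (fun c A y => by ext t; simp)) 1
    (fun A y => by
      rw [ContinuousMap.norm_le _ (by positivity)]
      intro t
      rw [one_mul]
      exact ((A t).le_opNorm (y t)).trans
        (mul_le_mul (A.norm_coe_le_norm t) (y.norm_coe_le_norm t) (norm_nonneg (y t)) (norm_nonneg A)))

@[simp] theorem pointwiseApplyL_apply {E F : Type*} [NormedAddCommGroup E] [NormedSpace ℝ E]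
    [NormedAddCommGroup F] [NormedSpace ℝ F] (A : C(K, E →L[ℝ] F)) (y : C(K, E)) (t : K) :
    pointwiseApplyL K E F A y t = A t (y t) := rfl

/-- Uniform continuity of f' on the ball of radius ‖y‖ + 1 makes the mean value estimate uniform in
t. Finite dimension of E enters through compactness of that ball. -/
theorem hasFDerivAt_superposition {E F : Type*} [NormedAddCommGroup E] [NormedSpace ℝ E]
    [FiniteDimensional ℝ E] [NormedAddCommGroup F] [NormedSpace ℝ F] {f : E → F}
    {f' : E → E →L[ℝ] F} (hf : ∀ x, HasFDerivAt f (f' x) x) (hf' : Continuous f')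
    (hc : Continuous f) (y : C(K, E)) :
    HasFDerivAt (fun y : C(K, E) => ContinuousMap.comp ⟨f, hc⟩ y)
      (pointwiseApplyL K E F (ContinuousMap.comp ⟨f', hf'⟩ y)) y := by
  have : ProperSpace E := FiniteDimensional.proper ℝ E
  rw [hasFDerivAt_iff_isLittleO_nhds_zero, Asymptotics.isLittleO_iff]
  intro ε hε
  have huc := (isCompact_closedBall (0 : E) (‖y‖ + 1)).uniformContinuousOn_of_continuous
    hf'.continuousOn
  rw [Metric.uniformContinuousOn_iff] at huc
  obtain ⟨δ, hδ, H⟩ := huc ε hε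
  have hr : 0 < min δ 1 := lt_min hδ one_pos
  filter_upwards [Metric.ball_mem_nhds (0 : C(K, E)) hr] with h hh
  rw [mem_ball_zero_iff] at hh
  rw [ContinuousMap.norm_le _ (by positivity)]
  intro t
  have h1 : ‖h t‖ < min δ 1 := (h.norm_coe_le_norm t).trans_lt hh
  have hy : ‖y t‖ ≤ ‖y‖ := y.norm_coe_le_norm t
  have key := (convex_ball (y t) (min δ 1)).norm_image_sub_le_of_norm_hasFDerivWithin_le'
    (f := f) (f' := f') (φ := f' (y t)) (C := ε) (x := y t) (y := y t + h t)
    (fun x _ => (hf x).hasFDerivWithinAt) (fun x hx => ?_) (Metric.mem_ball_self hr)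
    (by simpa [mem_ball_iff_norm] using h1)
  · refine le_trans ?_ (mul_le_mul_of_nonneg_left (h.norm_coe_le_norm t) hε.le)
    simpa using key
  · rw [mem_ball_iff_norm] at hx
    have hx' : ‖x‖ ≤ ‖y‖ + 1 := by
      have := norm_le_norm_add_norm_sub' x (y t)
      have := hx.le.trans (min_le_right δ 1)
      linarith
    rw [← dist_eq_norm]
    refine (H x (by simpa using hx') (y t) (by simpa using hy.trans (by linarith)) ?_).le
    rw [dist_eq_norm]
    exact hx.trans_le (min_le_left _ _)

/-- The derivative of a superposition operator is the superposition operator of `fderiv ℝ f`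
followed by a bounded linear map, so induction on the order works. The target F has to vary, since
it becomes `E →L[ℝ] F`. -/
theorem contDiff_nat_superposition {E : Type u} [NormedAddCommGroup E] [NormedSpace ℝ E]
    [FiniteDimensional ℝ E] (n : ℕ) : ∀ {F : Type u} [NormedAddCommGroup F] [NormedSpace ℝ F]
    {f : E → F} (_ : ContDiff ℝ ∞ f) (hc : Continuous f),
    ContDiff ℝ n (fun y : C(K, E) => (ContinuousMap.comp ⟨f, hc⟩ y : C(K, F))) := by
  induction n with
  | zero =>
    intro F _ _ f hf hc
    exact contDiff_zero.2 (ContinuousMap.continuous_postcomp _)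
  | succ n ih =>
    intro F _ _ f hf hc
    have hf' : ContDiff ℝ ∞ (fderiv ℝ f) := (contDiff_infty_iff_fderiv.1 hf).2
    refine contDiff_succ_iff_hasFDerivAt.2
      ⟨fun y => pointwiseApplyL K E F (ContinuousMap.comp ⟨fderiv ℝ f, hf'.continuous⟩ y), ?_, ?_⟩
    · exact (pointwiseApplyL K E F).contDiff.comp (ih hf' hf'.continuous)
    · exact hasFDerivAt_superposition
        (fun x => (hf.differentiable (by simp) x).hasFDerivAt) hf'.continuous hc

theorem contDiff_superposition {E F : Type u} [NormedAddCommGroup E] [NormedSpace ℝ E]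
    [FiniteDimensional ℝ E] [NormedAddCommGroup F] [NormedSpace ℝ F]
    {f : E → F} (hf : ContDiff ℝ ∞ f) :
    ContDiff ℝ ∞
      (fun y : C(K, E) => (ContinuousMap.comp ⟨f, hf.continuous⟩ y : C(K, F))) :=
  contDiff_infty.2 fun n => contDiff_nat_superposition n hf hf.continuous

end Superposition

/-! ### The primitive of a continuous function on `[-1, 1]` -/

section Primitive

/-- The operator that maps a continuous function on `[-1, 1]` to its primitive vanishing at `0`. -/
noncomputable def primitiveL (F : Type*) [NormedAddCommGroup F] [NormedSpace ℝ F] :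
    C(Icc (-1 : ℝ) 1, F) →L[ℝ] C(Icc (-1 : ℝ) 1, F) :=
  LinearMap.mkContinuous
    { toFun := fun y => ⟨fun r => ∫ s in (0 : ℝ)..r, y (projIcc (-1) 1 (by norm_num) s), by
          have hy : Continuous fun s => y (projIcc (-1) 1 (by norm_num) s) :=
            y.continuous.comp continuous_projIcc
          exact (intervalIntegral.continuous_primitive
            (fun a b => hy.intervalIntegrable a b) 0).comp continuous_subtype_val⟩
      map_add' := fun y z => by
        ext r
        have hy : Continuous fun s => y (projIcc (-1) 1 (by norm_num) s) :=
          y.continuous.comp continuous_projIcc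
        have hz : Continuous fun s => z (projIcc (-1) 1 (by norm_num) s) :=
          z.continuous.comp continuous_projIcc
        exact intervalIntegral.integral_add (hy.intervalIntegrable _ _) (hz.intervalIntegrable _ _)
      map_smul' := fun c y => by
        ext r
        exact intervalIntegral.integral_smul _ _ } 1
    (fun y => by
      rw [ContinuousMap.norm_le _ (by positivity)]
      intro r
      refine (intervalIntegral.norm_integral_le_of_norm_le_const
        (fun s _ => y.norm_coe_le_norm _)).trans ?_
      have : |(r : ℝ) - 0| ≤ 1 := by
        rw [sub_zero, abs_le]; exact ⟨r.2.1, r.2.2⟩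
      nlinarith [norm_nonneg y])

theorem primitiveL_apply {F : Type*} [NormedAddCommGroup F] [NormedSpace ℝ F]
    (y : C(Icc (-1 : ℝ) 1, F)) (r : Icc (-1 : ℝ) 1) :
    primitiveL F y r = ∫ s in (0 : ℝ)..r, y (projIcc (-1) 1 (by norm_num) s) := rfl

/-- The map `(l, a, τ, y) ↦ (r ↦ (l, a + τ r, y r))`. -/
noncomputable def graphL (Λ F : Type*) [NormedAddCommGroup Λ] [NormedSpace ℝ Λ]
    [NormedAddCommGroup F] [NormedSpace ℝ F] :
    (Λ × ℝ × ℝ × C(Icc (-1 : ℝ) 1, F)) →L[ℝ] C(Icc (-1 : ℝ) 1, Λ × ℝ × F) :=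
  LinearMap.mkContinuous
    { toFun := fun z => ⟨fun r => (z.1, z.2.1 + z.2.2.1 * r, z.2.2.2 r), by fun_prop⟩
      map_add' := fun y z => by ext r <;> simp; ring
      map_smul' := fun c y => by ext r <;> simp; ring } 2
    (fun z => by
      rw [ContinuousMap.norm_le _ (by positivity)]
      intro r
      have h1 : ‖z.1‖ ≤ ‖z‖ := norm_fst_le z
      have h2 : ‖z.2.1‖ ≤ ‖z‖ := (norm_fst_le z.2).trans (norm_snd_le z)
      have h3 : ‖z.2.2.1‖ ≤ ‖z‖ :=
        (norm_fst_le z.2.2).trans ((norm_snd_le z.2).trans (norm_snd_le z))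
      have h4 : ‖z.2.2.2‖ ≤ ‖z‖ :=
        (norm_snd_le z.2.2).trans ((norm_snd_le z.2).trans (norm_snd_le z))
      have hr : ‖(r : ℝ)‖ ≤ 1 := by rw [Real.norm_eq_abs, abs_le]; exact ⟨r.2.1, r.2.2⟩
      have h0 := norm_nonneg z
      change ‖(z.1, z.2.1 + z.2.2.1 * (r : ℝ), z.2.2.2 r)‖ ≤ 2 * ‖z‖
      rw [Prod.norm_mk, Prod.norm_mk]
      refine max_le (by linarith) (max_le ?_ ?_)
      · refine (norm_add_le _ _).trans ?_
        rw [norm_mul]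
        nlinarith [norm_nonneg z.2.2.1, norm_nonneg (r : ℝ)]
      · have := z.2.2.2.norm_coe_le_norm r
        linarith)

@[simp] theorem graphL_apply {Λ F : Type*} [NormedAddCommGroup Λ] [NormedSpace ℝ Λ]
    [NormedAddCommGroup F] [NormedSpace ℝ F] (l : Λ) (a τ : ℝ) (y : C(Icc (-1 : ℝ) 1, F))
    (r : Icc (-1 : ℝ) 1) : graphL Λ F (l, a, τ, y) r = (l, a + τ * r, y r) := rfl

/-- The primitive of a smooth function of parameters and time is smooth. -/
theorem contDiff_parametric_primitive {Λ : Type} {F : Type u} [NormedAddCommGroup Λ]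
    [NormedSpace ℝ Λ] [FiniteDimensional ℝ Λ] [NormedAddCommGroup F] [NormedSpace ℝ F]
    [FiniteDimensional ℝ F] {β : Λ → ℝ → F} (hβ : ContDiff ℝ ∞ fun z : Λ × ℝ => β z.1 z.2) :
    ContDiff ℝ ∞ fun z : Λ × ℝ => ∫ t in (0 : ℝ)..z.2, β z.1 t := by
  -- Rescaling gives ∫₀ᵗ β(l, s) ds = t ∫₀¹ β(l, ts) ds. The right side is built from a
  -- superposition operator, here with a dummy argument in F, the primitive operator and evaluation
  -- at 1.
  have hf : ContDiff ℝ ∞ fun z : Λ × ℝ × F => β z.1 z.2.1 :=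
    hβ.comp (contDiff_fst.prodMk (contDiff_fst.comp contDiff_snd))
  have hg : ContDiff ℝ ∞ fun z : Λ × ℝ => graphL Λ F (z.1, 0, z.2, 0) :=
    (graphL Λ F).contDiff.comp
      (contDiff_fst.prodMk (contDiff_const.prodMk (contDiff_snd.prodMk contDiff_const)))
  have h1 := contDiff_snd.smul
    ((ContinuousMap.evalCLM ℝ (⟨1, by norm_num⟩ : Icc (-1 : ℝ) 1)).contDiff.comp
      ((primitiveL F).contDiff.comp ((contDiff_superposition hf).comp hg)))
  have h2 : ∀ z : Λ × ℝ,
      primitiveL F (ContinuousMap.comp ⟨_, hf.continuous⟩ (graphL Λ F (z.1, 0, z.2, 0)))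
        ⟨1, by norm_num⟩ = ∫ s in (0 : ℝ)..1, β z.1 (z.2 * s) := by
    intro z
    rw [primitiveL_apply]
    refine intervalIntegral.integral_congr fun s hs => ?_
    rw [uIcc_of_le zero_le_one] at hs
    simp [projIcc_of_mem (by norm_num : (-1 : ℝ) ≤ 1) (x := s) ⟨by linarith [hs.1], hs.2⟩]
  refine (congrArg (ContDiff ℝ ∞) (funext fun z => ?_)).mp h1
  change z.2 • primitiveL F (ContinuousMap.comp ⟨_, hf.continuous⟩
    (graphL Λ F (z.1, 0, z.2, 0))) ⟨1, by norm_num⟩ = _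
  rw [h2, intervalIntegral.smul_integral_comp_mul_left, mul_zero, mul_one]

end Primitive

/-! ### Smooth local solutions of ordinary differential equations -/

section LocalODE

/-- The inverse function theorem, with smoothness of the inverse on its whole domain. -/
theorem exists_smooth_local_inverse {E F : Type*} [NormedAddCommGroup E] [NormedSpace ℝ E]
    [CompleteSpace E] [NormedAddCommGroup F] [NormedSpace ℝ F] {f : E → F} {S : Set E}
    (hS : IsOpen S) (hf : ContDiffOn ℝ ∞ f S) {a : E} (ha : a ∈ S) {f' : E ≃L[ℝ] F}
    (hf' : HasFDerivAt f (f' : E →L[ℝ] F) a) :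
    ∃ e : OpenPartialHomeomorph E F, a ∈ e.source ∧ e.source ⊆ S ∧ ⇑e = f ∧
      ContDiffOn ℝ ∞ e.symm e.target := by
  have hc : ContDiffAt ℝ ∞ f a := hf.contDiffAt (hS.mem_nhds ha)
  let e₀ := hc.toOpenPartialHomeomorph f hf' (by simp)
  have hcont : ContinuousOn (fderiv ℝ f) S := hf.continuousOn_fderiv_of_isOpen hS (by simp)
  -- Invertibility of the derivative is an open condition; restricting to it makes the inverse
  -- smooth at every point of its domain, not only at the image of `a`.
  have hO : IsOpen (S ∩ fderiv ℝ f ⁻¹' range ((↑) : (E ≃L[ℝ] F) → E →L[ℝ] F)) :=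
    hcont.isOpen_inter_preimage hS ContinuousLinearEquiv.isOpen
  refine ⟨e₀.restrOpen _ hO, ⟨hc.mem_toOpenPartialHomeomorph_source hf' (by simp), ha, f', ?_⟩,
    fun x hx => hx.2.1, rfl, ?_⟩
  · exact hf'.fderiv.symm
  · intro x hx
    have hx' := (e₀.restrOpen _ hO).map_target hx
    obtain ⟨g, hg⟩ := hx'.2.2
    have hd : ContDiffAt ℝ ∞ f ((e₀.restrOpen _ hO).symm x) :=
      hf.contDiffAt (hS.mem_nhds hx'.2.1)
    refine ((e₀.restrOpen _ hO).contDiffAt_symm hx (f₀' := g) ?_ hd).contDiffWithinAt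
    rw [hg]
    exact (hd.differentiableAt (by simp)).hasFDerivAt

/-- The equation whose solutions `y` are the solutions on `[-1, 1]` of the integral equation of
`x' = f (l, t, x)`, `x t₀ = x₀`, with time rescaled by `τ`. -/
noncomputable def odeDefect {Λ F : Type*} [NormedAddCommGroup Λ] [NormedSpace ℝ Λ]
    [NormedAddCommGroup F] [NormedSpace ℝ F] (f : C(Λ × ℝ × F, F)) (t₀ : ℝ) (x₀ : F)
    (z : (Λ × ℝ) × C(Icc (-1 : ℝ) 1, F)) : C(Icc (-1 : ℝ) 1, F) :=
  z.2 - ContinuousMap.const _ x₀ -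
    z.1.2 • primitiveL F (f.comp (graphL Λ F (z.1.1, t₀, z.1.2, z.2)))

theorem odeDefect_eq_zero_iff {Λ F : Type*} [NormedAddCommGroup Λ] [NormedSpace ℝ Λ]
    [NormedAddCommGroup F] [NormedSpace ℝ F] (f : C(Λ × ℝ × F, F)) (t₀ : ℝ) (x₀ : F)
    (l : Λ) (τ : ℝ) (y : C(Icc (-1 : ℝ) 1, F)) :
    odeDefect f t₀ x₀ ((l, τ), y) = 0 ↔ ∀ r : Icc (-1 : ℝ) 1,
      y r = x₀ + τ • ∫ s in (0 : ℝ)..r, f (l, t₀ + τ * s, y (projIcc (-1) 1 (by norm_num) s)) := by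
  rw [ContinuousMap.ext_iff]
  refine forall_congr' fun r => ?_
  have h2 : primitiveL F (f.comp (graphL Λ F (l, t₀, τ, y))) r =
      ∫ s in (0 : ℝ)..r, f (l, t₀ + τ * s, y (projIcc (-1) 1 (by norm_num) s)) := by
    rw [primitiveL_apply]
    refine intervalIntegral.integral_congr fun s hs => ?_
    have hs' : s ∈ Icc (-1 : ℝ) 1 := by
      rcases le_total 0 (r : ℝ) with h | h
      · rw [uIcc_of_le h] at hs
        exact ⟨by linarith [hs.1], by linarith [hs.2, r.2.2]⟩
      · rw [uIcc_of_ge h] at hs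
        exact ⟨by linarith [hs.1, r.2.1], by linarith [hs.2]⟩
    simp [projIcc_of_mem _ hs']
  change y r - x₀ - τ • (primitiveL F (f.comp (graphL Λ F (l, t₀, τ, y))) r) = 0 ↔ _
  rw [h2, sub_sub, sub_eq_zero]

theorem contDiff_odeDefect {Λ : Type} {F : Type u} [NormedAddCommGroup Λ]
    [NormedSpace ℝ Λ] [FiniteDimensional ℝ Λ] [NormedAddCommGroup F] [NormedSpace ℝ F]
    [FiniteDimensional ℝ F] {f : Λ × ℝ × F → F} (hf : ContDiff ℝ ∞ f) (t₀ : ℝ) (x₀ : F) :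
    ContDiff ℝ ∞ (odeDefect ⟨f, hf.continuous⟩ t₀ x₀) := by
  have hg : ContDiff ℝ ∞ fun z : (Λ × ℝ) × C(Icc (-1 : ℝ) 1, F) =>
      graphL Λ F (z.1.1, t₀, z.1.2, z.2) :=
    (graphL Λ F).contDiff.comp ((contDiff_fst.comp contDiff_fst).prodMk
      (contDiff_const.prodMk ((contDiff_snd.comp contDiff_fst).prodMk contDiff_snd)))
  exact (contDiff_snd.sub contDiff_const).sub ((contDiff_snd.comp contDiff_fst).smul
    ((primitiveL F).contDiff.comp ((contDiff_superposition hf).comp hg)))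

/-- As Φ(a, ·) is a translation, the derivative of (x, y) ↦ (x, Φ(x, y)) is block triangular with
identities on the diagonal. This turns the inverse function theorem into the implicit function
theorem needed below. -/
theorem hasFDerivAt_shear {A B : Type*} [NormedAddCommGroup A] [NormedSpace ℝ A]
    [NormedAddCommGroup B] [NormedSpace ℝ B] {Φ : A × B → B} {a : A} {b : B}
    (hΦ : DifferentiableAt ℝ Φ (a, b)) (h : ∀ y, Φ (a, y) = y - b) :
    ∃ e : (A × B) ≃L[ℝ] (A × B),
      HasFDerivAt (fun z : A × B => (z.1, Φ z)) (e : A × B →L[ℝ] A × B) (a, b) := by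
  set D := fderiv ℝ Φ (a, b)
  have hD : ∀ y, D (0, y) = y := by
    intro y
    have h1 : HasFDerivAt (fun y => Φ (a, y)) (D ∘L ContinuousLinearMap.inr ℝ A B) b :=
      hΦ.hasFDerivAt.comp b (hasFDerivAt_prodMk_right a b)
    have h2 : HasFDerivAt (fun y => Φ (a, y)) (ContinuousLinearMap.id ℝ B) b := by
      simp only [h]
      exact (hasFDerivAt_id b).sub_const b
    exact DFunLike.congr_fun (h1.unique h2) y
  have hD' : ∀ x y, D (x, y) = D (x, 0) + y := by
    intro x y
    rw [← hD y, ← map_add, hD]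
    simp
  refine ⟨ContinuousLinearEquiv.equivOfInverse
    ((ContinuousLinearMap.fst ℝ A B).prod D)
    ((ContinuousLinearMap.fst ℝ A B).prod (ContinuousLinearMap.snd ℝ A B -
      D ∘L ContinuousLinearMap.inl ℝ A B ∘L ContinuousLinearMap.fst ℝ A B)) ?_ ?_, ?_⟩
  · rintro ⟨x, y⟩
    simp [hD' x y]
  · rintro ⟨x, y⟩
    simp [hD' x (y - D (x, 0))]
  · exact hasFDerivAt_fst.prodMk hΦ.hasFDerivAt

/-- With time rescaled to [-1, 1], the step length τ is a parameter like l. At τ = 0 the defect is y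
- x₀, so its zero set is the graph of a smooth function y(l, τ) near there. The value at 1 of y(l, t
- t₀) is the solution at time t, smooth in (l, t) together. -/
theorem exists_local_ode_solution_of_contDiff {Λ : Type} {F : Type u} [NormedAddCommGroup Λ]
    [NormedSpace ℝ Λ] [FiniteDimensional ℝ Λ] [NormedAddCommGroup F] [NormedSpace ℝ F]
    [FiniteDimensional ℝ F] {f : Λ × ℝ × F → F} (hf : ContDiff ℝ ∞ f) (l₀ : Λ) (t₀ : ℝ) (x₀ : F) :
    ∃ ε > 0, ∃ x : Λ × ℝ → F, ContDiffOn ℝ ∞ x (Metric.ball l₀ ε ×ˢ Metric.ball t₀ ε) ∧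
      ∀ l ∈ Metric.ball l₀ ε, x (l, t₀) = x₀ ∧ ∀ t ∈ Metric.ball t₀ ε,
        HasDerivAt (fun t => x (l, t)) (f (l, t, x (l, t))) t := by
  have : CompleteSpace F := FiniteDimensional.complete ℝ F
  have : CompleteSpace Λ := FiniteDimensional.complete ℝ Λ
  set f₁ : C(Λ × ℝ × F, F) := ⟨f, hf.continuous⟩
  set Φ := odeDefect f₁ t₀ x₀
  have hΦ : ContDiff ℝ ∞ Φ := contDiff_odeDefect hf t₀ x₀
  set c₀ : C(Icc (-1 : ℝ) 1, F) := ContinuousMap.const _ x₀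
  have hΦ0 : ∀ y, Φ ((l₀, 0), y) = y - c₀ := fun y => by simp [Φ, odeDefect, c₀]
  obtain ⟨g, hg⟩ := hasFDerivAt_shear
    ((hΦ.differentiable (by simp)) ((l₀, (0 : ℝ)), c₀)) hΦ0
  obtain ⟨e, heS, -, he, hes⟩ := exists_smooth_local_inverse isOpen_univ
    (contDiff_fst.prodMk hΦ).contDiffOn (mem_univ _) hg
  have he' : ∀ p y, e (p, y) = (p, Φ (p, y)) := fun p y => by rw [he]
  obtain ⟨ρ, hρ, hρS⟩ := Metric.isOpen_iff.1 e.open_source _ heS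
  have h0 : e ((l₀, 0), c₀) = ((l₀, 0), 0) := by rw [he', hΦ0, sub_self]
  have hT : ((l₀, (0 : ℝ)), (0 : C(Icc (-1 : ℝ) 1, F))) ∈ e.target := h0 ▸ e.map_source heS
  have hsymm0 : e.symm ((l₀, 0), 0) = ((l₀, 0), c₀) := by rw [← h0, e.left_inv heS]
  have hO : IsOpen (e.target ∩ e.symm ⁻¹' Metric.ball ((l₀, (0 : ℝ)), c₀) ρ) :=
    e.symm.isOpen_inter_preimage Metric.isOpen_ball
  obtain ⟨η, hη, hηO⟩ := Metric.isOpen_iff.1 hO ((l₀, (0 : ℝ)), 0)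
    ⟨hT, by rw [mem_preimage, hsymm0]; exact Metric.mem_ball_self hρ⟩
  have hmem : ∀ l ∈ Metric.ball l₀ η, ∀ τ ∈ Metric.ball (0 : ℝ) η,
      ((l, τ), (0 : C(Icc (-1 : ℝ) 1, F))) ∈
        e.target ∩ e.symm ⁻¹' Metric.ball ((l₀, (0 : ℝ)), c₀) ρ := by
    intro l hl τ hτ
    apply hηO
    rw [Metric.mem_ball, Prod.dist_eq, Prod.dist_eq]
    simpa [hη] using And.intro hl (by simpa using hτ)
  set y : Λ → ℝ → C(Icc (-1 : ℝ) 1, F) := fun l τ => (e.symm ((l, τ), 0)).2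
  have hy : ∀ l ∈ Metric.ball l₀ η, ∀ τ ∈ Metric.ball (0 : ℝ) η,
      e.symm ((l, τ), 0) = ((l, τ), y l τ) ∧ Φ ((l, τ), y l τ) = 0 := by
    intro l hl τ hτ
    have h1 := e.right_inv (hmem l hl τ hτ).1
    rw [← Prod.mk.eta (p := e.symm ((l, τ), 0)), he', Prod.mk.injEq] at h1
    refine ⟨Prod.ext h1.1 rfl, ?_⟩
    rw [h1.1] at h1
    exact h1.2
  set τ₁ := η / 2
  have hτ₁ : 0 < τ₁ := half_pos hη
  have hτη : τ₁ < η := half_lt_self hη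
  -- Running the solution for step length τ₁ only up to r gives a solution for step length rτ₁. It
  -- is no farther from the constant curve, hence still in the domain where `e` is injective, so it
  -- is y(l, rτ₁). Thus the values at 1 trace out the single curve y(l, τ₁), for which the integral
  -- equation can be differentiated.
  have hscale : ∀ l ∈ Metric.ball l₀ η, ∀ r : Icc (-1 : ℝ) 1,
      y l (r * τ₁) ⟨1, by norm_num⟩ = y l τ₁ r := by
    intro l hl r
    have hr : |(r : ℝ)| ≤ 1 := by rw [abs_le]; exact ⟨r.2.1, r.2.2⟩
    have hmul : ∀ s : Icc (-1 : ℝ) 1, (r : ℝ) * s ∈ Icc (-1 : ℝ) 1 := by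
      intro s
      have hs : |(s : ℝ)| ≤ 1 := by rw [abs_le]; exact ⟨s.2.1, s.2.2⟩
      rw [mem_Icc, ← abs_le, abs_mul]
      exact mul_le_one₀ hr (abs_nonneg _) hs
    have hτ₁m : τ₁ ∈ Metric.ball (0 : ℝ) η := by
      rw [mem_ball_zero_iff, Real.norm_eq_abs, abs_of_pos hτ₁]; exact hτη
    have hrτ : (r : ℝ) * τ₁ ∈ Metric.ball (0 : ℝ) η := by
      rw [mem_ball_zero_iff, Real.norm_eq_abs, abs_mul, abs_of_pos hτ₁]
      nlinarith [abs_nonneg (r : ℝ)]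
    let z : C(Icc (-1 : ℝ) 1, F) := ⟨fun s => y l τ₁ ⟨r * s, hmul s⟩, by fun_prop⟩
    have hz : Φ ((l, r * τ₁), z) = 0 := by
      rw [odeDefect_eq_zero_iff]
      intro s
      have h1 := (odeDefect_eq_zero_iff _ _ _ _ _ _).1 (hy l hl τ₁ hτ₁m).2 ⟨r * s, hmul s⟩
      change y l τ₁ ⟨r * s, hmul s⟩ = _
      rw [h1, mul_comm (r : ℝ) τ₁, mul_smul]
      congr 2
      have h2 := intervalIntegral.smul_integral_comp_mul_left (a := 0) (b := (s : ℝ))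
        (fun s => f₁ (l, t₀ + τ₁ * s, y l τ₁ (projIcc (-1) 1 (by norm_num) s))) (r : ℝ)
      rw [mul_zero] at h2
      rw [← h2]
      congr 1
      refine intervalIntegral.integral_congr fun q hq => ?_
      have hq' : q ∈ Icc (-1 : ℝ) 1 := by
        rcases le_total 0 (s : ℝ) with h | h
        · rw [uIcc_of_le h] at hq
          exact ⟨by linarith [hq.1], by linarith [hq.2, s.2.2]⟩
        · rw [uIcc_of_ge h] at hq
          exact ⟨by linarith [hq.1, s.2.1], by linarith [hq.2]⟩
      simp only [projIcc_of_mem _ hq', projIcc_of_mem _ (hmul ⟨q, hq'⟩), mul_assoc]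
      rfl
    have hzS : ((l, r * τ₁), z) ∈ e.source := by
      apply hρS
      have h1 := (hmem l hl τ₁ hτ₁m).2
      have h2 := (hmem l hl _ hrτ).2
      rw [mem_preimage, (hy l hl _ hτ₁m).1, Metric.mem_ball, Prod.dist_eq, max_lt_iff] at h1
      rw [mem_preimage, (hy l hl _ hrτ).1, Metric.mem_ball, Prod.dist_eq, max_lt_iff] at h2
      rw [Metric.mem_ball, Prod.dist_eq, max_lt_iff]
      refine ⟨h2.1, lt_of_le_of_lt ?_ h1.2⟩
      rw [ContinuousMap.dist_le dist_nonneg]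
      intro s
      exact ContinuousMap.dist_apply_le_dist (f := y l τ₁) (g := c₀) ⟨r * s, hmul s⟩
    have h3 : e.symm (e ((l, r * τ₁), z)) = ((l, r * τ₁), z) := e.left_inv hzS
    rw [he', hz, (hy l hl _ hrτ).1, Prod.mk.injEq] at h3
    rw [h3.2]
    change y l τ₁ ⟨r * 1, _⟩ = _
    congr 1
    exact Subtype.ext (mul_one _)
  refine ⟨τ₁, hτ₁, fun z => y z.1 (z.2 - t₀) ⟨1, by norm_num⟩, ?_, ?_⟩
  · have h1 : ContDiffOn ℝ ∞ (fun z : Λ × ℝ => e.symm ((z.1, z.2 - t₀), 0))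
        (Metric.ball l₀ τ₁ ×ˢ Metric.ball t₀ τ₁) := by
      refine hes.comp (ContDiff.contDiffOn (by fun_prop)) ?_
      rintro ⟨l, t⟩ ⟨hl, ht⟩
      refine (hmem l (Metric.ball_subset_ball hτη.le hl) _ ?_).1
      rw [mem_ball_zero_iff, ← dist_eq_norm]
      exact (Metric.mem_ball.1 ht).trans hτη
    exact (ContinuousMap.evalCLM ℝ (⟨1, by norm_num⟩ : Icc (-1 : ℝ) 1)).contDiff.comp_contDiffOn
      (contDiff_snd.comp_contDiffOn h1)
  · intro l hl'
    have hl : l ∈ Metric.ball l₀ η := Metric.ball_subset_ball hτη.le hl'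
    have hτ₁m : τ₁ ∈ Metric.ball (0 : ℝ) η := by
      rw [mem_ball_zero_iff, Real.norm_eq_abs, abs_of_pos hτ₁]; exact hτη
    have hint := (odeDefect_eq_zero_iff _ _ _ _ _ _).1 (hy l hl τ₁ hτ₁m).2
    have hx : ∀ t ∈ Metric.ball t₀ τ₁, ∃ h : (t - t₀) / τ₁ ∈ Icc (-1 : ℝ) 1,
        y l (t - t₀) ⟨1, by norm_num⟩ = y l τ₁ ⟨(t - t₀) / τ₁, h⟩ := by
      intro t ht
      rw [Metric.mem_ball, Real.dist_eq] at ht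
      have h : (t - t₀) / τ₁ ∈ Icc (-1 : ℝ) 1 := by
        rw [mem_Icc, ← abs_le, abs_div, abs_of_pos hτ₁, div_le_one hτ₁]
        exact ht.le
      refine ⟨h, ?_⟩
      rw [← hscale l hl ⟨_, h⟩]
      congr 2
      field_simp
    have hx' : ∀ t ∈ Metric.ball t₀ τ₁, y l (t - t₀) ⟨1, by norm_num⟩ =
        x₀ + τ₁ • ∫ s in (0 : ℝ)..((t - t₀) / τ₁),
          f (l, t₀ + τ₁ * s, y l τ₁ (projIcc (-1) 1 (by norm_num) s)) := by
      intro t ht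
      obtain ⟨h, h1⟩ := hx t ht
      rw [h1, hint]
      rfl
    refine ⟨?_, fun t ht => ?_⟩
    · have := hx' t₀ (Metric.mem_ball_self hτ₁)
      simpa using this
    · have hcont : Continuous fun s : ℝ =>
          f (l, t₀ + τ₁ * s, y l τ₁ (projIcc (-1) 1 (by norm_num) s)) := by
        have := hf.continuous
        have h2 : Continuous fun s : ℝ => y l τ₁ (projIcc (-1) 1 (by norm_num) s) :=
          (y l τ₁).continuous.comp continuous_projIcc
        fun_prop
      have h3 : HasDerivAt (fun t : ℝ => (t - t₀) / τ₁) (1 / τ₁) t :=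
        ((hasDerivAt_id t).sub_const t₀).div_const τ₁
      have h4 := ((intervalIntegral.integral_hasDerivAt_right
        (hcont.intervalIntegrable 0 ((t - t₀) / τ₁))
        hcont.stronglyMeasurable.stronglyMeasurableAtFilter hcont.continuousAt).scomp t h3)
      have h5 := (h4.const_smul τ₁).const_add x₀
      obtain ⟨h, h6⟩ := hx t ht
      have h7 : τ₁ • (1 / τ₁) • f (l, t₀ + τ₁ * ((t - t₀) / τ₁),
          y l τ₁ (projIcc (-1) 1 (by norm_num) ((t - t₀) / τ₁))) =
          f (l, t, y l (t - t₀) ⟨1, by norm_num⟩) := by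
        rw [projIcc_of_mem _ h, h6, smul_smul, mul_one_div_cancel hτ₁.ne', one_smul,
          mul_div_cancel₀ _ hτ₁.ne', add_sub_cancel]
      rw [h7] at h5
      refine h5.congr_of_eventuallyEq ?_
      filter_upwards [Metric.isOpen_ball.mem_nhds ht] with t' ht'
      exact hx' t' ht'

/-- Local existence and smooth dependence on parameters of solutions of ordinary differential
equations with smooth right hand side. -/
theorem exists_local_ode_solution {Λ : Type} {F : Type u} [NormedAddCommGroup Λ]
    [NormedSpace ℝ Λ] [FiniteDimensional ℝ Λ] [NormedAddCommGroup F] [NormedSpace ℝ F]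
    [FiniteDimensional ℝ F] {f : Λ × ℝ × F → F} {Ω : Set (Λ × ℝ × F)} (hΩ : IsOpen Ω)
    (hf : ContDiffOn ℝ ∞ f Ω) {l₀ : Λ} {t₀ : ℝ} {x₀ : F} (h₀ : (l₀, t₀, x₀) ∈ Ω) :
    ∃ ε > 0, ∃ x : Λ × ℝ → F, ContDiffOn ℝ ∞ x (Metric.ball l₀ ε ×ˢ Metric.ball t₀ ε) ∧
      ∀ l ∈ Metric.ball l₀ ε, x (l, t₀) = x₀ ∧ ∀ t ∈ Metric.ball t₀ ε,
        (l, t, x (l, t)) ∈ Ω ∧ HasDerivAt (fun t => x (l, t)) (f (l, t, x (l, t))) t := by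
  obtain ⟨R, hR, hRΩ⟩ := Metric.isOpen_iff.1 hΩ _ h₀
  -- The cutoff makes the right hand side globally smooth. The solution is afterwards confined to
  -- the ball of radius R / 3, where χ = 1.
  let χ : ContDiffBump (l₀, t₀, x₀) := ⟨R / 3, R / 2, by positivity, by linarith⟩
  have hχf : ContDiff ℝ ∞ fun z => χ z • f z := by
    rw [contDiff_iff_contDiffAt]
    intro z
    by_cases hz : z ∈ Ω
    · exact χ.contDiff.contDiffAt.smul (hf.contDiffAt (hΩ.mem_nhds hz))
    · have hz' : z ∈ (Metric.closedBall (l₀, t₀, x₀) (R / 2))ᶜ := fun h =>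
        hz (hRΩ (Metric.closedBall_subset_ball (by linarith) h))
      refine (contDiffAt_const (c := (0 : F))).congr_of_eventuallyEq ?_
      filter_upwards [Metric.isClosed_closedBall.isOpen_compl.mem_nhds hz'] with w hw
      have : χ w = 0 := χ.zero_of_le_dist (by
        rw [mem_compl_iff, Metric.mem_closedBall, not_le] at hw
        exact hw.le)
      rw [this, zero_smul]
  obtain ⟨ε, hε, x, hx, hx'⟩ := exists_local_ode_solution_of_contDiff hχf l₀ t₀ x₀
  have hO : IsOpen ((Metric.ball l₀ ε ×ˢ Metric.ball t₀ ε) ∩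
      (fun z : Λ × ℝ => (z.1, z.2, x z)) ⁻¹' Metric.ball (l₀, t₀, x₀) (R / 3)) := by
    refine ContinuousOn.isOpen_inter_preimage ?_ (Metric.isOpen_ball.prod Metric.isOpen_ball)
      Metric.isOpen_ball
    exact continuousOn_fst.prodMk (continuousOn_snd.prodMk hx.continuousOn)
  obtain ⟨δ, hδ, hδO⟩ := Metric.isOpen_iff.1 hO (l₀, t₀)
    ⟨⟨Metric.mem_ball_self hε, Metric.mem_ball_self hε⟩, by
      rw [mem_preimage]
      simp only [(hx' l₀ (Metric.mem_ball_self hε)).1]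
      exact Metric.mem_ball_self (by positivity)⟩
  rw [← ball_prod_same] at hδO
  refine ⟨δ, hδ, x, hx.mono fun z hz => (hδO hz).1, fun l hl => ?_⟩
  have hm := fun t (ht : t ∈ Metric.ball t₀ δ) => hδO (mk_mem_prod hl ht)
  have hl' : l ∈ Metric.ball l₀ ε := (hm t₀ (Metric.mem_ball_self hδ)).1.1
  refine ⟨(hx' l hl').1, fun t ht => ⟨?_, ?_⟩⟩
  · exact hRΩ (Metric.ball_subset_ball (by linarith) (hm t ht).2)
  · have h1 := (hx' l hl').2 t (hm t ht).1.2
    have h2 : χ (l, t, x (l, t)) = 1 :=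
      χ.one_of_mem_closedBall (Metric.ball_subset_closedBall (hm t ht).2)
    simpa only [h2, one_smul] using h1

end LocalODE

/-! ### Derivatives of maps between manifolds, as maps between the model spaces -/

section HasD

variable {E E' E'' : Type*} [NormedAddCommGroup E] [NormedSpace ℝ E]
  [NormedAddCommGroup E'] [NormedSpace ℝ E'] [NormedAddCommGroup E''] [NormedSpace ℝ E'']
  {N N' N'' : Type*} [TopologicalSpace N] [ChartedSpace E N]
  [TopologicalSpace N'] [ChartedSpace E' N'] [TopologicalSpace N''] [ChartedSpace E'' N'']
  {V : Type*} [NormedAddCommGroup V] [NormedSpace ℝ V]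

/-- `f` has the derivative `L` at `x` within `s`, where `L` is viewed as a map between the model
spaces. -/
def HasD (f : N → N') (s : Set N) (x : N) (L : E →L[ℝ] E') : Prop :=
  HasMFDerivWithinAt 𝓘(ℝ, E) 𝓘(ℝ, E') f s x L

/-- The derivative of a map between manifolds, viewed as a map between the model spaces. -/
noncomputable def mD (E E' : Type*) [NormedAddCommGroup E] [NormedSpace ℝ E]
    [NormedAddCommGroup E'] [NormedSpace ℝ E'] {N N' : Type*} [TopologicalSpace N]
    [ChartedSpace E N] [TopologicalSpace N'] [ChartedSpace E' N'] (f : N → N') (x : N) :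
    E →L[ℝ] E' :=
  mfderiv 𝓘(ℝ, E) 𝓘(ℝ, E') f x

theorem MDifferentiableAt.hasD {f : N → N'} {x : N}
    (h : MDifferentiableAt 𝓘(ℝ, E) 𝓘(ℝ, E') f x) : HasD f univ x (mD E E' f x) :=
  hasMFDerivWithinAt_univ.2 h.hasMFDerivAt

theorem HasD.mD_eq {f : N → N'} {x : N} {L : E →L[ℝ] E'} (h : HasD f univ x L) :
    mD E E' f x = L :=
  (hasMFDerivWithinAt_univ.1 h).mfderiv

theorem HasD.mono {f : N → N'} {s t : Set N} {x : N} {L : E →L[ℝ] E'} (h : HasD f s x L)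
    (hst : t ⊆ s) : HasD f t x L :=
  HasMFDerivWithinAt.mono h hst

theorem HasD.continuousWithinAt {f : N → N'} {s : Set N} {x : N} {L : E →L[ℝ] E'}
    (h : HasD f s x L) : ContinuousWithinAt f s x := h.1

theorem HasD.congr {f g : N → N'} {s : Set N} {x : N} {L : E →L[ℝ] E'} (h : HasD f s x L)
    (hfg : g =ᶠ[𝓝[s] x] f) (hx : g x = f x) : HasD g s x L :=
  HasMFDerivWithinAt.congr_of_eventuallyEq h hfg hx

theorem HasD.congr_nhds {f g : N → N'} {x : N} {L : E →L[ℝ] E'} (h : HasD f univ x L)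
    (hfg : g =ᶠ[𝓝 x] f) : HasD g univ x L :=
  h.congr (by rwa [nhdsWithin_univ]) hfg.self_of_nhds

theorem HasD.comp {g : N' → N''} {f : N → N'} {s : Set N} {t : Set N'} {x : N}
    {L : E →L[ℝ] E'} {L' : E' →L[ℝ] E''} (hg : HasD g t (f x) L') (hf : HasD f s x L)
    (h : MapsTo f s t) : HasD (fun z => g (f z)) s x (L' ∘L L) :=
  HasMFDerivWithinAt.comp x hg hf h

theorem HasD.comp_univ {g : N' → N''} {f : N → N'} {s : Set N} {x : N}
    {L : E →L[ℝ] E'} {L' : E' →L[ℝ] E''} (hg : HasD g univ (f x) L') (hf : HasD f s x L) :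
    HasD (fun z => g (f z)) s x (L' ∘L L) :=
  hg.comp hf (mapsTo_univ _ _)

theorem HasD.comp_eq {g : N' → N''} {f : N → N'} {s : Set N} {x : N} {y : N'}
    {L : E →L[ℝ] E'} {L' : E' →L[ℝ] E''} (hg : HasD g univ y L') (hf : HasD f s x L)
    (hy : f x = y) : HasD (fun z => g (f z)) s x (L' ∘L L) := by
  subst hy
  exact hg.comp_univ hf

theorem hasD_id (s : Set N) (x : N) : HasD (fun z : N => z) s x (ContinuousLinearMap.id ℝ E) :=
  hasMFDerivWithinAt_id ..

theorem hasD_const (c : N') (s : Set N) (x : N) : HasD (fun _ : N => c) s x (0 : E →L[ℝ] E') :=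
  hasMFDerivWithinAt_const ..

theorem hasD_iff_hasFDerivWithinAt {f : V → E} {s : Set V} {x : V} {L : V →L[ℝ] E} :
    HasD f s x L ↔ HasFDerivWithinAt f L s x :=
  hasMFDerivWithinAt_iff_hasFDerivWithinAt

theorem hasD_univ_iff_hasFDerivAt {f : V → E} {x : V} {L : V →L[ℝ] E} :
    HasD f univ x L ↔ HasFDerivAt f L x := by
  rw [hasD_iff_hasFDerivWithinAt, hasFDerivWithinAt_univ]

theorem hasD_iff_chart {f : V → N} {s : Set V} {x : V} {L : V →L[ℝ] E} :
    HasD f s x L ↔ ContinuousWithinAt f s x ∧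
      HasFDerivWithinAt (fun z => extChartAt 𝓘(ℝ, E) (f x) (f z)) L s x := by
  unfold HasD HasMFDerivWithinAt
  simp only [mfld_simps]
  rfl

theorem HasD.unique {f : V → N} {s : Set V} {x : V} {L L' : V →L[ℝ] E} (h : HasD f s x L)
    (h' : HasD f s x L') (hs : UniqueDiffWithinAt ℝ s x) : L = L' :=
  hs.eq (hasD_iff_chart.1 h).2 (hasD_iff_chart.1 h').2

theorem HasD.unique_univ {f : N → N'} {x : N} {L L' : E →L[ℝ] E'} (h : HasD f univ x L)
    (h' : HasD f univ x L') : L = L' := by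
  rw [← h.mD_eq, h'.mD_eq]

theorem hasD_extChartAt [IsManifold 𝓘(ℝ, E) ∞ N] {p q : N}
    (hq : q ∈ (extChartAt 𝓘(ℝ, E) p).source) :
    HasD (extChartAt 𝓘(ℝ, E) p) univ q (mD E E (extChartAt 𝓘(ℝ, E) p) q) := by
  have : IsManifold 𝓘(ℝ, E) 1 N := IsManifold.of_le (n := ∞) (by simp)
  rw [extChartAt_source] at hq
  exact (mdifferentiableAt_extChartAt hq).hasD

/-- Tangent vectors at `p` are identified with model vectors through the preferred chart at `p`
itself; at other points of the chart the derivative is a coordinate change. -/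
theorem mD_extChartAt_self [IsManifold 𝓘(ℝ, E) ∞ N] (p : N) :
    mD E E (extChartAt 𝓘(ℝ, E) p) p = ContinuousLinearMap.id ℝ E := by
  have : IsManifold 𝓘(ℝ, E) 1 N := IsManifold.of_le (n := ∞) (by simp)
  exact mfderiv_extChartAt_self

theorem hasD_extChartAt_symm [IsManifold 𝓘(ℝ, E) ∞ N] {p : N} {y : E}
    (hy : y ∈ (extChartAt 𝓘(ℝ, E) p).target) :
    HasD (extChartAt 𝓘(ℝ, E) p).symm univ y (mD E E (extChartAt 𝓘(ℝ, E) p).symm y) := by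
  have : IsManifold 𝓘(ℝ, E) 1 N := IsManifold.of_le (n := ∞) (by simp)
  have h := mdifferentiableWithinAt_extChartAt_symm hy
  rw [modelWithCornersSelf_coe, range_id, mdifferentiableWithinAt_univ] at h
  exact h.hasD

theorem mD_extChartAt_comp_symm [IsManifold 𝓘(ℝ, E) ∞ N] {p : N} {y : E}
    (hy : y ∈ (extChartAt 𝓘(ℝ, E) p).target) :
    mD E E (extChartAt 𝓘(ℝ, E) p) ((extChartAt 𝓘(ℝ, E) p).symm y) ∘L
      mD E E (extChartAt 𝓘(ℝ, E) p).symm y = ContinuousLinearMap.id ℝ E := by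
  have h1 := (hasD_extChartAt ((extChartAt 𝓘(ℝ, E) p).map_target hy)).comp_univ
    (hasD_extChartAt_symm hy)
  refine h1.unique_univ ((hasD_id univ y).congr_nhds ?_)
  filter_upwards [(isOpen_extChartAt_target p).mem_nhds hy] with z hz
  exact (extChartAt 𝓘(ℝ, E) p).right_inv hz

theorem mD_extChartAt_symm_comp [IsManifold 𝓘(ℝ, E) ∞ N] {p q : N}
    (hq : q ∈ (extChartAt 𝓘(ℝ, E) p).source) :
    mD E E (extChartAt 𝓘(ℝ, E) p).symm (extChartAt 𝓘(ℝ, E) p q) ∘L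
      mD E E (extChartAt 𝓘(ℝ, E) p) q = ContinuousLinearMap.id ℝ E := by
  have h1 := (hasD_extChartAt_symm ((extChartAt 𝓘(ℝ, E) p).map_source hq)).comp_univ
    (hasD_extChartAt hq)
  refine h1.unique_univ ((hasD_id univ q).congr_nhds ?_)
  filter_upwards [(isOpen_extChartAt_source p).mem_nhds hq] with z hz
  exact (extChartAt 𝓘(ℝ, E) p).left_inv hz

theorem mD_extChartAt_symm_self [IsManifold 𝓘(ℝ, E) ∞ N] (p : N) :
    mD E E (extChartAt 𝓘(ℝ, E) p).symm (extChartAt 𝓘(ℝ, E) p p) =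
      ContinuousLinearMap.id ℝ E := by
  have := mD_extChartAt_symm_comp (E := E) (mem_extChartAt_source (I := 𝓘(ℝ, E)) p)
  rwa [mD_extChartAt_self, ContinuousLinearMap.comp_id] at this

/-- The chain rule for a function of two variables. -/
theorem HasD.comp₂ {F : N × N' → N''} {a : V → N} {b : V → N'} {s : Set V} {x : V}
    {La : V →L[ℝ] E} {Lb : V →L[ℝ] E'}
    (hF : MDifferentiableAt (𝓘(ℝ, E).prod 𝓘(ℝ, E')) 𝓘(ℝ, E'') F (a x, b x))
    (ha : HasD a s x La) (hb : HasD b s x Lb) :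
    HasD (fun z => F (a z, b z)) s x
      (mD E E'' (fun p => F (p, b x)) (a x) ∘L La + mD E' E'' (fun q => F (a x, q)) (b x) ∘L Lb) := by
  have h1 := hF.hasMFDerivAt.comp_hasMFDerivWithinAt x (HasMFDerivWithinAt.prodMk ha hb)
  refine h1.congr_mfderiv ?_
  ext v
  exact mfderiv_prod_eq_add_apply (p := (a x, b x)) (v := (La v, Lb v)) hF

end HasD

/-! ### Curves with vanishing derivative -/

section Constant

variable {E : Type*} [NormedAddCommGroup E] [NormedSpace ℝ E]
  {N : Type*} [TopologicalSpace N] [ChartedSpace E N] [IsManifold 𝓘(ℝ, E) ∞ N] [T2Space N]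

/-- The set of times with value `c a` is closed because N is Hausdorff. It contains a right
neighbourhood of each of its points t < b, since the derivative also vanishes in the chart at `c t`.
-/
theorem eq_of_hasD_zero_Icc {c : ℝ → N} {a b : ℝ} (hab : a ≤ b)
    (h : ∀ t ∈ Icc a b, HasD c (Icc a b) t (0 : ℝ →L[ℝ] E)) : c b = c a := by
  have hc : ContinuousOn c (Icc a b) := fun t ht => (h t ht).continuousWithinAt
  have hclosed : IsClosed ({t | c t = c a} ∩ Icc a b) := by
    have := hc.preimage_isClosed_of_isClosed isClosed_Icc (isClosed_singleton (x := c a))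
    rwa [inter_comm] at this
  refine hclosed.Icc_subset_of_forall_mem_nhdsWithin rfl (fun t ht => ?_) (right_mem_Icc.2 hab)
  obtain ⟨hta, ht⟩ := ht
  have htI : t ∈ Icc a b := Ico_subset_Icc_self ht
  have hsrc : ∀ᶠ r in 𝓝[Icc a b] t, c r ∈ (extChartAt 𝓘(ℝ, E) (c t)).source :=
    hc t htI ((isOpen_extChartAt_source (c t)).mem_nhds (mem_extChartAt_source _))
  have hsrc' : ∀ᶠ r in 𝓝[≥] t, r ∈ Icc a b ∧ c r ∈ (extChartAt 𝓘(ℝ, E) (c t)).source := by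
    have h1 : Icc a b ∈ 𝓝[≥] t := by
      refine mem_of_superset (Icc_mem_nhdsGE ht.2) (Icc_subset_Icc_left ht.1)
    have h2 : 𝓝[≥] t ≤ 𝓝[Icc a b] t := by
      rw [nhdsWithin_le_iff]; exact h1
    exact Filter.Eventually.and h1 (h2 hsrc)
  obtain ⟨b', hb', hs⟩ := (mem_nhdsGE_iff_exists_Icc_subset).1 hsrc'
  have hd : ∀ r ∈ Icc t b', HasDerivWithinAt (fun r => extChartAt 𝓘(ℝ, E) (c t) (c r)) 0
      (Icc t b') r := by
    intro r hr
    have h1 : HasD c (Icc t b') r (0 : ℝ →L[ℝ] E) :=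
      (h r (hs hr).1).mono fun r' hr' => (hs hr').1
    have h2 := (hasD_extChartAt (hs hr).2).comp_univ h1
    rw [ContinuousLinearMap.comp_zero, hasD_iff_hasFDerivWithinAt] at h2
    simpa using h2.hasDerivWithinAt
  have hconst := constant_of_has_deriv_right_zero
    (fun r hr => (hd r hr).continuousWithinAt)
    (fun r hr => ((hd r (Ico_subset_Icc_self hr)).mono_of_mem_nhdsWithin
      (mem_of_superset (Icc_mem_nhdsGE hr.2) (Icc_subset_Icc_left hr.1))))
  refine mem_of_superset (Ioo_mem_nhdsGT hb') fun r hr => ?_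
  have hr' : r ∈ Icc t b' := Ioo_subset_Icc_self hr
  have := (extChartAt 𝓘(ℝ, E) (c t)).injOn (hs hr').2 (mem_extChartAt_source _) (hconst r hr')
  exact this.trans hta

theorem eq_of_hasD_zero {c : ℝ → N} {J : Set ℝ} (hJ : J.OrdConnected)
    (h : ∀ t ∈ J, HasD c J t (0 : ℝ →L[ℝ] E)) {a b : ℝ} (ha : a ∈ J) (hb : b ∈ J) :
    c a = c b := by
  wlog hab : a ≤ b generalizing a b
  · exact (this hb ha (le_of_not_ge hab)).symm
  exact (eq_of_hasD_zero_Icc hab fun t ht =>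
    (h t (hJ.out ha hb ht)).mono (hJ.out ha hb)).symm

end Constant

/-! ### Gluing local solutions of an evolution equation -/

section Glue

variable {Λ : Type*} [NormedAddCommGroup Λ] [NormedSpace ℝ Λ]
  {E : Type*} [NormedAddCommGroup E] [NormedSpace ℝ E]
  {N : Type*} [TopologicalSpace N] [ChartedSpace E N]

/-- Local solutions of an evolution equation, depending smoothly on parameters, can be glued to
a global solution if the equation can be solved locally, over a time interval that does not depend
on the initial value. -/
theorem exists_global_solution (Sol : Λ → (ℝ → N) → ℝ → Prop) (Fib : Λ → ℝ → Set N)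
    (sol_congr : ∀ l c c' t, c =ᶠ[𝓝 t] c' → Sol l c t → Sol l c' t)
    (sol_fib : ∀ l c t, Sol l c t → c t ∈ Fib l t)
    (unique : ∀ (l : Λ) (J : Set ℝ) (c c' : ℝ → N), IsOpen J → J.OrdConnected →
      (∀ t ∈ J, Sol l c t) → (∀ t ∈ J, Sol l c' t) → ∀ t₀ ∈ J, c t₀ = c' t₀ → EqOn c c' J)
    (loc : ∀ (l₀ : Λ) (t₀ : ℝ), ∃ ε > 0, ∀ t₁ ∈ Metric.ball t₀ ε, ∀ (W : Set Λ) (x : Λ → N),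
      IsOpen W → l₀ ∈ W → ContMDiffOn 𝓘(ℝ, Λ) 𝓘(ℝ, E) ∞ x W → (∀ l ∈ W, x l ∈ Fib l t₁) →
      ∃ W' ⊆ W, IsOpen W' ∧ l₀ ∈ W' ∧ ∃ c : Λ → ℝ → N,
        ContMDiffOn 𝓘(ℝ, Λ × ℝ) 𝓘(ℝ, E) ∞ (fun z : Λ × ℝ => c z.1 z.2)
          (W' ×ˢ Metric.ball t₀ ε) ∧
        ∀ l ∈ W', c l t₁ = x l ∧ ∀ t ∈ Metric.ball t₀ ε, Sol l (c l) t)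
    (x₀ : Λ → N) (hx₀ : ContMDiff 𝓘(ℝ, Λ) 𝓘(ℝ, E) ∞ x₀) (hx₀' : ∀ l, x₀ l ∈ Fib l 0) :
    ∃ c : Λ → ℝ → N, ContMDiff 𝓘(ℝ, Λ × ℝ) 𝓘(ℝ, E) ∞ (fun z : Λ × ℝ => c z.1 z.2) ∧
      ∀ l, c l 0 = x₀ l ∧ ∀ t, Sol l (c l) t := by
  let good : Λ → ℝ → Set Λ → Set ℝ → (Λ → ℝ → N) → Prop := fun l₀ τ W J c =>
    IsOpen W ∧ l₀ ∈ W ∧ IsOpen J ∧ J.OrdConnected ∧ 0 ∈ J ∧ τ ∈ J ∧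
      ContMDiffOn 𝓘(ℝ, Λ × ℝ) 𝓘(ℝ, E) ∞ (fun z : Λ × ℝ => c z.1 z.2) (W ×ˢ J) ∧
      ∀ l ∈ W, c l 0 = x₀ l ∧ ∀ t ∈ J, Sol l (c l) t
  -- Here ε does not depend on t₁, so near each t₀ either all times are reachable or none is. The
  -- set of reachable times is therefore clopen in ℝ, hence everything.
  have ext_good : ∀ l₀ t₀, ∃ ε > 0, ∀ t₁ ∈ Metric.ball t₀ ε, ∀ t₂ ∈ Metric.ball t₀ ε,
      (∃ W J c, good l₀ t₁ W J c) → ∃ W J c, good l₀ t₂ W J c := by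
    intro l₀ t₀
    obtain ⟨ε, hε, H⟩ := loc l₀ t₀
    refine ⟨ε, hε, ?_⟩
    rintro t₁ ht₁ t₂ ht₂ ⟨W, J, c, hW, hl₀, hJ, hJo, h0, h1, hc, hc'⟩
    have hx : ContMDiffOn 𝓘(ℝ, Λ) 𝓘(ℝ, E) ∞ (fun l => c l t₁) W := by
      have h2 : ContMDiff 𝓘(ℝ, Λ) 𝓘(ℝ, Λ × ℝ) ∞ fun l : Λ => (l, t₁) :=
        ContDiff.contMDiff (by fun_prop)
      exact hc.comp h2.contMDiffOn fun l hl => ⟨hl, h1⟩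
    obtain ⟨W', hWW, hW', hl₀', c', hc₁, hc₂⟩ := H t₁ ht₁ W (fun l => c l t₁) hW hl₀ hx
      (fun l hl => sol_fib _ _ _ ((hc' l hl).2 t₁ h1))
    have hB : (Metric.ball t₀ ε).OrdConnected := (convex_ball t₀ ε).ordConnected
    have hagree : ∀ l ∈ W', EqOn (c l) (c' l) (J ∩ Metric.ball t₀ ε) := by
      intro l hl
      exact unique l _ _ _ (hJ.inter Metric.isOpen_ball) (hJo.inter hB)
        (fun t ht => (hc' l (hWW hl)).2 t ht.1) (fun t ht => (hc₂ l hl).2 t ht.2) t₁ ⟨h1, ht₁⟩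
        (hc₂ l hl).1.symm
    classical
    let C : Λ → ℝ → N := fun l t => if t ∈ J then c l t else c' l t
    have hC1 : ∀ l, EqOn (C l) (c l) J := fun l t ht => if_pos ht
    have hC2 : ∀ l ∈ W', EqOn (C l) (c' l) (Metric.ball t₀ ε) := by
      intro l hl t ht
      by_cases htJ : t ∈ J
      · exact (if_pos htJ).trans (hagree l hl ⟨htJ, ht⟩)
      · exact if_neg htJ
    refine ⟨W', J ∪ Metric.ball t₀ ε, C, hW', hl₀', hJ.union Metric.isOpen_ball, ?_, Or.inl h0,
      Or.inr ht₂, ?_, fun l hl => ⟨?_, ?_⟩⟩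
    · exact ((hJo.isPreconnected.union t₁ h1 ht₁ hB.isPreconnected)).ordConnected
    · rintro ⟨l, t⟩ ⟨hl, ht⟩
      refine ContMDiffAt.contMDiffWithinAt ?_
      rcases ht with ht | ht
      · refine (hc.contMDiffAt ((hW.prod hJ).mem_nhds ⟨hWW hl, ht⟩)).congr_of_eventuallyEq ?_
        filter_upwards [(hW.prod hJ).mem_nhds ⟨hWW hl, ht⟩] with z hz
        exact hC1 z.1 hz.2
      · refine (hc₁.contMDiffAt ((hW'.prod Metric.isOpen_ball).mem_nhds
          ⟨hl, ht⟩)).congr_of_eventuallyEq ?_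
        filter_upwards [(hW'.prod Metric.isOpen_ball).mem_nhds ⟨hl, ht⟩] with z hz
        exact hC2 z.1 hz.1 hz.2
    · exact (hC1 l h0).trans (hc' l (hWW hl)).1
    · rintro t (ht | ht)
      · refine sol_congr _ _ _ _ ?_ ((hc' l (hWW hl)).2 t ht)
        exact ((hC1 l).eventuallyEq_of_mem (hJ.mem_nhds ht)).symm
      · refine sol_congr _ _ _ _ ?_ ((hc₂ l hl).2 t ht)
        exact ((hC2 l hl).eventuallyEq_of_mem (Metric.isOpen_ball.mem_nhds ht)).symm
  have hgood : ∀ l₀ τ, ∃ W J c, good l₀ τ W J c := by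
    intro l₀
    have hclopen : IsClopen {τ | ∃ W J c, good l₀ τ W J c} := by
      constructor
      · rw [← isOpen_compl_iff, Metric.isOpen_iff]
        intro t₀ ht₀
        obtain ⟨ε, hε, H⟩ := ext_good l₀ t₀
        exact ⟨ε, hε, fun t ht h => ht₀ (H t ht t₀ (Metric.mem_ball_self hε) h)⟩
      · rw [Metric.isOpen_iff]
        intro t₀ ht₀
        obtain ⟨ε, hε, H⟩ := ext_good l₀ t₀
        exact ⟨ε, hε, fun t ht => H t₀ (Metric.mem_ball_self hε) t ht ht₀⟩
    have hne : {τ | ∃ W J c, good l₀ τ W J c}.Nonempty := by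
      obtain ⟨ε, hε, H⟩ := loc l₀ 0
      obtain ⟨W', -, hW', hl₀', c, hc₁, hc₂⟩ := H 0 (Metric.mem_ball_self hε) univ x₀ isOpen_univ
        (mem_univ _) hx₀.contMDiffOn fun l _ => hx₀' l
      exact ⟨0, W', Metric.ball 0 ε, c, hW', hl₀', Metric.isOpen_ball,
        (convex_ball _ _).ordConnected, Metric.mem_ball_self hε, Metric.mem_ball_self hε, hc₁,
        hc₂⟩
    intro τ
    have hτ : τ ∈ {τ | ∃ W J c, good l₀ τ W J c} := by
      rw [hclopen.eq_univ hne]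
      exact mem_univ τ
    exact hτ
  choose W J c hc using hgood
  have hagree : ∀ l₀ t₀ l t, l ∈ W l₀ t₀ → t ∈ J l₀ t₀ → c l t l t = c l₀ t₀ l t := by
    intro l₀ t₀ l t hl ht
    obtain ⟨-, -, hJ, hJo, h0, -, -, hS⟩ := hc l₀ t₀
    obtain ⟨-, hl', hJ', hJo', h0', ht', -, hS'⟩ := hc l t
    exact unique l _ _ _ (hJ'.inter hJ) (hJo'.inter hJo) (fun r hr => (hS' l hl').2 r hr.1)
      (fun r hr => (hS l hl).2 r hr.2) 0 ⟨h0', h0⟩ ((hS' l hl').1.trans (hS l hl).1.symm)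
      ⟨ht', ht⟩
  -- Each point (l, t) is given its own local solution. Two of them agree where both are defined,
  -- since both start at `x₀ l` at time 0, so the diagonal is smooth and solves the equation.
  refine ⟨fun l t => c l t l t, fun z => ?_, fun l => ⟨?_, fun t => ?_⟩⟩
  · obtain ⟨hW, hl, hJ, -, -, ht, hsm, -⟩ := hc z.1 z.2
    have hz : W z.1 z.2 ×ˢ J z.1 z.2 ∈ 𝓝 z := (hW.prod hJ).mem_nhds ⟨hl, ht⟩
    refine (hsm.contMDiffAt hz).congr_of_eventuallyEq ?_
    filter_upwards [hz] with w hw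
    exact hagree _ _ _ _ hw.1 hw.2
  · obtain ⟨-, hl, -, -, -, -, -, hS⟩ := hc l 0
    exact (hS l hl).1
  · obtain ⟨-, hl, hJ, -, -, ht, -, hS⟩ := hc l t
    refine sol_congr _ _ _ _ ?_ ((hS l hl).2 t ht)
    filter_upwards [hJ.mem_nhds ht] with r hr
    exact (hagree l t l r hl hr).symm

end Glue

/-! ### Logarithmic derivatives of maps into a Lie group -/

section LogDeriv

variable {E : Type*} [NormedAddCommGroup E] [NormedSpace ℝ E]
  {G : Type*} [TopologicalSpace G] [ChartedSpace E G] [Group G] [LieGroup 𝓘(ℝ, E) ∞ G]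
  {V : Type*} [NormedAddCommGroup V] [NormedSpace ℝ V]

/-- `L` is the logarithmic derivative `f⁻¹ df` of `f` at `x` within `s`. -/
def HasLogD (f : V → G) (s : Set V) (x : V) (L : V →L[ℝ] E) : Prop :=
  HasD (fun z => (f x)⁻¹ * f z) s x L

/-- The differential at `1` of the left translation by `g`. -/
noncomputable def leftD (E : Type*) [NormedAddCommGroup E] [NormedSpace ℝ E] {G : Type*}
    [TopologicalSpace G] [ChartedSpace E G] [Group G] (g : G) : E →L[ℝ] E :=
  mD E E (fun x : G => g * x) 1

theorem hasD_mul_left (g x : G) :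
    HasD (fun z : G => g * z) univ x (mD E E (fun z : G => g * z) x) :=
  ((contMDiff_mul_left (I := 𝓘(ℝ, E)) (n := ∞) (a := g)).mdifferentiable (by simp) x).hasD

theorem hasD_conj (g x : G) :
    HasD (fun z : G => g * z * g⁻¹) univ x (mD E E (fun z : G => g * z * g⁻¹) x) :=
  (((contMDiff_mul_right (I := 𝓘(ℝ, E)) (n := ∞) (a := g⁻¹)).comp
    (contMDiff_mul_left (I := 𝓘(ℝ, E)) (n := ∞) (a := g))).mdifferentiable (by simp) x).hasD

theorem hasD_lieAd (g : G) : HasD (fun z : G => g * z * g⁻¹) univ 1 (lieAd (EG := E) g) :=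
  hasD_conj g 1

theorem HasLogD.hasD {f : V → G} {s : Set V} {x : V} {L : V →L[ℝ] E} (h : HasLogD f s x L) :
    HasD f s x (leftD E (f x) ∘L L) := by
  have h2 := (hasD_mul_left (E := E) (f x) 1).comp_eq (f := fun z => (f x)⁻¹ * f z) h
    (inv_mul_cancel _)
  simp only [mul_inv_cancel_left] at h2
  exact h2

theorem leftD_comp (g : G) :
    mD E E (fun z : G => g⁻¹ * z) g ∘L leftD E g = ContinuousLinearMap.id ℝ E := by
  have h2 := (hasD_mul_left (E := E) g⁻¹ g).comp_eq (hasD_mul_left g (1 : G)) (mul_one g)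
  simp only [inv_mul_cancel_left] at h2
  exact h2.unique_univ (hasD_id _ _)

theorem HasD.hasLogD {f : V → G} {s : Set V} {x : V} {L : V →L[ℝ] E} (h : HasD f s x L) :
    HasLogD f s x (mD E E (fun z : G => (f x)⁻¹ * z) (f x) ∘L L) :=
  (hasD_mul_left _ _).comp_univ h

theorem hasLogD_iff {f : V → G} {s : Set V} {x : V} {L : V →L[ℝ] E} :
    HasLogD f s x L ↔ HasD f s x (leftD E (f x) ∘L L) := by
  refine ⟨HasLogD.hasD, fun h => ?_⟩
  have := h.hasLogD
  rwa [← ContinuousLinearMap.comp_assoc, leftD_comp, ContinuousLinearMap.id_comp] at this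

theorem HasLogD.mono {f : V → G} {s t : Set V} {x : V} {L : V →L[ℝ] E} (h : HasLogD f s x L)
    (hst : t ⊆ s) : HasLogD f t x L := HasD.mono h hst

theorem HasLogD.unique_univ {f : V → G} {x : V} {L L' : V →L[ℝ] E} (h : HasLogD f univ x L)
    (h' : HasLogD f univ x L') : L = L' := HasD.unique_univ h h'

theorem HasLogD.congr_nhds {f g : V → G} {x : V} {L : V →L[ℝ] E} (h : HasLogD f univ x L)
    (hfg : g =ᶠ[𝓝 x] f) : HasLogD g univ x L := by
  rw [hasLogD_iff] at h ⊢
  rw [hfg.self_of_nhds]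
  exact h.congr_nhds hfg

theorem HasLogD.comp {W : Type*} [NormedAddCommGroup W] [NormedSpace ℝ W] {f : V → G}
    {g : W → V} {s : Set W} {t : Set V} {x : W} {L : V →L[ℝ] E} {L' : W →L[ℝ] V}
    (h : HasLogD f t (g x) L) (hg : HasFDerivWithinAt g L' s x) (hst : MapsTo g s t) :
    HasLogD (fun z => f (g z)) s x (L ∘L L') :=
  HasD.comp (g := fun z => (f (g x))⁻¹ * f z) h (hasD_iff_hasFDerivWithinAt.2 hg) hst

theorem hasLogD_const (g : G) (s : Set V) (x : V) :
    HasLogD (fun _ : V => g) s x (0 : V →L[ℝ] E) := hasD_const _ _ _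

theorem HasLogD.const_mul {f : V → G} {s : Set V} {x : V} {L : V →L[ℝ] E} (h : HasLogD f s x L)
    (g : G) : HasLogD (fun z => g * f z) s x L := by
  unfold HasLogD at h ⊢
  simpa only [mul_inv_rev, mul_assoc, inv_mul_cancel_left] using h

theorem HasD.mul_of_eq_one {f g : V → G} {s : Set V} {x : V} {L L' : V →L[ℝ] E}
    (hf : HasD f s x L) (hg : HasD g s x L') (hfx : f x = 1) (hgx : g x = 1) :
    HasD (fun z => f z * g z) s x (L + L') := by
  have h1 := HasD.comp₂ (F := fun p : G × G => p.1 * p.2)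
    ((contMDiff_mul 𝓘(ℝ, E) ∞).mdifferentiable (by simp) _) hf hg
  simp only [hfx, hgx, one_mul, mul_one] at h1
  rwa [(hasD_id univ (1 : G)).mD_eq, ContinuousLinearMap.id_comp,
    ContinuousLinearMap.id_comp] at h1

/-- Normalised to the value 1 at x, the product splits as the conjugate by g(x)⁻¹ of f(x)⁻¹f(z),
times g(x)⁻¹g(z). At the identity the derivative of multiplication is addition. -/
theorem HasLogD.mul {f g : V → G} {s : Set V} {x : V} {L L' : V →L[ℝ] E} (hf : HasLogD f s x L)
    (hg : HasLogD g s x L') :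
    HasLogD (fun z => f z * g z) s x (lieAd (EG := E) (g x)⁻¹ ∘L L + L') := by
  have h1 := (hasD_lieAd (E := E) (g x)⁻¹).comp_eq (f := fun z => (f x)⁻¹ * f z) hf
    (inv_mul_cancel _)
  have h2 := h1.mul_of_eq_one (g := fun z => (g x)⁻¹ * g z) hg (by simp) (by simp)
  unfold HasLogD
  convert h2 using 2 with z
  group

/-- Obtained by differentiating y · y⁻¹ = 1, along the inverse chart because the product rule is
stated for maps on vector spaces. -/
theorem hasD_inv_one : HasD (fun z : G => z⁻¹) univ 1 (-ContinuousLinearMap.id ℝ E) := by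
  have h1 : HasD (fun z : G => z⁻¹) univ 1 (mD E E (fun z : G => z⁻¹) 1) :=
    ((contMDiff_inv 𝓘(ℝ, E) ∞).mdifferentiable (by simp) _).hasD
  have h2 : HasD (extChartAt 𝓘(ℝ, E) (1 : G)).symm univ (extChartAt 𝓘(ℝ, E) (1 : G) 1)
      (ContinuousLinearMap.id ℝ E) := by
    have := hasD_extChartAt_symm (E := E) (mem_extChartAt_target (I := 𝓘(ℝ, E)) (1 : G))
    rwa [mD_extChartAt_symm_self] at this
  have h0 : (extChartAt 𝓘(ℝ, E) (1 : G)).symm (extChartAt 𝓘(ℝ, E) (1 : G) 1) = 1 :=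
    extChartAt_to_inv _
  have h1' : HasD (fun z : G => z⁻¹) univ
      ((extChartAt 𝓘(ℝ, E) (1 : G)).symm (extChartAt 𝓘(ℝ, E) (1 : G) 1))
      (mD E E (fun z : G => z⁻¹) 1) := by rwa [h0]
  have h3 := h2.mul_of_eq_one (h1'.comp_univ h2) h0 (by rw [h0, inv_one])
  simp only [mul_inv_cancel] at h3
  have h4 := h3.unique_univ (hasD_const _ _ _)
  rw [ContinuousLinearMap.comp_id] at h4
  rwa [← eq_neg_of_add_eq_zero_right h4]

theorem HasLogD.inv {f : V → G} {s : Set V} {x : V} {L : V →L[ℝ] E} (hf : HasLogD f s x L) :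
    HasLogD (fun z => (f z)⁻¹) s x (-(lieAd (EG := E) (f x) ∘L L)) := by
  have h1 := (hasD_lieAd (E := E) (f x)).comp_eq (f := fun z => (f x)⁻¹ * f z) hf
    (inv_mul_cancel _)
  have h2 := (hasD_inv_one (E := E) (G := G)).comp_eq h1 (by simp)
  unfold HasLogD
  convert h2 using 2 with z
  · group
  · ext; simp

theorem lieAd_one : lieAd (1 : G) = ContinuousLinearMap.id ℝ E := by
  have := (hasD_lieAd (E := E) (1 : G)).unique_univ
    (by simpa using hasD_id (E := E) univ (1 : G))
  exact this

theorem lieAd_mul (g h : G) : lieAd (EG := E) (g * h) = lieAd g ∘L lieAd h := by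
  have h2 := (hasD_lieAd (E := E) g).comp_eq (hasD_lieAd (E := E) h) (by simp)
  refine (hasD_lieAd (E := E) (g * h)).unique_univ ?_
  convert h2 using 2
  group

theorem lieAd_inv_comp (g : G) :
    lieAd (EG := E) g⁻¹ ∘L lieAd g = ContinuousLinearMap.id ℝ E := by
  rw [← lieAd_mul, inv_mul_cancel, lieAd_one]

/-- Two maps with the same logarithmic derivative differ by a map with logarithmic derivative
zero. -/
theorem HasLogD.mul_inv_self {f g : V → G} {s : Set V} {x : V} {L : V →L[ℝ] E}
    (hf : HasLogD f s x L) (hg : HasLogD g s x L) :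
    HasD (fun z => f z * (g z)⁻¹) s x (0 : V →L[ℝ] E) := by
  have h := hf.mul hg.inv
  rw [inv_inv, add_neg_cancel] at h
  simpa using h.hasD

theorem eq_of_hasLogD [T2Space G] {f g : ℝ → G} {J : Set ℝ} (hJ : J.OrdConnected)
    {b : ℝ → ℝ →L[ℝ] E} (hf : ∀ t ∈ J, HasLogD f J t (b t)) (hg : ∀ t ∈ J, HasLogD g J t (b t))
    {t₀ : ℝ} (h₀ : t₀ ∈ J) (h : f t₀ = g t₀) : EqOn f g J := by
  intro t ht
  have h1 := eq_of_hasD_zero hJ (fun t ht => (hf t ht).mul_inv_self (hg t ht)) ht h₀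
  rw [h, mul_inv_cancel] at h1
  exact mul_inv_eq_one.1 h1

/-- The logarithmic derivative of `f`. -/
noncomputable def logD (E : Type*) [NormedAddCommGroup E] [NormedSpace ℝ E] {G : Type*}
    [TopologicalSpace G] [ChartedSpace E G] [Group G] {V : Type*} [NormedAddCommGroup V]
    [NormedSpace ℝ V] (f : V → G) (x : V) : V →L[ℝ] E :=
  mD V E (fun z => (f x)⁻¹ * f z) x

theorem HasLogD.logD_eq {f : V → G} {x : V} {L : V →L[ℝ] E} (h : HasLogD f univ x L) :
    logD E f x = L := h.mD_eq

theorem hasLogD_logD {f : V → G} {x : V} (h : MDifferentiableAt 𝓘(ℝ, V) 𝓘(ℝ, E) f x) :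
    HasLogD f univ x (logD E f x) := by
  rw [h.hasD.hasLogD.logD_eq]
  exact h.hasD.hasLogD

end LogDeriv

/-! ### Path ordered exponentials and logarithmic derivatives -/

section PathOrderedExp

variable {E : Type*} [NormedAddCommGroup E] [NormedSpace ℝ E]
  {H : Type*} [TopologicalSpace H] [ChartedSpace E H] [Group H] [LieGroup 𝓘(ℝ, E) ∞ H]

theorem isPathOrderedExp_iff {b : ℝ → E} {k : ℝ → H} :
    IsPathOrderedExp (E := E) b k ↔ k 0 = 1 ∧ ∀ s ∈ Icc (0 : ℝ) 1,
      HasLogD k (Icc 0 1) s ((ContinuousLinearMap.id ℝ ℝ).smulRight (b s)) := by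
  refine and_congr_right fun _ => forall₂_congr fun s _ => ?_
  rw [hasLogD_iff]
  have : leftD E (k s) ∘L (ContinuousLinearMap.id ℝ ℝ).smulRight (b s) =
      (ContinuousLinearMap.id ℝ ℝ).smulRight (leftD E (k s) (b s)) := by
    ext; simp
  rw [this]
  rfl

/-- By uniqueness the choice made in the definition is immaterial: any solution on [0, 1] computes
the path ordered exponential. -/
theorem pathOrderedExp_eq [T2Space H] {b : ℝ → E} {k : ℝ → H} (h₀ : k 0 = 1)
    (h : ∀ s ∈ Icc (0 : ℝ) 1,
      HasLogD k (Icc 0 1) s ((ContinuousLinearMap.id ℝ ℝ).smulRight (b s))) :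
    pathOrderedExp (E := E) (H := H) b = k 1 := by
  have hex : ∃ k : ℝ → H, IsPathOrderedExp (E := E) b k := ⟨k, isPathOrderedExp_iff.2 ⟨h₀, h⟩⟩
  have hs := isPathOrderedExp_iff.1 hex.choose_spec
  unfold pathOrderedExp
  rw [dif_pos hex]
  exact eq_of_hasLogD ordConnected_Icc hs.2 h (left_mem_Icc.2 zero_le_one) (hs.1.trans h₀.symm)
    (right_mem_Icc.2 zero_le_one)

end PathOrderedExp

/-! ### Smoothness of derivatives in charts -/

section ChartSmooth

variable {E : Type*} [NormedAddCommGroup E] [NormedSpace ℝ E]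
  {N : Type*} [TopologicalSpace N] [ChartedSpace E N] [IsManifold 𝓘(ℝ, E) ∞ N]
  {V : Type*} [NormedAddCommGroup V] [NormedSpace ℝ V]
  {W : Type*} [NormedAddCommGroup W] [NormedSpace ℝ W]

theorem contDiffAt_extChartAt_comp {f : V → N} {x : V} {n₀ : N}
    (hf : ContMDiffAt 𝓘(ℝ, V) 𝓘(ℝ, E) ∞ f x)
    (hx : f x ∈ (extChartAt 𝓘(ℝ, E) n₀).source) :
    ContDiffAt ℝ ∞ (fun z => extChartAt 𝓘(ℝ, E) n₀ (f z)) x := by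
  rw [extChartAt_source] at hx
  exact ((contMDiffAt_extChartAt' hx).comp x hf).contDiffAt

theorem contMDiffAt_extChartAt_symm {n₀ : N} {y : E} (hy : y ∈ (extChartAt 𝓘(ℝ, E) n₀).target) :
    ContMDiffAt 𝓘(ℝ, E) 𝓘(ℝ, E) ∞ (extChartAt 𝓘(ℝ, E) n₀).symm y :=
  (contMDiffOn_extChartAt_symm n₀).contMDiffAt ((isOpen_extChartAt_target n₀).mem_nhds hy)

theorem mD_eq_fderiv_extChartAt {f : V → N} {x : V}
    (hf : MDifferentiableAt 𝓘(ℝ, V) 𝓘(ℝ, E) f x) :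
    mD V E f x = fderiv ℝ (fun z => extChartAt 𝓘(ℝ, E) (f x) (f z)) x := by
  have h := (hasD_iff_chart.1 hf.hasD).2
  rw [hasFDerivWithinAt_univ] at h
  exact h.fderiv.symm

/-- Since `F z (g z)` is always n₀, all these derivatives are read in one chart, at n₀. With a
moving value the preferred chart would jump with z. -/
theorem contDiffAt_mD_family {F : V → W → N} {g : V → W} {x : V} {n₀ : N}
    (hF : ContMDiffAt 𝓘(ℝ, V × W) 𝓘(ℝ, E) ∞ (fun z : V × W => F z.1 z.2) (x, g x))
    (hg : ContDiffAt ℝ ∞ g x) (h : ∀ z, F z (g z) = n₀) :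
    ContDiffAt ℝ ∞ (fun z => mD W E (F z) (g z)) x := by
  have : IsManifold 𝓘(ℝ, E) 1 N := IsManifold.of_le (n := ∞) (by simp)
  have h1 : ContDiffAt ℝ ∞ (fun z : V × W => extChartAt 𝓘(ℝ, E) n₀ (F z.1 z.2)) (x, g x) :=
    contDiffAt_extChartAt_comp hF (by simp [h x])
  refine (ContDiffAt.fderiv (f := fun z w => extChartAt 𝓘(ℝ, E) n₀ (F z w)) h1 hg
    (by simp)).congr_of_eventuallyEq ?_
  have h2 : ∀ᶠ z in 𝓝 (x, g x), ContMDiffAt 𝓘(ℝ, V × W) 𝓘(ℝ, E) 1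
      (fun z : V × W => F z.1 z.2) z :=
    (contMDiffAt_iff_contMDiffAt_nhds (by simp)).1 (ContMDiffAt.of_le hF (by simp))
  have h3 : Tendsto (fun z => (z, g z)) (𝓝 x) (𝓝 (x, g x)) :=
    (continuousAt_id.prodMk hg.continuousAt)
  filter_upwards [h3.eventually h2] with z hz
  have h4 : ContMDiffAt 𝓘(ℝ, W) 𝓘(ℝ, E) 1 (F z) (g z) := by
    have : ContMDiffAt 𝓘(ℝ, W) 𝓘(ℝ, V × W) 1 (fun w : W => (z, w)) (g z) :=
      ContDiffAt.contMDiffAt (by fun_prop)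
    exact hz.comp (g z) this
  rw [mD_eq_fderiv_extChartAt (h4.mdifferentiableAt (by simp)), h z]

end ChartSmooth

/-! ### The Lie bracket in the chart at 1 and the Maurer–Cartan equation -/

section LieGroupChart

variable {E : Type*} [NormedAddCommGroup E] [NormedSpace ℝ E]
  {G : Type*} [TopologicalSpace G] [ChartedSpace E G] [Group G] [LieGroup 𝓘(ℝ, E) ∞ G]
  {V : Type*} [NormedAddCommGroup V] [NormedSpace ℝ V]

theorem contDiffAt_logD {f : V → G} {x : V} (hf : ContMDiffAt 𝓘(ℝ, V) 𝓘(ℝ, E) ∞ f x) :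
    ContDiffAt ℝ ∞ (logD E f) x := by
  have : IsManifold 𝓘(ℝ, E) ∞ G := inferInstance
  have hfst : ContMDiffAt 𝓘(ℝ, V × V) 𝓘(ℝ, V) ∞ (fun z : V × V => z.1) (x, x) :=
    ContDiffAt.contMDiffAt (by fun_prop)
  have hsnd : ContMDiffAt 𝓘(ℝ, V × V) 𝓘(ℝ, V) ∞ (fun z : V × V => z.2) (x, x) :=
    ContDiffAt.contMDiffAt (by fun_prop)
  have h1 : ContMDiffAt 𝓘(ℝ, V × V) 𝓘(ℝ, E) ∞ (fun z : V × V => (f z.1)⁻¹ * f z.2) (x, x) :=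
    (ContMDiffAt.comp (x, x) (g := f) hf hfst).inv.mul (ContMDiffAt.comp (x, x) (g := f) hf hsnd)
  exact contDiffAt_mD_family (F := fun z w => (f z)⁻¹ * f w) (g := fun z => z) h1 contDiffAt_id
    (n₀ := 1) (by simp)

variable (E G) in
/-- The chart of a Lie group at `1`, evaluated at `1`. -/
noncomputable def chartOne : E := extChartAt 𝓘(ℝ, E) (1 : G) 1

theorem chartOne_mem : chartOne E G ∈ (extChartAt 𝓘(ℝ, E) (1 : G)).target :=
  mem_extChartAt_target _

theorem extChartAt_symm_chartOne : (extChartAt 𝓘(ℝ, E) (1 : G)).symm (chartOne E G) = 1 :=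
  extChartAt_to_inv _

theorem hasLogD_extChartAt_symm :
    HasLogD (extChartAt 𝓘(ℝ, E) (1 : G)).symm univ (chartOne E G)
      (ContinuousLinearMap.id ℝ E) := by
  have h := hasD_extChartAt_symm (chartOne_mem (E := E) (G := G))
  have h2 : mD E E (extChartAt 𝓘(ℝ, E) (1 : G)).symm (chartOne E G) =
    ContinuousLinearMap.id ℝ E := mD_extChartAt_symm_self _
  rw [h2] at h
  unfold HasLogD
  simpa only [extChartAt_symm_chartOne, inv_one, one_mul] using h

variable (E G) in
/-- The trivialisation of the tangent bundle of a Lie group by left translation, in the chart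
at `1`. -/
noncomputable def leftField (y : E) : E →L[ℝ] E :=
  mD E E (extChartAt 𝓘(ℝ, E) (1 : G)) ((extChartAt 𝓘(ℝ, E) (1 : G)).symm y) ∘L
    leftD E ((extChartAt 𝓘(ℝ, E) (1 : G)).symm y)

theorem leftField_chartOne : leftField E G (chartOne E G) = ContinuousLinearMap.id ℝ E := by
  rw [leftField, extChartAt_symm_chartOne, mD_extChartAt_self, leftD]
  simp only [one_mul]
  rw [(hasD_id univ (1 : G)).mD_eq, ContinuousLinearMap.id_comp]

theorem HasLogD.hasFDerivWithinAt {f : V → G} {s : Set V} {x : V} {L : V →L[ℝ] E}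
    (h : HasLogD f s x L) (hx : f x ∈ (extChartAt 𝓘(ℝ, E) (1 : G)).source) :
    HasFDerivWithinAt (fun z => extChartAt 𝓘(ℝ, E) (1 : G) (f z))
      (leftField E G (extChartAt 𝓘(ℝ, E) (1 : G) (f x)) ∘L L) s x := by
  have h1 := (hasD_extChartAt hx).comp_univ h.hasD
  rw [hasD_iff_hasFDerivWithinAt] at h1
  rw [leftField, (extChartAt 𝓘(ℝ, E) (1 : G)).left_inv hx]
  exact h1

/-- This form exhibits `leftField` as a partial derivative, at a fixed point, of a smooth function
of two variables, which yields its smoothness in y. -/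
theorem leftField_eq {y : E} (hy : y ∈ (extChartAt 𝓘(ℝ, E) (1 : G)).target) :
    leftField E G y = fderiv ℝ (fun z => extChartAt 𝓘(ℝ, E) (1 : G)
      ((extChartAt 𝓘(ℝ, E) (1 : G)).symm y * (extChartAt 𝓘(ℝ, E) (1 : G)).symm z))
      (chartOne E G) := by
  have h := (hasLogD_extChartAt_symm (E := E) (G := G)).const_mul
    ((extChartAt 𝓘(ℝ, E) (1 : G)).symm y)
  have h1 : (extChartAt 𝓘(ℝ, E) (1 : G)).symm y *
    (extChartAt 𝓘(ℝ, E) (1 : G)).symm (chartOne E G) = (extChartAt 𝓘(ℝ, E) (1 : G)).symm y := by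
    rw [extChartAt_symm_chartOne, mul_one]
  have h2 := h.hasFDerivWithinAt (by rw [h1]; exact (extChartAt 𝓘(ℝ, E) (1 : G)).map_target hy)
  rw [h1, (extChartAt 𝓘(ℝ, E) (1 : G)).right_inv hy, hasFDerivWithinAt_univ,
    ContinuousLinearMap.comp_id] at h2
  exact h2.fderiv.symm

theorem contDiffAt_leftField {y : E} (hy : y ∈ (extChartAt 𝓘(ℝ, E) (1 : G)).target) :
    ContDiffAt ℝ ∞ (leftField E G) y := by
  have hfst : ContMDiffAt 𝓘(ℝ, E × E) 𝓘(ℝ, E) ∞ (fun z : E × E => z.1) (y, chartOne E G) :=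
    ContDiffAt.contMDiffAt (by fun_prop)
  have hsnd : ContMDiffAt 𝓘(ℝ, E × E) 𝓘(ℝ, E) ∞ (fun z : E × E => z.2) (y, chartOne E G) :=
    ContDiffAt.contMDiffAt (by fun_prop)
  have h1 : ContMDiffAt 𝓘(ℝ, E × E) 𝓘(ℝ, E) ∞ (fun z : E × E =>
      (extChartAt 𝓘(ℝ, E) (1 : G)).symm z.1 * (extChartAt 𝓘(ℝ, E) (1 : G)).symm z.2)
      (y, chartOne E G) :=
    (ContMDiffAt.comp (y, chartOne E G) (contMDiffAt_extChartAt_symm hy) hfst).mul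
      (ContMDiffAt.comp (y, chartOne E G) (contMDiffAt_extChartAt_symm chartOne_mem) hsnd)
  have h2 := contDiffAt_extChartAt_comp (n₀ := 1) h1 (by
    simpa only [extChartAt_symm_chartOne, mul_one] using
      (extChartAt 𝓘(ℝ, E) (1 : G)).map_target hy)
  refine (ContDiffAt.fderiv (f := fun y z => extChartAt 𝓘(ℝ, E) (1 : G)
      ((extChartAt 𝓘(ℝ, E) (1 : G)).symm y * (extChartAt 𝓘(ℝ, E) (1 : G)).symm z)) h2
    (contDiffAt_const (c := chartOne E G)) (m := ∞) (by simp)).congr_of_eventuallyEq ?_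
  filter_upwards [(isOpen_extChartAt_target (I := 𝓘(ℝ, E)) (1 : G)).mem_nhds hy] with z hz
  exact leftField_eq hz

/-- In the chart at 1 the left invariant field of ζ is y ↦ `leftField E G y ζ`, with value ζ at the
base point. What remains is the coordinate formula for the bracket of vector fields. -/
theorem lieBr_eq (ξ η : E) : lieBr G ξ η =
    fderiv ℝ (leftField E G) (chartOne E G) ξ η - fderiv ℝ (leftField E G) (chartOne E G) η ξ := by
  have hV : ∀ ζ : E, (VectorField.mpullbackWithin 𝓘(ℝ, E) 𝓘(ℝ, E)
      (extChartAt 𝓘(ℝ, E) (1 : G)).symm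
      (mulInvariantVectorField (I := 𝓘(ℝ, E)) (G := G) ζ) (range 𝓘(ℝ, E)) : E → E)
      =ᶠ[𝓝 (chartOne E G)] fun y => leftField E G y ζ := by
    intro ζ
    filter_upwards [(isOpen_extChartAt_target (I := 𝓘(ℝ, E)) (1 : G)).mem_nhds chartOne_mem]
      with y hy
    rw [VectorField.mpullbackWithin_apply, modelWithCornersSelf_coe, range_id, mfderivWithin_univ]
    have h1 := mD_extChartAt_comp_symm hy
    have h2 := mD_extChartAt_symm_comp ((extChartAt 𝓘(ℝ, E) (1 : G)).map_target hy)
    rw [(extChartAt 𝓘(ℝ, E) (1 : G)).right_inv hy] at h2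
    have h3 := ContinuousLinearMap.inverse_eq h2 h1
    exact congrArg (fun L : E →L[ℝ] E =>
      L (leftD E ((extChartAt 𝓘(ℝ, E) (1 : G)).symm y) ζ)) h3
  have hd : DifferentiableAt ℝ (leftField E G) (chartOne E G) :=
    (contDiffAt_leftField chartOne_mem).differentiableAt (by simp)
  have hdf : ∀ ζ : E, fderiv ℝ (fun y => leftField E G y ζ) (chartOne E G) =
      (fderiv ℝ (leftField E G) (chartOne E G)).flip ζ := fun ζ => by
    rw [fderiv_clm_apply hd (differentiableAt_const _)]; simp
  -- The pulled back invariant fields are abstracted as A, since only their germs at the base point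
  -- enter the bracket.
  obtain ⟨A, hA, key⟩ : ∃ A : E → E → E,
      (∀ ζ, A ζ =ᶠ[𝓝 (chartOne E G)] fun y => leftField E G y ζ) ∧
      lieBr G ξ η = (mD E E (extChartAt 𝓘(ℝ, E) (1 : G)) (1 : G)).inverse
        (VectorField.lieBracketWithin ℝ (A ξ) (A η)
          ((extChartAt 𝓘(ℝ, E) (1 : G)).symm ⁻¹' univ ∩ range 𝓘(ℝ, E)) (chartOne E G)) :=
    ⟨_, hV, rfl⟩
  rw [key, mD_extChartAt_self, ContinuousLinearMap.inverse_id, ContinuousLinearMap.id_apply,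
    preimage_univ, modelWithCornersSelf_coe, range_id, univ_inter,
    VectorField.lieBracketWithin_univ, VectorField.lieBracket,
    (hA ξ).fderiv_eq, (hA η).fderiv_eq, (hA ξ).self_of_nhds, (hA η).self_of_nhds,
    hdf, hdf]
  simp [leftField_chartOne]

/-- The Maurer–Cartan equation. -/
theorem maurerCartan {f : V → G} {x : V} (hf : ContMDiffAt 𝓘(ℝ, V) 𝓘(ℝ, E) ∞ f x) (v w : V) :
    fderiv ℝ (logD E f) x v w - fderiv ℝ (logD E f) x w v =
      -lieBr G (logD E f x v) (logD E f x w) := by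
  have : IsManifold 𝓘(ℝ, E) 1 G := IsManifold.of_le (n := ∞) (by simp)
  wlog h1 : f x = 1 generalizing f
  · have hg : ContMDiffAt 𝓘(ℝ, V) 𝓘(ℝ, E) ∞ (fun z => (f x)⁻¹ * f z) x :=
      contMDiffAt_const.mul hf
    have heq : logD E (fun z => (f x)⁻¹ * f z) = logD E f := by
      funext z
      simp only [logD, mul_inv_rev, inv_inv, mul_assoc, mul_inv_cancel_left]
    have := this hg (by simp)
    rwa [heq] at this
  have hsrc : ∀ᶠ z in 𝓝 x, f z ∈ (extChartAt 𝓘(ℝ, E) (1 : G)).source :=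
    hf.continuousAt ((isOpen_extChartAt_source (1 : G)).mem_nhds (by simp [h1]))
  have hκ := contDiffAt_extChartAt_comp hf hsrc.self_of_nhds
  have hd : ∀ᶠ z in 𝓝 x, HasFDerivAt (fun z => extChartAt 𝓘(ℝ, E) (1 : G) (f z))
      (leftField E G (extChartAt 𝓘(ℝ, E) (1 : G) (f z)) ∘L logD E f z) z := by
    filter_upwards [hsrc, (contMDiffAt_iff_contMDiffAt_nhds (n := 1) (by simp)).1
      (ContMDiffAt.of_le hf (by simp))] with z hz hfz
    have := (hasLogD_logD (hfz.mdifferentiableAt (by simp))).hasFDerivWithinAt hz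
    rwa [hasFDerivWithinAt_univ] at this
  have hfd : fderiv ℝ (fun z => extChartAt 𝓘(ℝ, E) (1 : G) (f z)) =ᶠ[𝓝 x]
      fun z => leftField E G (extChartAt 𝓘(ℝ, E) (1 : G) (f z)) ∘L logD E f z := by
    filter_upwards [hd] with z hz using hz.fderiv
  have hx1 : extChartAt 𝓘(ℝ, E) (1 : G) (f x) = chartOne E G := by rw [h1]; rfl
  have hL : HasFDerivAt (fun z => leftField E G (extChartAt 𝓘(ℝ, E) (1 : G) (f z)))
      (fderiv ℝ (leftField E G) (chartOne E G) ∘L logD E f x) x := by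
    have h2 := hd.self_of_nhds
    rw [hx1, leftField_chartOne, ContinuousLinearMap.id_comp] at h2
    have h3 : HasFDerivAt (leftField E G) (fderiv ℝ (leftField E G) (chartOne E G))
        (extChartAt 𝓘(ℝ, E) (1 : G) (f x)) := by
      rw [hx1]
      exact ((contDiffAt_leftField chartOne_mem).differentiableAt (by simp)).hasFDerivAt
    exact h3.comp x h2
  have hD := (contDiffAt_logD (E := E) hf).differentiableAt (by simp) |>.hasFDerivAt
  -- In the chart, df is `leftField` along f applied to the logarithmic derivative. Differentiating
  -- this product and antisymmetrising kills the second derivative of f and leaves the exterior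
  -- derivative plus the bracket.
  have h2 := (hL.clm_comp hD).fderiv
  rw [← hfd.fderiv_eq] at h2
  have hsymm := (hκ.isSymmSndFDerivAt (by simpa using ENat.LEInfty.out)).eq v w
  rw [h2] at hsymm
  simp only [add_apply, ContinuousLinearMap.comp_apply,
    ContinuousLinearMap.compL_apply, ContinuousLinearMap.flip_apply, hx1, leftField_chartOne,
    ContinuousLinearMap.id_apply] at hsymm
  rw [lieBr_eq, neg_sub, sub_eq_sub_iff_add_eq_add, hsymm]
  abel

end LieGroupChart

/-! ### Derivatives of the structure maps of a crossed module -/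

namespace LieCrossedModule

variable {EG EH G H : Type*}
  [NormedAddCommGroup EG] [NormedSpace ℝ EG] [NormedAddCommGroup EH] [NormedSpace ℝ EH]
  [TopologicalSpace G] [ChartedSpace EG G] [Group G] [LieGroup 𝓘(ℝ, EG) ∞ G]
  [TopologicalSpace H] [ChartedSpace EH H] [Group H] [LieGroup 𝓘(ℝ, EH) ∞ H]
  (X : LieCrossedModule EG EH G H)
  {V : Type*} [NormedAddCommGroup V] [NormedSpace ℝ V]

theorem hasD_α (g : G) (h : H) :
    HasD (fun x : H => X.α g x) univ h (mD EH EH (fun x : H => X.α g x) h) := by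
  have h1 : ContMDiff 𝓘(ℝ, EH) 𝓘(ℝ, EH) ∞ (fun x : H => X.α g x) :=
    X.contMDiff_α.comp (contMDiff_const.prodMk contMDiff_id)
  exact (h1.mdifferentiable (by simp) h).hasD

theorem hasD_αStarGroup (g : G) : HasD (fun x : H => X.α g x) univ 1 (X.αStarGroup g) :=
  X.hasD_α g 1

theorem hasD_tStar : HasD X.t univ 1 X.tStar :=
  (X.contMDiff_t.mdifferentiable (by simp) 1).hasD

theorem αStarGroup_one : X.αStarGroup 1 = ContinuousLinearMap.id ℝ EH := by
  refine (X.hasD_αStarGroup 1).unique_univ ?_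
  simpa using hasD_id (E := EH) univ (1 : H)

theorem αStarGroup_mul (g g' : G) :
    X.αStarGroup (g * g') = X.αStarGroup g ∘L X.αStarGroup g' := by
  refine (X.hasD_αStarGroup (g * g')).unique_univ ?_
  have := (X.hasD_αStarGroup g).comp_eq (X.hasD_αStarGroup g') (map_one _)
  simpa using this

theorem αStarGroup_inv_comp (g : G) :
    X.αStarGroup g⁻¹ ∘L X.αStarGroup g = ContinuousLinearMap.id ℝ EH := by
  rw [← αStarGroup_mul, inv_mul_cancel, αStarGroup_one]

theorem tStar_comp_αStarGroup (g : G) :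
    X.tStar ∘L X.αStarGroup g = lieAd g ∘L X.tStar := by
  have h1 := X.hasD_tStar.comp_eq (X.hasD_αStarGroup g) (map_one _)
  have h2 := (hasD_lieAd (E := EG) g).comp_eq X.hasD_tStar (map_one _)
  simp only [X.t_α] at h1
  exact h1.unique_univ h2

theorem αStarGroup_t (h : H) : X.αStarGroup (X.t h) = lieAd h := by
  have h1 := X.hasD_αStarGroup (X.t h)
  simp only [X.α_t] at h1
  exact h1.unique_univ (hasD_lieAd h)

theorem contDiffAt_αStarGroup {g : V → G} {x : V} (hg : ContMDiffAt 𝓘(ℝ, V) 𝓘(ℝ, EG) ∞ g x) :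
    ContDiffAt ℝ ∞ (fun z => X.αStarGroup (g z)) x := by
  have heq : ∀ z, X.αStarGroup (g z) = mD EH EH
      (fun y => X.α (g z) ((extChartAt 𝓘(ℝ, EH) (1 : H)).symm y)) (chartOne EH H) := by
    intro z
    have h1 := (X.hasD_αStarGroup (g z)).comp_eq
      (hasLogD_iff.1 (hasLogD_extChartAt_symm (E := EH) (G := H))) extChartAt_symm_chartOne
    rw [extChartAt_symm_chartOne, leftD] at h1
    simp only [one_mul] at h1
    rw [(hasD_id univ (1 : H)).mD_eq, ContinuousLinearMap.id_comp,
      ContinuousLinearMap.comp_id] at h1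
    exact h1.mD_eq.symm
  simp only [heq]
  have hfst : ContMDiffAt 𝓘(ℝ, V × EH) 𝓘(ℝ, V) ∞ (fun z : V × EH => z.1) (x, chartOne EH H) :=
    ContDiffAt.contMDiffAt (by fun_prop)
  have hsnd : ContMDiffAt 𝓘(ℝ, V × EH) 𝓘(ℝ, EH) ∞ (fun z : V × EH => z.2) (x, chartOne EH H) :=
    ContDiffAt.contMDiffAt (by fun_prop)
  refine contDiffAt_mD_family (n₀ := (1 : H)) (g := fun _ => chartOne EH H)
    (F := fun z y => X.α (g z) ((extChartAt 𝓘(ℝ, EH) (1 : H)).symm y)) ?_ contDiffAt_const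
    (fun z => by rw [extChartAt_symm_chartOne, map_one])
  have h1 := (ContMDiffAt.comp (x, chartOne EH H) (g := g) hg hfst).prodMk
    (ContMDiffAt.comp (x, chartOne EH H)
      (contMDiffAt_extChartAt_symm (chartOne_mem (E := EH) (G := H))) hsnd)
  exact X.contMDiff_α.contMDiffAt.comp (x, chartOne EH H) h1

/-- The map `α_* : 𝔤 × 𝔥 → 𝔥` as a bilinear map. -/
noncomputable def αStarL : EG →L[ℝ] EH →L[ℝ] EH :=
  fderiv ℝ (fun y => X.αStarGroup ((extChartAt 𝓘(ℝ, EG) (1 : G)).symm y)) (chartOne EG G)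

theorem hasD_αStarGroup_one : HasD (fun g : G => X.αStarGroup g) univ 1 X.αStarL := by
  have h1 : HasFDerivAt (fun y => X.αStarGroup ((extChartAt 𝓘(ℝ, EG) (1 : G)).symm y))
      X.αStarL (chartOne EG G) :=
    ((X.contDiffAt_αStarGroup (contMDiffAt_extChartAt_symm chartOne_mem)).differentiableAt
      (by simp)).hasFDerivAt
  have h2 : HasD (extChartAt 𝓘(ℝ, EG) (1 : G)) univ 1 (ContinuousLinearMap.id ℝ EG) := by
    have := hasD_extChartAt (E := EG) (mem_extChartAt_source (I := 𝓘(ℝ, EG)) (1 : G))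
    rwa [mD_extChartAt_self] at this
  have h3 := (hasD_univ_iff_hasFDerivAt.2 h1).comp_eq h2 rfl
  rw [ContinuousLinearMap.comp_id] at h3
  refine h3.congr_nhds ?_
  filter_upwards [(isOpen_extChartAt_source (I := 𝓘(ℝ, EG)) (1 : G)).mem_nhds
    (mem_extChartAt_source _)] with g hg
  rw [(extChartAt 𝓘(ℝ, EG) (1 : G)).left_inv hg]

theorem αStar_eq (ξ : EG) (η : EH) : X.αStar ξ η = X.αStarL ξ η := by
  have h1 : HasD (fun L : EH →L[ℝ] EH => L η) univ (X.αStarGroup 1)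
      (ContinuousLinearMap.apply ℝ EH η) :=
    hasD_univ_iff_hasFDerivAt.2 (ContinuousLinearMap.apply ℝ EH η).hasFDerivAt
  have h2 := (h1.comp_eq X.hasD_αStarGroup_one rfl).mD_eq
  exact congrArg (fun L : EG →L[ℝ] EH => L ξ) h2

/-- Writing α_{g(z)} as α_{g(x)} composed with α of g(x)⁻¹g(z) reduces the derivative to the one at
the identity. -/
theorem hasFDerivWithinAt_αStarGroup {g : V → G} {s : Set V} {x : V} {L : V →L[ℝ] EG}
    (hg : HasLogD g s x L) :
    HasFDerivWithinAt (fun z => X.αStarGroup (g z))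
      (ContinuousLinearMap.compL ℝ EH EH EH (X.αStarGroup (g x)) ∘L X.αStarL ∘L L) s x := by
  have h1 := X.hasD_αStarGroup_one.comp_eq (f := fun z => (g x)⁻¹ * g z) hg (inv_mul_cancel _)
  rw [hasD_iff_hasFDerivWithinAt] at h1
  have h2 := (ContinuousLinearMap.compL ℝ EH EH EH
    (X.αStarGroup (g x))).hasFDerivAt.comp_hasFDerivWithinAt x h1
  refine h2.congr_of_eventuallyEq (Eventually.of_forall fun z => ?_) ?_ <;>
  simp [← αStarGroup_mul]

/-- Differentiate α_{g g' g⁻¹} = α_g α_{g'} α_{g⁻¹} in g' at 1. -/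
theorem αStarL_lieAd (g : G) (ξ : EG) (η : EH) :
    X.αStarL (lieAd g ξ) (X.αStarGroup g η) = X.αStarGroup g (X.αStarL ξ η) := by
  have h1 := X.hasD_αStarGroup_one.comp_eq (hasD_lieAd (E := EG) g) (by simp)
  have h2 : HasD (fun L : EH →L[ℝ] EH => X.αStarGroup g ∘L L ∘L X.αStarGroup g⁻¹) univ
      (X.αStarGroup 1)
      (ContinuousLinearMap.compL ℝ EH EH EH (X.αStarGroup g) ∘L
        (ContinuousLinearMap.compL ℝ EH EH EH).flip (X.αStarGroup g⁻¹)) :=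
    hasD_univ_iff_hasFDerivAt.2 (ContinuousLinearMap.hasFDerivAt
      (ContinuousLinearMap.compL ℝ EH EH EH (X.αStarGroup g) ∘L
        (ContinuousLinearMap.compL ℝ EH EH EH).flip (X.αStarGroup g⁻¹)))
  have h3 := h2.comp_eq X.hasD_αStarGroup_one rfl
  simp only [← αStarGroup_mul, ← mul_assoc] at h3
  have h4 := congrArg (fun L : EG →L[ℝ] EH →L[ℝ] EH => L ξ (X.αStarGroup g η)) (h1.unique_univ h3)
  have h5 : X.αStarGroup g⁻¹ (X.αStarGroup g η) = η :=
    congrArg (fun L : EH →L[ℝ] EH => L η) (X.αStarGroup_inv_comp g)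
  simpa [h5] using h4

end LieCrossedModule

/-! ### The adjoint action and its derivative, the bracket -/

section Adjoint

variable {E : Type*} [NormedAddCommGroup E] [NormedSpace ℝ E]
  {G : Type*} [TopologicalSpace G] [ChartedSpace E G] [Group G] [LieGroup 𝓘(ℝ, E) ∞ G]
  {V : Type*} [NormedAddCommGroup V] [NormedSpace ℝ V]

variable (E G) in
/-- The crossed module of a Lie group acting on itself by conjugation. -/
def LieCrossedModule.conj : LieCrossedModule E E G G where
  t := MonoidHom.id G
  α := MulAut.conj
  contMDiff_t := contMDiff_id
  contMDiff_α := (contMDiff_fst.mul contMDiff_snd).mul contMDiff_fst.inv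
  t_α := fun _ _ => rfl
  α_t := fun _ _ => rfl

/-- For conjugation this says that ad is the derivative of Ad. Apply the Maurer–Cartan equation to
f(y, z) = ψ(y)ψ(z)⁻¹, with ψ the inverse chart at 1: the logarithmic derivative of f is Ad_{ψ(z)}
applied to that of ψ at y minus that at z. On mixed arguments at (e, e), its exterior derivative
sees only the derivative of z ↦ Ad_{ψ(z)}. -/
theorem LieCrossedModule.conj_αStarL (η ξ : E) : (conj E G).αStarL η ξ = lieBr G η ξ := by
  let φ := extChartAt 𝓘(ℝ, E) (1 : G)
  let e := chartOne E G
  have he : e ∈ φ.target := chartOne_mem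
  have hopen : φ.target ∈ 𝓝 e := (isOpen_extChartAt_target (1 : G)).mem_nhds he
  have hψ1 : φ.symm e = 1 := extChartAt_symm_chartOne
  have hψ : ContMDiffAt 𝓘(ℝ, E) 𝓘(ℝ, E) ∞ φ.symm e := contMDiffAt_extChartAt_symm he
  have hfst : ContMDiffAt 𝓘(ℝ, E × E) 𝓘(ℝ, E) ∞ (fun z : E × E => z.1) (e, e) :=
    ContDiffAt.contMDiffAt (by fun_prop)
  have hsnd : ContMDiffAt 𝓘(ℝ, E × E) 𝓘(ℝ, E) ∞ (fun z : E × E => z.2) (e, e) :=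
    ContDiffAt.contMDiffAt (by fun_prop)
  let f : E × E → G := fun z => φ.symm z.1 * (φ.symm z.2)⁻¹
  have hf : ContMDiffAt 𝓘(ℝ, E × E) 𝓘(ℝ, E) ∞ f (e, e) :=
    (ContMDiffAt.comp (e, e) (g := φ.symm) hψ hfst).mul
      (ContMDiffAt.comp (e, e) (g := φ.symm) hψ hsnd).inv
  have hψl : ∀ y ∈ φ.target, HasLogD φ.symm univ y (logD E φ.symm y) := fun y hy =>
    hasLogD_logD ((contMDiffAt_extChartAt_symm hy).mdifferentiableAt (by simp))
  have hlog : ∀ z ∈ φ.target ×ˢ φ.target, logD E f z =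
      lieAd (φ.symm z.2) ∘L (logD E φ.symm z.1 ∘L ContinuousLinearMap.fst ℝ E E) +
        -(lieAd (φ.symm z.2) ∘L (logD E φ.symm z.2 ∘L ContinuousLinearMap.snd ℝ E E)) := by
    rintro z ⟨h1, h2⟩
    have h3 := HasLogD.comp (s := univ) (hψl z.1 h1)
      (hasFDerivAt_fst (𝕜 := ℝ) (p := z)).hasFDerivWithinAt (mapsTo_univ _ _)
    have h4 := HasLogD.comp (s := univ) (hψl z.2 h2)
      (hasFDerivAt_snd (𝕜 := ℝ) (p := z)).hasFDerivWithinAt (mapsTo_univ _ _)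
    have h5 := h3.mul h4.inv
    rw [inv_inv] at h5
    exact h5.logD_eq
  have hlog1 : logD E φ.symm e = ContinuousLinearMap.id ℝ E := hasLogD_extChartAt_symm.logD_eq
  have hd : DifferentiableAt ℝ (logD E f) (e, e) :=
    (contDiffAt_logD hf).differentiableAt (by simp)
  -- derivatives along the coordinate directions
  have hA : fderiv ℝ (logD E f) (e, e) (ξ, 0) (0, η) = 0 := by
    have h1 : HasFDerivAt (fun y : E => (y, e)) (ContinuousLinearMap.inl ℝ E E) e :=
      hasFDerivAt_prodMk_left e e
    have h2 := (HasFDerivAt.comp (g := logD E f) (f := fun y => (y, e)) e hd.hasFDerivAt h1).clm_apply (hasFDerivAt_const ((0, η) : E × E) e)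
    have h3 : (fun y => (logD E f ∘ fun y : E => (y, e)) y ((0, η) : E × E)) =ᶠ[𝓝 e]
        fun _ => -η := by
      filter_upwards [hopen] with y hy
      simp [hlog (y, e) ⟨hy, he⟩, hψ1, lieAd_one, hlog1]
    have h4 := (h2.congr_of_eventuallyEq h3.symm).unique (hasFDerivAt_const (-η) e)
    simpa using congrArg (fun L : E →L[ℝ] E => L ξ) h4
  have hB : fderiv ℝ (logD E f) (e, e) (0, η) (ξ, 0) = (conj E G).αStarL η ξ := by
    have h1 : HasFDerivAt (fun y : E => (e, y)) (ContinuousLinearMap.inr ℝ E E) e :=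
      hasFDerivAt_prodMk_right e e
    have h2 := (HasFDerivAt.comp (g := logD E f) (f := fun y => (e, y)) e hd.hasFDerivAt h1).clm_apply (hasFDerivAt_const ((ξ, 0) : E × E) e)
    have h3 : (fun y => (logD E f ∘ fun y : E => (e, y)) y ((ξ, 0) : E × E)) =ᶠ[𝓝 e]
        fun y => lieAd (φ.symm y) ξ := by
      filter_upwards [hopen] with y hy
      simp [hlog (e, y) ⟨he, hy⟩, hlog1]
    have h5 := ((conj E G).hasFDerivWithinAt_αStarGroup
      (hasLogD_extChartAt_symm (E := E) (G := G)))
    rw [hasFDerivWithinAt_univ] at h5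
    have h6 := h5.clm_apply (hasFDerivAt_const ξ e)
    have h4 := (h2.congr_of_eventuallyEq h3.symm).unique h6
    have := congrArg (fun L : E →L[ℝ] E => L η) h4
    rw [extChartAt_symm_chartOne] at this
    simpa [αStarGroup_one] using this
  have hMC := maurerCartan hf (0, η) (ξ, 0)
  rw [hA, hB, hlog (e, e) ⟨he, he⟩] at hMC
  simp only [hψ1, lieAd_one, hlog1] at hMC
  simpa [lieBr_eq, sub_eq_add_neg, add_comm] using hMC

variable (E G) in
/-- The bracket of the Lie algebra of a Lie group as a bilinear map. -/
noncomputable def lieBrL : E →L[ℝ] E →L[ℝ] E := (LieCrossedModule.conj E G).αStarL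

theorem lieBr_eq_lieBrL (ξ η : E) : lieBr G ξ η = lieBrL E G ξ η :=
  (LieCrossedModule.conj_αStarL ξ η).symm

theorem lieBr_swap (ξ η : E) : lieBr G ξ η = -lieBr G η ξ := by rw [lieBr_eq, lieBr_eq, neg_sub]

theorem lieBr_jacobi [CompleteSpace E] (ξ η ζ : E) :
    lieBrL E G ξ (lieBrL E G η ζ) =
      lieBrL E G (lieBrL E G ξ η) ζ + lieBrL E G η (lieBrL E G ξ ζ) := by
  have : LieGroup 𝓘(ℝ, E) (minSmoothness ℝ 3) G :=
    LieGroup.of_le (n := ∞) (by simpa using ENat.LEInfty.out)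
  simp only [← lieBr_eq_lieBrL]
  have h : ∀ ξ η ζ : GroupLieAlgebra 𝓘(ℝ, E) G, ⁅ξ, ⁅η, ζ⁆⁆ = ⁅⁅ξ, η⁆, ζ⁆ + ⁅η, ⁅ξ, ζ⁆⁆ :=
    fun ξ η ζ => leibniz_lie ξ η ζ
  exact h ξ η ζ

end Adjoint

/-! ### The infinitesimal crossed module identities -/

namespace LieCrossedModule

variable {EG EH G H : Type*}
  [NormedAddCommGroup EG] [NormedSpace ℝ EG] [NormedAddCommGroup EH] [NormedSpace ℝ EH]
  [TopologicalSpace G] [ChartedSpace EG G] [Group G] [LieGroup 𝓘(ℝ, EG) ∞ G]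
  [TopologicalSpace H] [ChartedSpace EH H] [Group H] [LieGroup 𝓘(ℝ, EH) ∞ H]
  (X : LieCrossedModule EG EH G H)

/-- Differentiate t_* ∘ (α_g)_* = Ad_g ∘ t_* in g at 1; the right side gives ad by `conj_αStarL`. -/
theorem tStar_αStarL (ξ : EG) (η : EH) :
    X.tStar (X.αStarL ξ η) = lieBr G ξ (X.tStar η) := by
  have h1 : HasD (fun L : EH →L[ℝ] EH => X.tStar ∘L L) univ (X.αStarGroup 1)
      (ContinuousLinearMap.compL ℝ EH EH EG X.tStar) :=
    hasD_univ_iff_hasFDerivAt.2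
      (ContinuousLinearMap.hasFDerivAt (ContinuousLinearMap.compL ℝ EH EH EG X.tStar))
  have h2 : HasD (fun L : EG →L[ℝ] EG => L ∘L X.tStar) univ ((conj EG G).αStarGroup 1)
      ((ContinuousLinearMap.compL ℝ EH EG EG).flip X.tStar) :=
    hasD_univ_iff_hasFDerivAt.2
      (ContinuousLinearMap.hasFDerivAt ((ContinuousLinearMap.compL ℝ EH EG EG).flip X.tStar))
  have h3 := h1.comp_eq X.hasD_αStarGroup_one rfl
  have h4 := h2.comp_eq (conj EG G).hasD_αStarGroup_one rfl
  simp only [tStar_comp_αStarGroup] at h3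
  have h5 := congrArg (fun L : EG →L[ℝ] EH →L[ℝ] EG => L ξ η) (h3.unique_univ h4)
  rw [← conj_αStarL]
  exact h5

/-- The infinitesimal Peiffer identity, from (α_{t(h)})_* = Ad_h. It makes ker t_* central in 𝔥, and
it turns α_*(A, ·) into a bracket wherever A is a value of t_*. -/
theorem αStarL_tStar (ξ η : EH) : X.αStarL (X.tStar ξ) η = lieBr H ξ η := by
  have h1 := X.hasD_αStarGroup_one.comp_eq X.hasD_tStar (map_one _)
  simp only [αStarGroup_t] at h1
  rw [← conj_αStarL]
  exact congrArg (fun L : EH →L[ℝ] EH →L[ℝ] EH => L ξ η)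
    (h1.unique_univ (conj EH H).hasD_αStarGroup_one)

end LieCrossedModule

/-! ### Evolution equations in Lie groups -/

section GroupODE

variable {E : Type u} [NormedAddCommGroup E] [NormedSpace ℝ E] [FiniteDimensional ℝ E]
  {G : Type*} [TopologicalSpace G] [ChartedSpace E G] [Group G] [LieGroup 𝓘(ℝ, E) ∞ G]
  {Λ : Type} [NormedAddCommGroup Λ] [NormedSpace ℝ Λ] [FiniteDimensional ℝ Λ]

theorem hasLogD_extChartAt_symm_comp {V : Type*} [NormedAddCommGroup V] [NormedSpace ℝ V]
    {x : V → E} {s : Set V} {z : V} {L : V →L[ℝ] E}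
    (hz : x z ∈ (extChartAt 𝓘(ℝ, E) (1 : G)).target)
    (hx : HasFDerivWithinAt x (leftField E G (x z) ∘L L) s z) :
    HasLogD (fun z => (extChartAt 𝓘(ℝ, E) (1 : G)).symm (x z)) s z L := by
  have h1 := (hasD_extChartAt_symm hz).comp_univ (hasD_iff_hasFDerivWithinAt.2 hx)
  have h2 := mD_extChartAt_symm_comp ((extChartAt 𝓘(ℝ, E) (1 : G)).map_target hz)
  rw [(extChartAt 𝓘(ℝ, E) (1 : G)).right_inv hz] at h2
  rw [leftField, ← ContinuousLinearMap.comp_assoc, ← ContinuousLinearMap.comp_assoc, h2,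
    ContinuousLinearMap.id_comp] at h1
  exact hasLogD_iff.2 h1

/-- In the chart at 1 the equation is x' = `leftField` at x applied to b. A left translation, which
preserves logarithmic derivatives, moves the value 1 to any time t₁ in the interval, so a single ε
serves all t₁. -/
theorem exists_local_group_ode {U : Set (Λ × ℝ)} (hU : IsOpen U) {b : Λ × ℝ → E}
    (hb : ContDiffOn ℝ ∞ b U) {l₀ : Λ} {t₀ : ℝ} (h₀ : (l₀, t₀) ∈ U) :
    ∃ ε > 0, (Metric.ball l₀ ε ×ˢ Metric.ball t₀ ε ⊆ U) ∧ ∀ t₁ ∈ Metric.ball t₀ ε,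
      ∃ k : Λ → ℝ → G,
        ContMDiffOn 𝓘(ℝ, Λ × ℝ) 𝓘(ℝ, E) ∞ (fun z : Λ × ℝ => k z.1 z.2)
          (Metric.ball l₀ ε ×ˢ Metric.ball t₀ ε) ∧
        ∀ l ∈ Metric.ball l₀ ε, k l t₁ = 1 ∧ ∀ t ∈ Metric.ball t₀ ε,
          HasLogD (k l) univ t ((ContinuousLinearMap.id ℝ ℝ).smulRight (b (l, t))) := by
  let φ := extChartAt 𝓘(ℝ, E) (1 : G)
  let Ω : Set (Λ × ℝ × E) := {z | (z.1, z.2.1) ∈ U ∧ z.2.2 ∈ φ.target}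
  have hΩ : IsOpen Ω := (hU.preimage (by fun_prop : Continuous fun z : Λ × ℝ × E => (z.1, z.2.1))).inter
    ((isOpen_extChartAt_target (I := 𝓘(ℝ, E)) (1 : G)).preimage
      (by fun_prop : Continuous fun z : Λ × ℝ × E => z.2.2))
  have hf : ContDiffOn ℝ ∞ (fun z : Λ × ℝ × E => leftField E G z.2.2 (b (z.1, z.2.1))) Ω := by
    refine ContDiffOn.clm_apply (fun z hz => ?_) ?_
    · exact (ContDiffAt.comp z (contDiffAt_leftField hz.2)
        (by fun_prop : ContDiffAt ℝ ∞ (fun z : Λ × ℝ × E => z.2.2) z)).contDiffWithinAt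
    · exact hb.comp (by fun_prop : ContDiffOn ℝ ∞ (fun z : Λ × ℝ × E => (z.1, z.2.1)) Ω)
        fun z hz => hz.1
  obtain ⟨ε, hε, x, hx, hsol⟩ := exists_local_ode_solution hΩ hf (l₀ := l₀) (t₀ := t₀)
    (x₀ := chartOne E G) ⟨h₀, chartOne_mem⟩
  have hsub : Metric.ball l₀ ε ×ˢ Metric.ball t₀ ε ⊆ U := fun z hz =>
    ((hsol z.1 hz.1).2 z.2 hz.2).1.1
  let k : Λ → ℝ → G := fun l t => φ.symm (x (l, t))
  have hk : ContMDiffOn 𝓘(ℝ, Λ × ℝ) 𝓘(ℝ, E) ∞ (fun z : Λ × ℝ => k z.1 z.2)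
      (Metric.ball l₀ ε ×ˢ Metric.ball t₀ ε) :=
    (contMDiffOn_extChartAt_symm (1 : G)).comp hx.contMDiffOn
      fun z hz => ((hsol z.1 hz.1).2 z.2 hz.2).1.2
  have hlog : ∀ l ∈ Metric.ball l₀ ε, ∀ t ∈ Metric.ball t₀ ε,
      HasLogD (k l) univ t ((ContinuousLinearMap.id ℝ ℝ).smulRight (b (l, t))) := by
    intro l hl t ht
    obtain ⟨h1, h2⟩ := (hsol l hl).2 t ht
    refine hasLogD_extChartAt_symm_comp h1.2 ?_
    rw [hasFDerivWithinAt_univ]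
    refine h2.hasFDerivAt.congr_fderiv ?_
    ext
    simp
  refine ⟨ε, hε, hsub, fun t₁ ht₁ => ⟨fun l t => (k l t₁)⁻¹ * k l t, ?_, fun l hl =>
    ⟨inv_mul_cancel _, fun t ht => (hlog l hl t ht).const_mul _⟩⟩⟩
  have h1 : ContMDiffOn 𝓘(ℝ, Λ × ℝ) 𝓘(ℝ, E) ∞ (fun z : Λ × ℝ => k z.1 t₁)
      (Metric.ball l₀ ε ×ˢ Metric.ball t₀ ε) := by
    have h2 : ContMDiff 𝓘(ℝ, Λ × ℝ) 𝓘(ℝ, Λ × ℝ) ∞ fun z : Λ × ℝ => (z.1, t₁) :=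
      ContDiff.contMDiff (by fun_prop)
    exact hk.comp h2.contMDiffOn fun z hz => ⟨hz.1, ht₁⟩
  exact h1.inv.mul hk

/-- Left translating the local solution by `x l` reaches every initial value over the same time
interval, which is what the gluing argument asks for. -/
theorem exists_group_ode [T2Space G] {b : Λ × ℝ → E} (hb : ContDiff ℝ ∞ b) :
    ∃ k : Λ → ℝ → G, ContMDiff 𝓘(ℝ, Λ × ℝ) 𝓘(ℝ, E) ∞ (fun z : Λ × ℝ => k z.1 z.2) ∧
      ∀ l, k l 0 = 1 ∧ ∀ t,
        HasLogD (k l) univ t ((ContinuousLinearMap.id ℝ ℝ).smulRight (b (l, t))) := by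
  refine exists_global_solution (Sol := fun l c t =>
      HasLogD c univ t ((ContinuousLinearMap.id ℝ ℝ).smulRight (b (l, t))))
    (Fib := fun _ _ => univ) (fun l c c' t h h' => h'.congr_nhds h.symm)
    (fun _ _ _ _ => mem_univ _) ?_ ?_ (fun _ => 1) contMDiff_const (fun _ => mem_univ _)
  · intro l J c c' hJ hJo hc hc' t₀ ht₀ h
    exact eq_of_hasLogD hJo (fun t ht => (hc t ht).mono (subset_univ _))
      (fun t ht => (hc' t ht).mono (subset_univ _)) ht₀ h
  · intro l₀ t₀
    obtain ⟨ε, hε, -, H⟩ := exists_local_group_ode (G := G) isOpen_univ hb.contDiffOn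
      (mem_univ (l₀, t₀))
    refine ⟨ε, hε, fun t₁ ht₁ W x hW hl₀ hx _ => ?_⟩
    obtain ⟨k, hk, hk'⟩ := H t₁ ht₁
    refine ⟨W ∩ Metric.ball l₀ ε, inter_subset_left, hW.inter Metric.isOpen_ball,
      ⟨hl₀, Metric.mem_ball_self hε⟩, fun l t => x l * k l t, ?_, fun l hl => ⟨?_, fun t ht => ?_⟩⟩
    · have h2 : ContMDiff 𝓘(ℝ, Λ × ℝ) 𝓘(ℝ, Λ) ∞ fun z : Λ × ℝ => z.1 :=
        ContDiff.contMDiff (by fun_prop)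
      exact (hx.comp h2.contMDiffOn fun z hz => hz.1.1).mul
        (hk.mono (prod_mono inter_subset_right subset_rfl))
    · change x l * k l t₁ = x l
      rw [(hk' l hl.2).1, mul_one]
    · exact ((hk' l hl.2).2 t ht).const_mul _

end GroupODE

/-! ### Smooth families of alternating maps -/

section FormCalculus

variable {E F W V : Type*} [NormedAddCommGroup E] [NormedSpace ℝ E]
  [NormedAddCommGroup W] [NormedSpace ℝ W] [NormedAddCommGroup V] [NormedSpace ℝ V] {k : ℕ}

theorem ContDiffAt.alternating_apply [FiniteDimensional ℝ E] {θ : V → E [⋀^Fin k]→L[ℝ] W}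
    {v : V → Fin k → E} {x : V} (hθ : ContDiffAt ℝ ∞ θ x)
    (hv : ∀ i, ContDiffAt ℝ ∞ (fun z => v z i) x) :
    ContDiffAt ℝ ∞ (fun z => θ z (v z)) x := by
  let b := Module.finBasis ℝ E
  have h : ∀ z, θ z (v z) = ∑ r : Fin k → Fin (Module.finrank ℝ E),
      (∏ i, b.coord (r i) (v z i)) • θ z (fun i => b (r i)) := by
    intro z
    have h1 : v z = fun i => ∑ j, b.coord j (v z i) • b j := by
      funext i
      exact (b.sum_repr (v z i)).symm
    conv_lhs => rw [h1]
    have h2 := (θ z).toMultilinearMap.map_sum (fun i j => b.coord j (v z i) • b j)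
    refine h2.trans (Finset.sum_congr rfl fun r _ => ?_)
    exact (θ z).toMultilinearMap.map_smul_univ _ _
  simp only [h]
  refine ContDiffAt.sum fun r _ => ContDiffAt.smul (contDiffAt_prod fun i _ => ?_) ?_
  · exact (LinearMap.toContinuousLinearMap (b.coord (r i))).contDiff.contDiffAt.comp x (hv i)
  · exact (ContinuousAlternatingMap.apply ℝ E W (fun i => b (r i))).contDiff.contDiffAt.comp x hθ

/-- Evaluation on tuples of basis vectors is an injective linear map T, and in finite dimension a
left inverse of T is continuous. -/
theorem contDiffAt_alternating [FiniteDimensional ℝ E] [FiniteDimensional ℝ W]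
    {θ : V → E [⋀^Fin k]→L[ℝ] W} {x : V}
    (h : ∀ v : Fin k → E, ContDiffAt ℝ ∞ (fun z => θ z v) x) : ContDiffAt ℝ ∞ θ x := by
  let b := Module.finBasis ℝ E
  let T : (E [⋀^Fin k]→L[ℝ] W) →ₗ[ℝ] ((Fin k → Fin (Module.finrank ℝ E)) → W) :=
    { toFun := fun θ r => θ fun i => b (r i)
      map_add' := fun _ _ => rfl
      map_smul' := fun _ _ => rfl }
  have hT : LinearMap.ker T = ⊥ := by
    rw [LinearMap.ker_eq_bot']
    intro θ hθ
    ext v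
    have h1 : v = fun i => ∑ j, b.coord j (v i) • b j := by
      funext i
      exact (b.sum_repr (v i)).symm
    rw [h1]
    have h2 := θ.toMultilinearMap.map_sum (fun i j => b.coord j (v i) • b j)
    refine h2.trans (Finset.sum_eq_zero fun r _ => ?_)
    refine (θ.toMultilinearMap.map_smul_univ _ _).trans ?_
    have h3 : θ.toMultilinearMap (fun i => b (r i)) = 0 := congrFun hθ r
    rw [h3, smul_zero]
  obtain ⟨R, hR⟩ := T.exists_leftInverse_of_injective hT
  have h1 : θ = fun z => LinearMap.toContinuousLinearMap R (T (θ z)) := by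
    funext z
    exact (congrArg (fun L => L (θ z)) hR).symm
  rw [h1]
  refine (LinearMap.toContinuousLinearMap R).contDiff.contDiffAt.comp x ?_
  exact contDiffAt_pi.2 fun r => h _

end FormCalculus

/-! ### Pullbacks of forms on manifolds to vector spaces -/

section Pullback

variable {E : Type*} [NormedAddCommGroup E] [NormedSpace ℝ E]
  {N : Type*} [TopologicalSpace N] [ChartedSpace E N] [IsManifold 𝓘(ℝ, E) ∞ N]
  {W : Type*} [NormedAddCommGroup W] [NormedSpace ℝ W]
  {V : Type*} [NormedAddCommGroup V] [NormedSpace ℝ V] {k : ℕ}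

/-- The pullback of a form under a map defined on a vector space. -/
noncomputable def mpull (f : V → N) (θ : MForm E N k W) (x : V) : V [⋀^Fin k]→L[ℝ] W :=
  ContinuousAlternatingMap.compContinuousLinearMap (M := E) (M' := V)
    (show E [⋀^Fin k]→L[ℝ] W from θ (f x)) (mD V E f x)

theorem mpull_eq_chart {f : V → N} {θ : MForm E N k W} {x : V} {p₀ : N}
    (hf : MDifferentiableAt 𝓘(ℝ, V) 𝓘(ℝ, E) f x)
    (hx : f x ∈ (extChartAt 𝓘(ℝ, E) p₀).source) :
    mpull f θ x = (θ.inChart p₀ (extChartAt 𝓘(ℝ, E) p₀ (f x))).compContinuousLinearMap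
      (fderiv ℝ (fun z => extChartAt 𝓘(ℝ, E) p₀ (f z)) x) := by
  have h1 := (hasD_extChartAt hx).comp_univ hf.hasD
  rw [hasD_univ_iff_hasFDerivAt] at h1
  have h2 := congrArg (fun L => L ∘L mD V E f x) (mD_extChartAt_symm_comp (E := E) hx)
  simp only [ContinuousLinearMap.id_comp, ContinuousLinearMap.comp_assoc] at h2
  -- The base point occurs in the type of the value of θ, so it is generalised to q before being
  -- identified with `f x`.
  have h4 : ∀ q (_ : q = f x) (L : E →L[ℝ] E) (hL : L ∘L (mD E E (extChartAt 𝓘(ℝ, E) p₀) (f x)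
      ∘L mD V E f x) = mD V E f x),
      mpull f θ x = ContinuousAlternatingMap.compContinuousLinearMap (M := E) (M' := V)
        (ContinuousAlternatingMap.compContinuousLinearMap (M := E) (M' := E)
          (show E [⋀^Fin k]→L[ℝ] W from θ q) L)
        (mD E E (extChartAt 𝓘(ℝ, E) p₀) (f x) ∘L mD V E f x) := by
    rintro q rfl L hL
    conv_lhs => rw [mpull, ← hL]
    rfl
  rw [h1.fderiv]
  exact h4 _ ((extChartAt 𝓘(ℝ, E) p₀).left_inv hx) _ h2

theorem mpull_eventuallyEq_chart {f : V → N} (θ : MForm E N k W) {x : V}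
    (hf : ContMDiffAt 𝓘(ℝ, V) 𝓘(ℝ, E) ∞ f x) :
    mpull f θ =ᶠ[𝓝 x] fun z => (θ.inChart (f x)
      (extChartAt 𝓘(ℝ, E) (f x) (f z))).compContinuousLinearMap
        (fderiv ℝ (fun z => extChartAt 𝓘(ℝ, E) (f x) (f z)) z) := by
  have : IsManifold 𝓘(ℝ, E) 1 N := IsManifold.of_le (n := ∞) (by simp)
  filter_upwards [hf.continuousAt ((isOpen_extChartAt_source (I := 𝓘(ℝ, E)) (f x)).mem_nhds
    (mem_extChartAt_source _)), (contMDiffAt_iff_contMDiffAt_nhds (n := 1) (by simp)).1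
      (ContMDiffAt.of_le hf (by simp))] with z hz hfz
  exact mpull_eq_chart (hfz.mdifferentiableAt (by simp)) hz

theorem contDiffAt_mpull [FiniteDimensional ℝ E] [FiniteDimensional ℝ V] [FiniteDimensional ℝ W]
    {f : V → N} {θ : MForm E N k W} (hθ : θ.IsSmooth) {x : V}
    (hf : ContMDiffAt 𝓘(ℝ, V) 𝓘(ℝ, E) ∞ f x) : ContDiffAt ℝ ∞ (mpull f θ) x := by
  refine ContDiffAt.congr_of_eventuallyEq ?_ (mpull_eventuallyEq_chart θ hf)
  have hκ := contDiffAt_extChartAt_comp hf (mem_extChartAt_source (f x))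
  refine contDiffAt_alternating fun v => ?_
  refine ContDiffAt.alternating_apply
    (θ := fun z => θ.inChart (f x) (extChartAt 𝓘(ℝ, E) (f x) (f z)))
    (v := fun z i => fderiv ℝ (fun z => extChartAt 𝓘(ℝ, E) (f x) (f z)) z (v i)) ?_ fun i => ?_
  · exact ((hθ (f x)).contDiffAt ((isOpen_extChartAt_target (f x)).mem_nhds
      (mem_extChartAt_target _))).comp x hκ
  · exact (hκ.fderiv_right (m := ∞) (by simp)).clm_apply contDiffAt_const

/-- `MForm.d` at `f x` is computed in the chart at `f x`, whose derivative there is the identity. In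
that chart the claim is naturality of the exterior derivative on vector spaces. -/
theorem extDeriv_mpull {f : V → N} {θ : MForm E N k W} (hθ : θ.IsSmooth) {x : V}
    (hf : ContMDiffAt 𝓘(ℝ, V) 𝓘(ℝ, E) ∞ f x) : extDeriv (mpull f θ) x = mpull f θ.d x := by
  have : IsManifold 𝓘(ℝ, E) 1 N := IsManifold.of_le (n := ∞) (by simp)
  rw [(mpull_eventuallyEq_chart θ hf).extDeriv_eq]
  have hκ := contDiffAt_extChartAt_comp hf (mem_extChartAt_source (f x))
  have h1 : DifferentiableAt ℝ (θ.inChart (f x)) (extChartAt 𝓘(ℝ, E) (f x) (f x)) :=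
    ((hθ (f x)).contDiffAt ((isOpen_extChartAt_target (f x)).mem_nhds
      (mem_extChartAt_target _))).differentiableAt (by simp)
  rw [extDeriv_pullback (f := fun z => extChartAt 𝓘(ℝ, E) (f x) (f z)) h1 hκ
      (by simpa using ENat.LEInfty.out), ← mD_eq_fderiv_extChartAt (hf.mdifferentiableAt (by simp))]
  have h2 : mD E E (extChartAt 𝓘(ℝ, E) (f x)) (f x) ∘L mD V E f x = mD V E f x := by
    rw [mD_extChartAt_self, ContinuousLinearMap.id_comp]
  conv_lhs => rw [← h2]
  rfl

end Pullback

/-! ### Explicit exterior derivatives of 1-forms and 2-forms -/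

section ExtDeriv

variable {V W : Type*} [NormedAddCommGroup V] [NormedSpace ℝ V] [NormedAddCommGroup W]
  [NormedSpace ℝ W]

theorem extDeriv_one_apply {θ : V → V [⋀^Fin 1]→L[ℝ] W} {x : V} (h : DifferentiableAt ℝ θ x)
    (v w : V) : extDeriv θ x ![v, w] =
      fderiv ℝ (fun z => θ z ![w]) x v - fderiv ℝ (fun z => θ z ![v]) x w := by
  rw [extDeriv_apply h, Fin.sum_univ_two]
  have h1 : Fin.removeNth (0 : Fin 2) (![v, w] : Fin 2 → V) = ![w] := by
    ext i; fin_cases i; rfl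
  have h2 : Fin.removeNth (1 : Fin 2) (![v, w] : Fin 2 → V) = ![v] := by
    ext i; fin_cases i; rfl
  rw [h1, h2]
  simp [sub_eq_add_neg]

theorem extDeriv_two_apply {θ : V → V [⋀^Fin 2]→L[ℝ] W} {x : V} (h : DifferentiableAt ℝ θ x)
    (v : Fin 3 → V) : extDeriv θ x v =
      fderiv ℝ (fun z => θ z ![v 1, v 2]) x (v 0) - fderiv ℝ (fun z => θ z ![v 0, v 2]) x (v 1)
        + fderiv ℝ (fun z => θ z ![v 0, v 1]) x (v 2) := by
  rw [extDeriv_apply h, Fin.sum_univ_three]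
  have h1 : Fin.removeNth (0 : Fin 3) v = ![v 1, v 2] := by
    ext i; fin_cases i <;> rfl
  have h2 : Fin.removeNth (1 : Fin 3) v = ![v 0, v 2] := by
    ext i; fin_cases i <;> rfl
  have h3 : Fin.removeNth (2 : Fin 3) v = ![v 0, v 1] := by
    ext i; fin_cases i <;> rfl
  rw [h1, h2, h3]
  simp [sub_eq_add_neg]

end ExtDeriv

/-! ### Alternating maps of low degree -/

section LowDegree

variable {E W : Type*} [NormedAddCommGroup E] [NormedSpace ℝ E]
  [NormedAddCommGroup W] [NormedSpace ℝ W]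

theorem alternating_two_add_left (θ : E [⋀^Fin 2]→L[ℝ] W) (v w u : E) :
    θ ![v + w, u] = θ ![v, u] + θ ![w, u] := by
  have h : ∀ x : E, Function.update ![0, u] (0 : Fin 2) x = ![x, u] := fun x => by
    ext i
    fin_cases i <;> simp
  have := θ.map_update_add ![0, u] 0 v w
  simpa only [h] using this

theorem alternating_two_swap (θ : E [⋀^Fin 2]→L[ℝ] W) (v w : E) :
    θ ![v, w] = -θ ![w, v] := by
  have := θ.map_swap ![w, v] (i := 0) (j := 1) (by simp)
  refine Eq.trans (congrArg θ ?_) this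
  ext i
  fin_cases i <;> rfl

/-- A 1-form as a linear map. -/
noncomputable def alternatingOneL (θ : E [⋀^Fin 1]→L[ℝ] W) : E →L[ℝ] W :=
  (ContinuousAlternatingMap.ofSubsingleton ℝ E W (0 : Fin 1)).symm θ

theorem alternatingOneL_apply (θ : E [⋀^Fin 1]→L[ℝ] W) (v : E) :
    alternatingOneL θ v = θ ![v] := by
  change θ (fun _ => v) = θ ![v]
  congr 1
  ext i
  fin_cases i
  rfl

end LowDegree

/-! ### Derivatives of the action on a principal bundle -/

section Bundle

variable {EG EH G H : Type*}
    [NormedAddCommGroup EG] [NormedSpace ℝ EG] [NormedAddCommGroup EH] [NormedSpace ℝ EH]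
    [TopologicalSpace G] [ChartedSpace EG G] [Group G] [LieGroup 𝓘(ℝ, EG) ∞ G]
    [TopologicalSpace H] [ChartedSpace EH H] [Group H] [LieGroup 𝓘(ℝ, EH) ∞ H]
    {X : LieCrossedModule EG EH G H}
    {EM EP EP₁ M P P₁ : Type*}
    [NormedAddCommGroup EM] [NormedSpace ℝ EM] [NormedAddCommGroup EP] [NormedSpace ℝ EP]
    [NormedAddCommGroup EP₁] [NormedSpace ℝ EP₁]
    [TopologicalSpace M] [ChartedSpace EM M] [TopologicalSpace P] [ChartedSpace EP P]
    [TopologicalSpace P₁] [ChartedSpace EP₁ P₁]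
    {V : Type*} [NormedAddCommGroup V] [NormedSpace ℝ V]

namespace Principal2Bundle

variable (Q : Principal2Bundle X EM EP EP₁ M P P₁)

/-- The differential at `p` of the right translation by `g`, between model spaces. -/
noncomputable def dRL (g : G) (p : P) : EP →L[ℝ] EP := mD EP EP (fun q : P => Q.act q g) p

/-- The fundamental vectors at `p`, as a linear map of the Lie algebra. -/
noncomputable def fundL (p : P) : EG →L[ℝ] EP := mD EG EP (fun g : G => Q.act p g) 1

theorem mdifferentiableAt_act (z : P × G) : MDifferentiableAt (𝓘(ℝ, EP).prod 𝓘(ℝ, EG)) 𝓘(ℝ, EP)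
    (fun z : P × G => Q.act z.1 z.2) z :=
  Q.contMDiff_act.mdifferentiable (by simp) z

theorem hasD_act_left (g : G) (p : P) : HasD (fun q : P => Q.act q g) univ p (Q.dRL g p) := by
  have h : ContMDiff 𝓘(ℝ, EP) 𝓘(ℝ, EP) ∞ (fun q : P => Q.act q g) :=
    Q.contMDiff_act.comp (contMDiff_id.prodMk contMDiff_const)
  exact (h.mdifferentiable (by simp) p).hasD

theorem hasD_act_right (p : P) : HasD (fun g : G => Q.act p g) univ 1 (Q.fundL p) := by
  have h : ContMDiff 𝓘(ℝ, EG) 𝓘(ℝ, EP) ∞ (fun g : G => Q.act p g) :=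
    Q.contMDiff_act.comp (contMDiff_const.prodMk contMDiff_id)
  exact (h.mdifferentiable (by simp) 1).hasD

/-- The product rule for γ·g. The second term is the fundamental vector of g⁻¹dg, because γ(x)·z =
(γ(x)·g(x))·(g(x)⁻¹z). -/
theorem hasD_act {γ : V → P} {g : V → G} {s : Set V} {x : V} {L : V →L[ℝ] EP} {L' : V →L[ℝ] EG}
    (hγ : HasD γ s x L) (hg : HasLogD g s x L') :
    HasD (fun z => Q.act (γ z) (g z)) s x
      (Q.dRL (g x) (γ x) ∘L L + Q.fundL (Q.act (γ x) (g x)) ∘L L') := by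
  have h1 := HasD.comp₂ (F := fun z : P × G => Q.act z.1 z.2) (Q.mdifferentiableAt_act _) hγ hg.hasD
  have h2 := (Q.hasD_act_right (Q.act (γ x) (g x))).comp_eq (hasD_mul_left (E := EG) (g x)⁻¹ (g x))
    (inv_mul_cancel _)
  simp only [← Q.act_mul, mul_inv_cancel_left] at h2
  change HasD _ s x (Q.dRL (g x) (γ x) ∘L L +
    mD EG EP (fun z => Q.act (γ x) z) (g x) ∘L leftD EG (g x) ∘L L') at h1
  convert h1 using 2
  rw [h2.mD_eq, ContinuousLinearMap.comp_assoc,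
    ← ContinuousLinearMap.comp_assoc (mD EG EG (fun z => (g x)⁻¹ * z) (g x)), leftD_comp,
    ContinuousLinearMap.id_comp]

theorem dproj_dRL (g : G) (p : P) :
    mD EP EM Q.proj (Q.act p g) ∘L Q.dRL g p = mD EP EM Q.proj p := by
  have h1 := (Q.contMDiff_proj.mdifferentiable (by simp) (Q.act p g)).hasD.comp_univ
    (f := fun q => Q.act q g) (Q.hasD_act_left g p)
  simp only [Q.proj_act] at h1
  exact h1.mD_eq.symm

theorem div_self (p : P) : Q.div p p = 1 := by
  have := Q.div_act p 1
  rwa [Q.act_one] at this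

end Principal2Bundle

namespace TwoConnection

variable {Q : Principal2Bundle X EM EP EP₁ M P P₁} (AB : TwoConnection Q)

/-- The connection form at `p` as a linear map between the model spaces. -/
noncomputable def AL (p : P) : EP →L[ℝ] EG :=
  alternatingOneL (show EP [⋀^Fin 1]→L[ℝ] EG from AB.A p)

/-- The form `B` at `p` as an alternating map between the model spaces. -/
noncomputable def BL (p : P) : EP [⋀^Fin 2]→L[ℝ] EH := AB.B p

theorem AL_apply (p : P) (v : EP) : AB.AL p v = AB.A p ![v] := alternatingOneL_apply _ _

theorem AL_fundL (p : P) (ξ : EG) : AB.AL p (Q.fundL p ξ) = ξ := by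
  rw [AL_apply]
  exact AB.A_fundamental p ξ

theorem AL_dRL (g : G) (p : P) (v : EP) :
    AB.AL (Q.act p g) (Q.dRL g p v) = lieAd g⁻¹ (AB.AL p v) := by
  rw [AL_apply, AL_apply]
  exact AB.A_equivariant g p v

theorem BL_add_fundL (p : P) (v w : EP) (ξ η : EG) :
    AB.BL p ![v + Q.fundL p ξ, w + Q.fundL p η] = AB.BL p ![v, w] := by
  have h : ∀ ξ w, AB.BL p ![Q.fundL p ξ, w] = 0 := AB.B_horizontal p
  rw [alternating_two_add_left, h, add_zero, alternating_two_swap, alternating_two_add_left, h,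
    add_zero, ← alternating_two_swap]

theorem BL_dRL (g : G) (p : P) (v w : EP) :
    AB.BL (Q.act p g) ![Q.dRL g p v, Q.dRL g p w] = X.αStarGroup g⁻¹ (AB.BL p ![v, w]) :=
  AB.B_equivariant g p v w

/-- The pullback of the connection form under `f`. -/
noncomputable def pullA (f : V → P) (x : V) : V →L[ℝ] EG := AB.AL (f x) ∘L mD V EP f x

/-- The pullback of the form `B` under `f`. -/
noncomputable def pullB (f : V → P) (x v w : V) : EH :=
  AB.BL (f x) ![mD V EP f x v, mD V EP f x w]

theorem pullB_eq (f : V → P) (x v w : V) : AB.pullB f x v w = mpull f AB.B x ![v, w] := by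
  change AB.BL (f x) _ = AB.BL (f x) _
  congr 1
  ext i
  fin_cases i <;> rfl

theorem pullA_eq (f : V → P) (x v : V) : AB.pullA f x v = mpull f AB.A x ![v] := by
  rw [pullA, ContinuousLinearMap.comp_apply, AL_apply]
  change (show EP [⋀^Fin 1]→L[ℝ] EG from AB.A (f x)) ![mD V EP f x v] = (show EP [⋀^Fin 1]→L[ℝ] EG from AB.A (f x)) (fun i => mD V EP f x (![v] i))
  congr 1
  ext i
  fin_cases i
  rfl

/-- The gauge transformation law; the fundamental vector contributes g⁻¹dg since A reproduces the
generators. -/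
theorem pullA_act {γ : V → P} {g : V → G} {x : V}
    (hγ : MDifferentiableAt 𝓘(ℝ, V) 𝓘(ℝ, EP) γ x) (hg : MDifferentiableAt 𝓘(ℝ, V) 𝓘(ℝ, EG) g x)
    (v : V) : AB.pullA (fun z => Q.act (γ z) (g z)) x v =
      lieAd (g x)⁻¹ (AB.pullA γ x v) + logD EG g x v := by
  rw [pullA, (Q.hasD_act hγ.hasD (hasLogD_logD hg)).mD_eq]
  simp [pullA, AL_dRL, AL_fundL]

/-- Horizontality of B discards the fundamental vectors, so there is no inhomogeneous term. -/
theorem pullB_act {γ : V → P} {g : V → G} {x : V}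
    (hγ : MDifferentiableAt 𝓘(ℝ, V) 𝓘(ℝ, EP) γ x) (hg : MDifferentiableAt 𝓘(ℝ, V) 𝓘(ℝ, EG) g x)
    (v w : V) : AB.pullB (fun z => Q.act (γ z) (g z)) x v w =
      X.αStarGroup (g x)⁻¹ (AB.pullB γ x v w) := by
  rw [pullB, (Q.hasD_act hγ.hasD (hasLogD_logD hg)).mD_eq]
  simp only [add_apply, ContinuousLinearMap.comp_apply]
  rw [BL_add_fundL, BL_dRL]
  rfl

section Smooth

variable [IsManifold 𝓘(ℝ, EP) ∞ P]

theorem tStar_pullB {f : V → P} {x : V} (hf : ContMDiffAt 𝓘(ℝ, V) 𝓘(ℝ, EP) ∞ f x)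
    [FiniteDimensional ℝ EP] [FiniteDimensional ℝ V] [FiniteDimensional ℝ EG] (v w : V) :
    X.tStar (AB.pullB f x v w) =
      fderiv ℝ (fun z => AB.pullA f z w) x v - fderiv ℝ (fun z => AB.pullA f z v) x w +
        lieBrL EG G (AB.pullA f x v) (AB.pullA f x w) := by
  have h1 := AB.fake_flat (f x) (mD V EP f x v) (mD V EP f x w)
  have h2 := extDeriv_one_apply ((contDiffAt_mpull AB.smooth_A hf).differentiableAt (by simp)) v w
  rw [extDeriv_mpull AB.smooth_A hf] at h2
  simp only [← pullA_eq] at h2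
  rw [← h2, ← lieBr_eq_lieBrL]
  refine h1.trans ?_
  have h3 : curvature2 G AB.A (f x) (mD V EP f x v) (mD V EP f x w) =
      (show EP [⋀^Fin 2]→L[ℝ] EG from AB.A.d (f x)) ![mD V EP f x v, mD V EP f x w] +
        lieBr G (AB.AL (f x) (mD V EP f x v)) (AB.AL (f x) (mD V EP f x w)) := by
    rw [AL_apply, AL_apply]
    rfl
  refine h3.trans (congrArg (· + lieBr G (AB.pullA f x v) (AB.pullA f x w)) ?_)
  refine congrArg (show EP [⋀^Fin 2]→L[ℝ] EG from AB.A.d (f x)) ?_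
  ext i
  fin_cases i <;> rfl

theorem curvature3_pull {f : V → P} {x : V} (hf : ContMDiffAt 𝓘(ℝ, V) 𝓘(ℝ, EP) ∞ f x)
    [FiniteDimensional ℝ EP] [FiniteDimensional ℝ V] [FiniteDimensional ℝ EH] (v : Fin 3 → V) :
    AB.curvature3 (f x) (fun i => mD V EP f x (v i)) =
      fderiv ℝ (fun z => AB.pullB f z (v 1) (v 2)) x (v 0)
      - fderiv ℝ (fun z => AB.pullB f z (v 0) (v 2)) x (v 1)
      + fderiv ℝ (fun z => AB.pullB f z (v 0) (v 1)) x (v 2)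
      + X.αStarL (AB.pullA f x (v 0)) (AB.pullB f x (v 1) (v 2))
      - X.αStarL (AB.pullA f x (v 1)) (AB.pullB f x (v 0) (v 2))
      + X.αStarL (AB.pullA f x (v 2)) (AB.pullB f x (v 0) (v 1)) := by
  have h2 := extDeriv_two_apply ((contDiffAt_mpull AB.smooth_B hf).differentiableAt (by simp)) v
  rw [extDeriv_mpull AB.smooth_B hf] at h2
  simp only [← pullB_eq] at h2
  rw [← h2]
  simp only [← X.αStar_eq, pullA, ContinuousLinearMap.comp_apply, AL_apply]
  rfl

end Smooth

end TwoConnection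

end Bundle

/-! ### The 2-curvature: values, equivariance and horizontality -/

section Curvature

variable {EG EH G H : Type*}
    [NormedAddCommGroup EG] [NormedSpace ℝ EG] [NormedAddCommGroup EH] [NormedSpace ℝ EH]
    [TopologicalSpace G] [ChartedSpace EG G] [Group G] [LieGroup 𝓘(ℝ, EG) ∞ G]
    [TopologicalSpace H] [ChartedSpace EH H] [Group H] [LieGroup 𝓘(ℝ, EH) ∞ H]
    {X : LieCrossedModule EG EH G H}
    {EM EP EP₁ M P P₁ : Type*}
    [NormedAddCommGroup EM] [NormedSpace ℝ EM] [NormedAddCommGroup EP] [NormedSpace ℝ EP]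
    [NormedAddCommGroup EP₁] [NormedSpace ℝ EP₁]
    [TopologicalSpace M] [ChartedSpace EM M] [TopologicalSpace P] [ChartedSpace EP P]
    [TopologicalSpace P₁] [ChartedSpace EP₁ P₁] [IsManifold 𝓘(ℝ, EP) ∞ P]
    [FiniteDimensional ℝ EG] [FiniteDimensional ℝ EH] [FiniteDimensional ℝ EP]
    {V : Type*} [NormedAddCommGroup V] [NormedSpace ℝ V] [FiniteDimensional ℝ V]
    {Q : Principal2Bundle X EM EP EP₁ M P P₁}

/-- Because the derivative at x is the identity, an identity for pulled back forms at x is the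
pointwise identity at q. -/
theorem exists_chart_map (q : P) : ∃ (f : EP → P) (x : EP),
    (∀ᶠ z in 𝓝 x, ContMDiffAt 𝓘(ℝ, EP) 𝓘(ℝ, EP) ∞ f z) ∧ f x = q ∧
      mD EP EP f x = ContinuousLinearMap.id ℝ EP :=
  ⟨(extChartAt 𝓘(ℝ, EP) q).symm, extChartAt 𝓘(ℝ, EP) q q, by
    filter_upwards [(isOpen_extChartAt_target (I := 𝓘(ℝ, EP)) q).mem_nhds
      (mem_extChartAt_target q)] with z hz using contMDiffAt_extChartAt_symm hz,
    extChartAt_to_inv q, mD_extChartAt_symm_self q⟩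

namespace TwoConnection

variable (AB : TwoConnection Q)

theorem contDiffAt_pullA {f : V → P} {x : V} (hf : ContMDiffAt 𝓘(ℝ, V) 𝓘(ℝ, EP) ∞ f x) (v : V) :
    ContDiffAt ℝ ∞ (fun z => AB.pullA f z v) x := by
  simp only [pullA_eq]
  exact (contDiffAt_mpull AB.smooth_A hf).alternating_apply fun i => contDiffAt_const

theorem contDiffAt_pullB {f : V → P} {x : V} (hf : ContMDiffAt 𝓘(ℝ, V) 𝓘(ℝ, EP) ∞ f x) (v w : V) :
    ContDiffAt ℝ ∞ (fun z => AB.pullB f z v w) x := by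
  simp only [pullB_eq]
  exact (contDiffAt_mpull AB.smooth_B hf).alternating_apply fun i => contDiffAt_const

/-- The Bianchi identity dF_A + [A, F_A] = 0. Fake flatness replaces t_*B by F_A both in the
derivatives of B and in the terms α_*(A, B). -/
theorem tStar_curvature3_pull {f : V → P} {x : V}
    (hf : ∀ᶠ z in 𝓝 x, ContMDiffAt 𝓘(ℝ, V) 𝓘(ℝ, EP) ∞ f z) (v : Fin 3 → V) :
    X.tStar (AB.curvature3 (f x) (fun i => mD V EP f x (v i))) = 0 := by
  have hfx := hf.self_of_nhds
  have hA : ∀ i, ContDiffAt ℝ ∞ (fun z => AB.pullA f z (v i)) x := fun i =>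
    AB.contDiffAt_pullA hfx _
  have hA' : ∀ i, HasFDerivAt (fun z => AB.pullA f z (v i))
      (fderiv ℝ (fun z => AB.pullA f z (v i)) x) x := fun i =>
    ((hA i).differentiableAt (by simp)).hasFDerivAt
  have hA2 : ∀ i j, HasFDerivAt (fun z => fderiv ℝ (fun z => AB.pullA f z (v i)) z (v j))
      ((fderiv ℝ (fderiv ℝ (fun z => AB.pullA f z (v i))) x).flip (v j)) x := by
    intro i j
    have h := (((hA i).fderiv_right (m := ∞) (by simp)).differentiableAt (by simp)).hasFDerivAt
    refine (h.clm_apply (hasFDerivAt_const (v j) x)).congr_fderiv ?_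
    ext u
    simp
  have hB : ∀ i j u, X.tStar (fderiv ℝ (fun z => AB.pullB f z (v i) (v j)) x u) =
      fderiv ℝ (fderiv ℝ (fun z => AB.pullA f z (v j))) x u (v i) -
      fderiv ℝ (fderiv ℝ (fun z => AB.pullA f z (v i))) x u (v j) +
      (lieBrL EG G (fderiv ℝ (fun z => AB.pullA f z (v i)) x u) (AB.pullA f x (v j)) +
        lieBrL EG G (AB.pullA f x (v i)) (fderiv ℝ (fun z => AB.pullA f z (v j)) x u)) := by
    intro i j u
    have h1 := X.tStar.hasFDerivAt.comp x
      ((AB.contDiffAt_pullB hfx (v i) (v j)).differentiableAt (by simp)).hasFDerivAt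
    have h2 := ((hA2 j i).sub (hA2 i j)).add
      ((lieBrL EG G).hasFDerivAt_of_bilinear (hA' i) (hA' j))
    have h3 := h1.unique (h2.congr_of_eventuallyEq (by
      filter_upwards [hf] with z hz using AB.tStar_pullB hz (v i) (v j)))
    have h4 := congrArg (fun L : V →L[ℝ] EG => L u) h3
    simp only [ContinuousLinearMap.comp_apply] at h4
    rw [h4]
    simp [add_comm]
  have hs : ∀ i u w, fderiv ℝ (fderiv ℝ (fun z => AB.pullA f z (v i))) x u w =
      fderiv ℝ (fderiv ℝ (fun z => AB.pullA f z (v i))) x w u := fun i u w =>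
    ((hA i).isSymmSndFDerivAt (by simpa using ENat.LEInfty.out)).eq u w
  have hswap : ∀ ξ η, lieBrL EG G ξ η = -lieBrL EG G η ξ := fun ξ η => by
    rw [← lieBr_eq_lieBrL, ← lieBr_eq_lieBrL, lieBr_swap]
  have : CompleteSpace EG := FiniteDimensional.complete ℝ EG
  have hJ := lieBr_jacobi (G := G) (AB.pullA f x (v 0)) (AB.pullA f x (v 1)) (AB.pullA f x (v 2))
  rw [AB.curvature3_pull hfx]
  simp only [map_add, map_sub, hB, X.tStar_αStarL, lieBr_eq_lieBrL, AB.tStar_pullB hfx]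
  -- Second derivatives of A cancel in pairs by symmetry. The brackets of A with its first
  -- derivatives cancel by antisymmetry, and the triple brackets by the Jacobi identity.
  rw [hJ, hs 0 (v 2) (v 1), hs 1 (v 2) (v 0), hs 2 (v 1) (v 0),
    hswap (fderiv ℝ (fun z => AB.pullA f z (v 1)) x (v 0)),
    hswap (fderiv ℝ (fun z => AB.pullA f z (v 0)) x (v 1)),
    hswap (fderiv ℝ (fun z => AB.pullA f z (v 0)) x (v 2)),
    hswap (lieBrL EG G (AB.pullA f x (v 0)) (AB.pullA f x (v 1)))]
  abel

theorem tStar_curvature3 (q : P) (v : Fin 3 → EP) : X.tStar (AB.curvature3 q v) = 0 := by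
  obtain ⟨f, x, hf, rfl, hD⟩ := exists_chart_map (EP := EP) q
  have h := AB.tStar_curvature3_pull hf v
  rw [hD] at h
  exact h

/-- Differentiating α_{g⁻¹}B produces -α_{g⁻¹}α_*(Ad_g(g⁻¹dg), B), in `hD`. The inhomogeneous part
of the transformed A contributes the same term with the opposite sign, in `hA`. -/
theorem curvature3_act {γ : V → P} {g : V → G} {x : V}
    (hγ : ∀ᶠ z in 𝓝 x, ContMDiffAt 𝓘(ℝ, V) 𝓘(ℝ, EP) ∞ γ z)
    (hg : ∀ᶠ z in 𝓝 x, ContMDiffAt 𝓘(ℝ, V) 𝓘(ℝ, EG) ∞ g z) (v : Fin 3 → V) :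
    AB.curvature3 (Q.act (γ x) (g x))
        (fun i => mD V EP (fun z => Q.act (γ z) (g z)) x (v i)) =
      X.αStarGroup (g x)⁻¹ (AB.curvature3 (γ x) (fun i => mD V EP γ x (v i))) := by
  have hγx := hγ.self_of_nhds
  have hgx := hg.self_of_nhds
  have hf : ContMDiffAt 𝓘(ℝ, V) 𝓘(ℝ, EP) ∞ (fun z => Q.act (γ z) (g z)) x :=
    ContMDiffAt.comp x (g := fun z : P × G => Q.act z.1 z.2) (Q.contMDiff_act _)
      (hγx.prodMk hgx)
  have hpB : ∀ v w, (fun z => AB.pullB (fun z => Q.act (γ z) (g z)) z v w) =ᶠ[𝓝 x]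
      fun z => X.αStarGroup (g z)⁻¹ (AB.pullB γ z v w) := by
    intro v w
    filter_upwards [hγ, hg] with z h1 h2
    exact AB.pullB_act (h1.mdifferentiableAt (by simp)) (h2.mdifferentiableAt (by simp)) v w
  have hα := X.hasFDerivWithinAt_αStarGroup
    (hasLogD_logD (hgx.mdifferentiableAt (by simp))).inv
  rw [hasFDerivWithinAt_univ] at hα
  have hD : ∀ v w u, fderiv ℝ (fun z => AB.pullB (fun z => Q.act (γ z) (g z)) z v w) x u =
      X.αStarGroup (g x)⁻¹ (fderiv ℝ (fun z => AB.pullB γ z v w) x u) -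
      X.αStarGroup (g x)⁻¹ (X.αStarL (lieAd (g x) (logD EG g x u)) (AB.pullB γ x v w)) := by
    intro v w u
    rw [(hpB v w).fderiv_eq]
    have h := hα.clm_apply
      ((AB.contDiffAt_pullB hγx v w).differentiableAt (by simp)).hasFDerivAt
    rw [h.fderiv]
    simp [sub_eq_add_neg]
  have hA : ∀ u η, X.αStarL (AB.pullA (fun z => Q.act (γ z) (g z)) x u)
      (X.αStarGroup (g x)⁻¹ η) = X.αStarGroup (g x)⁻¹ (X.αStarL (AB.pullA γ x u) η) +
        X.αStarGroup (g x)⁻¹ (X.αStarL (lieAd (g x) (logD EG g x u)) η) := by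
    intro u η
    rw [AB.pullA_act (hγx.mdifferentiableAt (by simp)) (hgx.mdifferentiableAt (by simp)),
      ← X.αStarL_lieAd, ← X.αStarL_lieAd]
    have h : lieAd (EG := EG) (g x)⁻¹ (lieAd (g x) (logD EG g x u)) = logD EG g x u :=
      congrArg (fun L : EG →L[ℝ] EG => L (logD EG g x u)) (lieAd_inv_comp (g x))
    rw [h, map_add, add_apply]
  have h1 := AB.curvature3_pull hf v
  rw [h1, AB.curvature3_pull hγx]
  simp only [hD, (hpB _ _).self_of_nhds, hA, map_add, map_sub]
  abel

/-- Apply `curvature3_act` to (z, ζ) ↦ f(z)·(gψ(ζ)), with ψ the inverse chart of G at 1; its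
derivative at the base point has exactly the displayed form. Taking ξ = 0 gives equivariance and g =
1 gives horizontality. -/
theorem curvature3_translate (q : P) (g : G) (v : Fin 3 → EP) (ξ : Fin 3 → EG) :
    AB.curvature3 (Q.act q g)
        (fun i => (Q.dRL g q (v i) + Q.fundL (Q.act q g) (ξ i) : EP)) =
      X.αStarGroup g⁻¹ (AB.curvature3 q v) := by
  obtain ⟨f, x, hf, rfl, hD⟩ := exists_chart_map (EP := EP) q
  let ψ : EG → G := (extChartAt 𝓘(ℝ, EG) (1 : G)).symm
  let e : EG := chartOne EG G
  have hψe : g * ψ e = g := by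
    change g * (extChartAt 𝓘(ℝ, EG) (1 : G)).symm (chartOne EG G) = g
    rw [extChartAt_symm_chartOne, mul_one]
  have hγ : ∀ᶠ z : EP × EG in 𝓝 (x, e), ContMDiffAt 𝓘(ℝ, EP × EG) 𝓘(ℝ, EP) ∞
      (fun z : EP × EG => f z.1) z := by
    filter_upwards [continuousAt_fst.eventually hf] with z hz
    have h1 : ContMDiffAt 𝓘(ℝ, EP × EG) 𝓘(ℝ, EP) ∞ (fun z : EP × EG => z.1) z :=
      ContDiffAt.contMDiffAt (by fun_prop)
    exact ContMDiffAt.comp z hz h1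
  have hg : ∀ᶠ z : EP × EG in 𝓝 (x, e), ContMDiffAt 𝓘(ℝ, EP × EG) 𝓘(ℝ, EG) ∞
      (fun z : EP × EG => g * ψ z.2) z := by
    have h0 : ∀ᶠ y in 𝓝 e, y ∈ (extChartAt 𝓘(ℝ, EG) (1 : G)).target :=
      (isOpen_extChartAt_target (1 : G)).mem_nhds chartOne_mem
    filter_upwards [(continuousAt_snd (p := (x, e))).eventually h0] with z hz
    have h1 : ContMDiffAt 𝓘(ℝ, EP × EG) 𝓘(ℝ, EG) ∞ (fun z : EP × EG => z.2) z :=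
      ContDiffAt.contMDiffAt (by fun_prop)
    exact contMDiffAt_const.mul (ContMDiffAt.comp (g := ψ) z (contMDiffAt_extChartAt_symm hz) h1)
  have h1 := AB.curvature3_act hγ hg fun i => (v i, ξ i)
  have h2 : HasD (fun z : EP × EG => f z.1) univ (x, e) (ContinuousLinearMap.fst ℝ EP EG) := by
    have h3 := (hf.self_of_nhds.mdifferentiableAt (by simp)).hasD
    rw [hD] at h3
    exact h3.comp_eq (f := Prod.fst) (x := (x, e))
      (hasD_univ_iff_hasFDerivAt.2 hasFDerivAt_fst) rfl
  have h3 : HasLogD (fun z : EP × EG => g * ψ z.2) univ (x, e)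
      (ContinuousLinearMap.snd ℝ EP EG) := by
    have h4 := HasLogD.comp (s := univ) (x := (x, e)) (g := Prod.snd)
      (hasLogD_extChartAt_symm (E := EG) (G := G))
      (hasFDerivAt_snd (𝕜 := ℝ)).hasFDerivWithinAt (mapsTo_univ _ _)
    exact h4.const_mul g
  rw [(Q.hasD_act h2 h3).mD_eq, h2.mD_eq] at h1
  simp only [hψe] at h1
  have h4 : ∀ g', g' = g → ∀ w : Fin 3 → EP,
      AB.curvature3 (Q.act (f x) g') w = AB.curvature3 (Q.act (f x) g) w := by
    rintro _ rfl _
    rfl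
  exact (h4 _ hψe _).symm.trans h1

end TwoConnection

end Curvature

/-! ### Local lifts and basic forms -/

section Lift

variable {EG EH G H : Type*}
    [NormedAddCommGroup EG] [NormedSpace ℝ EG] [NormedAddCommGroup EH] [NormedSpace ℝ EH]
    [TopologicalSpace G] [ChartedSpace EG G] [Group G] [LieGroup 𝓘(ℝ, EG) ∞ G]
    [TopologicalSpace H] [ChartedSpace EH H] [Group H] [LieGroup 𝓘(ℝ, EH) ∞ H]
    {X : LieCrossedModule EG EH G H}
    {EM EP EP₁ M P P₁ : Type*}
    [NormedAddCommGroup EM] [NormedSpace ℝ EM] [NormedAddCommGroup EP] [NormedSpace ℝ EP]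
    [NormedAddCommGroup EP₁] [NormedSpace ℝ EP₁]
    [TopologicalSpace M] [ChartedSpace EM M] [TopologicalSpace P] [ChartedSpace EP P]
    [TopologicalSpace P₁] [ChartedSpace EP₁ P₁] [IsManifold 𝓘(ℝ, EP) ∞ P]
    [IsManifold 𝓘(ℝ, EM) ∞ M]
    [FiniteDimensional ℝ EP] [FiniteDimensional ℝ EM]
    {V : Type*} [NormedAddCommGroup V] [NormedSpace ℝ V]

namespace Principal2Bundle

variable (Q : Principal2Bundle X EM EP EP₁ M P P₁)

theorem hasD_proj (p : P) : HasD Q.proj univ p (mD EP EM Q.proj p) :=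
  (Q.contMDiff_proj.mdifferentiable (by simp) p).hasD

theorem exists_dproj_rightInverse (p : P) :
    ∃ R : EM →L[ℝ] EP, mD EP EM Q.proj p ∘L R = ContinuousLinearMap.id ℝ EM := by
  obtain ⟨R, hR⟩ := LinearMap.exists_rightInverse_of_surjective
    (mD EP EM Q.proj p).toLinearMap (LinearMap.range_eq_top.2 (Q.submersion_proj p))
  refine ⟨LinearMap.toContinuousLinearMap R, ?_⟩
  ext v
  exact congrArg (fun L : EM →ₗ[ℝ] EM => L v) hR

/-- With R a right inverse of the differential of π at p, the map y ↦ π(φ⁻¹(φ(p) + R y)) has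
derivative the identity at 0 in charts. Its local inverse yields a smooth section through p, which
is composed with h. -/
theorem exists_local_lift {h : V → M} {U : Set V} (hU : IsOpen U)
    (hh : ContMDiffOn 𝓘(ℝ, V) 𝓘(ℝ, EM) ∞ h U) {x : V} (hx : x ∈ U) {p : P}
    (hp : Q.proj p = h x) : ∃ W ⊆ U, IsOpen W ∧ x ∈ W ∧ ∃ σ : V → P,
      ContMDiffOn 𝓘(ℝ, V) 𝓘(ℝ, EP) ∞ σ W ∧ σ x = p ∧ ∀ z ∈ W, Q.proj (σ z) = h z := by
  obtain ⟨R, hR⟩ := Q.exists_dproj_rightInverse p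
  let φ := extChartAt 𝓘(ℝ, EP) p
  let r₀ := φ p
  let φM := extChartAt 𝓘(ℝ, EM) (Q.proj p)
  let τ : EM → P := fun y => φ.symm (r₀ + R y)
  have hτ : ∀ y, r₀ + R y ∈ φ.target → ContMDiffAt 𝓘(ℝ, EM) 𝓘(ℝ, EP) ∞ τ y := fun y hy =>
    ContMDiffAt.comp (g := φ.symm) (f := fun y => r₀ + R y) y (contMDiffAt_extChartAt_symm hy)
      (ContDiffAt.contMDiffAt (by fun_prop))
  have hT : IsOpen {y : EM | r₀ + R y ∈ φ.target} :=
    (isOpen_extChartAt_target (I := 𝓘(ℝ, EP)) p).preimage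
      (by fun_prop : Continuous fun y => r₀ + R y)
  let S := {y : EM | r₀ + R y ∈ φ.target} ∩ (fun y => Q.proj (τ y)) ⁻¹' φM.source
  have hS : IsOpen S := by
    refine ContinuousOn.isOpen_inter_preimage (fun y hy => ?_) hT (isOpen_extChartAt_source _)
    exact (Q.contMDiff_proj.continuous.continuousAt.comp
      (hτ y hy).continuousAt).continuousWithinAt
  have hf : ContDiffOn ℝ ∞ (fun y => φM (Q.proj (τ y))) S := fun y hy =>
    (contDiffAt_extChartAt_comp (ContMDiffAt.comp (g := Q.proj) y (Q.contMDiff_proj _) (hτ y hy.1))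
      hy.2).contDiffWithinAt
  have hτ0 : τ 0 = p := by
    change φ.symm (r₀ + R 0) = p
    rw [map_zero, add_zero]
    exact extChartAt_to_inv p
  have h0 : (0 : EM) ∈ S := by
    refine ⟨?_, ?_⟩
    · change r₀ + R 0 ∈ φ.target
      rw [map_zero, add_zero]
      exact mem_extChartAt_target p
    · change Q.proj (τ 0) ∈ φM.source
      rw [hτ0]
      exact mem_extChartAt_source _
  have hf' : HasFDerivAt (fun y => φM (Q.proj (τ y)))
      ((ContinuousLinearEquiv.refl ℝ EM : EM ≃L[ℝ] EM) : EM →L[ℝ] EM) 0 := by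
    have h1 : HasD (fun y : EM => r₀ + R y) univ 0 R :=
      hasD_univ_iff_hasFDerivAt.2 (R.hasFDerivAt.const_add r₀)
    have h2 := hasD_extChartAt_symm (E := EP) (mem_extChartAt_target (I := 𝓘(ℝ, EP)) p)
    rw [mD_extChartAt_symm_self] at h2
    have h3 := h2.comp_eq h1 (by simp [r₀, φ])
    have h4 := (Q.hasD_proj p).comp_eq (f := τ) h3 hτ0
    have h5 := hasD_extChartAt (E := EM) (mem_extChartAt_source (I := 𝓘(ℝ, EM)) (Q.proj p))
    rw [mD_extChartAt_self] at h5
    have h6 := hasD_univ_iff_hasFDerivAt.1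
      (h5.comp_eq (f := fun y => Q.proj (τ y)) h4 (congrArg Q.proj hτ0))
    rw [ContinuousLinearMap.id_comp, ContinuousLinearMap.id_comp, hR] at h6
    exact h6
  obtain ⟨e, he0, heS, hef, hes⟩ := exists_smooth_local_inverse hS hf h0 hf'
  have hO : IsOpen (φM.source ∩ φM ⁻¹' e.target) :=
    (continuousOn_extChartAt (Q.proj p)).isOpen_inter_preimage (isOpen_extChartAt_source _)
      e.open_target
  refine ⟨U ∩ h ⁻¹' (φM.source ∩ φM ⁻¹' e.target), inter_subset_left,
    hh.continuousOn.isOpen_inter_preimage hU hO, ⟨hx, ?_, ?_⟩, fun z => τ (e.symm (φM (h z))),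
    fun z hz => ?_, ?_, fun z hz => ?_⟩
  · rw [← hp]
    exact mem_extChartAt_source _
  · have h1 := e.map_source he0
    rw [hef] at h1
    simp only [hτ0] at h1
    change φM (h x) ∈ e.target
    rwa [← hp]
  · have h1 : ContDiffAt ℝ ∞ (fun z => φM (h z)) z :=
      contDiffAt_extChartAt_comp (hh.contMDiffAt (hU.mem_nhds hz.1)) hz.2.1
    have h2 : ContDiffAt ℝ ∞ (fun z => e.symm (φM (h z))) z :=
      (hes.contDiffAt (e.open_target.mem_nhds hz.2.2)).comp z h1
    have h3 := hτ _ (heS (e.map_target hz.2.2)).1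
    exact (ContMDiffAt.comp (g := τ) z h3 h2.contMDiffAt).contMDiffWithinAt
  · have h1 := e.left_inv he0
    rw [hef] at h1
    simp only [hτ0] at h1
    change τ (e.symm (φM (h x))) = p
    rw [← hp, h1, hτ0]
  · have h1 := e.right_inv hz.2.2
    rw [hef] at h1
    exact φM.injOn (heS (e.map_target hz.2.2)).2 hz.2.1 h1

/-- Only the existence of a derivative matters; its value is later forced by x · (y : x) = y. -/
theorem mdifferentiableWithinAt_div {s : Set V} {x : V} {a b : V → P} {L L' : V →L[ℝ] EP}
    (ha : HasD a s x L) (hb : HasD b s x L') (hab : ∀ z ∈ s, Q.proj (a z) = Q.proj (b z))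
    (hx : x ∈ s) : ∃ T : V →L[ℝ] EG, HasD (fun z => Q.div (a z) (b z)) s x T := by
  have h1 := (Q.contMDiffOn_div (a x, b x) (hab x hx)).mdifferentiableWithinAt (by simp)
  have hm : s ⊆ (fun y => (a y, b y)) ⁻¹' {z : P × P | Q.proj z.1 = Q.proj z.2} :=
    fun z hz => hab z hz
  have h2 := h1.hasMFDerivWithinAt.comp x (HasMFDerivWithinAt.prodMk ha hb)
    hm
  exact ⟨_, h2⟩

/-- With σ a local section of π through q, write f(z) as σ(π(f(z))) times a G-valued function and
apply the product rule. On a vector killed by the differential of π the section does not vary, so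
only the fundamental vector remains. -/
theorem exists_fundL_of_dproj_eq_zero (q : P) (v : EP) (hv : mD EP EM Q.proj q v = 0) :
    ∃ ξ, v = Q.fundL q ξ := by
  obtain ⟨f, x, hf, rfl, hD⟩ := exists_chart_map (EP := EP) q
  obtain ⟨σ, hσ, hσx, hσp⟩ : ∃ σ : M → P, MDifferentiableAt 𝓘(ℝ, EM) 𝓘(ℝ, EP) σ (Q.proj (f x)) ∧
      σ (Q.proj (f x)) = f x ∧ ∀ᶠ m in 𝓝 (Q.proj (f x)), Q.proj (σ m) = m := by
    let φM := extChartAt 𝓘(ℝ, EM) (Q.proj (f x))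
    obtain ⟨W, hWU, hW, hxW, τ, hτ, hτx, hτp⟩ := Q.exists_local_lift (h := φM.symm)
      (isOpen_extChartAt_target (I := 𝓘(ℝ, EM)) (Q.proj (f x)))
      (contMDiffOn_extChartAt_symm (Q.proj (f x))) (mem_extChartAt_target _)
      (p := f x) (extChartAt_to_inv _).symm
    refine ⟨fun m => τ (φM m), ?_, hτx, ?_⟩
    · have h1 := ContMDiffAt.comp (g := τ) (Q.proj (f x)) (hτ.contMDiffAt (hW.mem_nhds hxW))
        (contMDiffAt_extChartAt (I := 𝓘(ℝ, EM)) (n := ∞))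
      exact h1.mdifferentiableAt (by simp)
    · have h2 : ∀ᶠ m in 𝓝 (Q.proj (f x)), φM m ∈ W :=
        (continuousAt_extChartAt (I := 𝓘(ℝ, EM)) (Q.proj (f x))) (hW.mem_nhds hxW)
      filter_upwards [h2, (isOpen_extChartAt_source (I := 𝓘(ℝ, EM)) (Q.proj (f x))).mem_nhds
        (mem_extChartAt_source _)] with m hm hm'
      rw [hτp _ hm]
      exact φM.left_inv hm'
  have hfx := (hf.self_of_nhds.mdifferentiableAt (by simp)).hasD
  rw [hD] at hfx
  have h1 := (Q.hasD_proj (f x)).comp_univ hfx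
  have h2 := hσ.hasD.comp_univ (f := fun z => Q.proj (f z)) h1
  have h3 : ∀ᶠ z in 𝓝 x, Q.proj (f z) = Q.proj (σ (Q.proj (f z))) := by
    have : ContinuousAt (fun z => Q.proj (f z)) x := by
      simpa [ContinuousWithinAt, ContinuousAt] using h1.continuousWithinAt
    filter_upwards [this.eventually hσp] with z hz using hz.symm
  obtain ⟨U, hUf, hU, hxU⟩ := mem_nhds_iff.1 h3
  obtain ⟨T, hT⟩ := Q.mdifferentiableWithinAt_div (hfx.mono (subset_univ U))
    (h2.mono (subset_univ U)) hUf hxU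
  have h4 := Q.hasD_act (h2.mono (subset_univ U)) hT.hasLogD
  have h5 : HasD f U x (ContinuousLinearMap.id ℝ EP) := hfx.mono (subset_univ U)
  have h6 := (h4.congr (g := f) (by
    filter_upwards [self_mem_nhdsWithin] with z hz using (Q.act_div _ _ (hUf hz)).symm)
    (Q.act_div _ _ (hUf hxU)).symm).unique h5 (hU.uniqueDiffWithinAt hxU)
  have h7 := congrArg (fun L : EP →L[ℝ] EP => L v) h6
  simp only [add_apply, ContinuousLinearMap.comp_apply, ContinuousLinearMap.id_apply, hv, map_zero,
    zero_add, Q.act_div _ _ (hUf hxU)] at h7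
  exact ⟨_, h7.symm⟩

end Principal2Bundle

end Lift

/-! ### Descent of the 2-curvature to the base -/

section Descent

variable {EG EH G H : Type*}
    [NormedAddCommGroup EG] [NormedSpace ℝ EG] [NormedAddCommGroup EH] [NormedSpace ℝ EH]
    [TopologicalSpace G] [ChartedSpace EG G] [Group G] [LieGroup 𝓘(ℝ, EG) ∞ G]
    [TopologicalSpace H] [ChartedSpace EH H] [Group H] [LieGroup 𝓘(ℝ, EH) ∞ H]
    {X : LieCrossedModule EG EH G H}
    {EM EP EP₁ M P P₁ : Type*}
    [NormedAddCommGroup EM] [NormedSpace ℝ EM] [NormedAddCommGroup EP] [NormedSpace ℝ EP]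
    [NormedAddCommGroup EP₁] [NormedSpace ℝ EP₁]
    [TopologicalSpace M] [ChartedSpace EM M] [TopologicalSpace P] [ChartedSpace EP P]
    [TopologicalSpace P₁] [ChartedSpace EP₁ P₁] [IsManifold 𝓘(ℝ, EP) ∞ P]
    [IsManifold 𝓘(ℝ, EM) ∞ M]
    [FiniteDimensional ℝ EG] [FiniteDimensional ℝ EH] [FiniteDimensional ℝ EP]
    [FiniteDimensional ℝ EM]
    {V : Type*} [NormedAddCommGroup V] [NormedSpace ℝ V] [FiniteDimensional ℝ V]
    {Q : Principal2Bundle X EM EP EP₁ M P P₁}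

namespace TwoConnection

variable (AB : TwoConnection Q)

/-- The 2-curvature as an alternating map. -/
noncomputable def curvatureForm (q : P) : EP [⋀^Fin 3]→L[ℝ] EH :=
  (show EP [⋀^Fin 3]→L[ℝ] EH from AB.B.d q) +
    ContinuousAlternatingMap.alternatizeUncurryFin (LinearMap.toContinuousLinearMap
      { toFun := fun v : EP => (X.αStarL (AB.AL q v)).compContinuousAlternatingMap (AB.BL q)
        map_add' := fun v w => by ext u; simp
        map_smul' := fun c v => by ext u; simp })

theorem curvatureForm_apply (q : P) (v : Fin 3 → EP) :
    AB.curvatureForm q v = AB.curvature3 q v := by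
  rw [curvatureForm, ContinuousAlternatingMap.add_apply,
    ContinuousAlternatingMap.alternatizeUncurryFin_apply, Fin.sum_univ_three]
  have h1 : Fin.removeNth (0 : Fin 3) v = ![v 1, v 2] := by
    ext i; fin_cases i <;> rfl
  have h2 : Fin.removeNth (1 : Fin 3) v = ![v 0, v 2] := by
    ext i; fin_cases i <;> rfl
  have h3 : Fin.removeNth (2 : Fin 3) v = ![v 0, v 1] := by
    ext i; fin_cases i <;> rfl
  have h4 : AB.curvature3 q v = (show EP [⋀^Fin 3]→L[ℝ] EH from AB.B.d q) v +
      X.αStarL (AB.AL q (v 0)) (AB.BL q ![v 1, v 2]) -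
      X.αStarL (AB.AL q (v 1)) (AB.BL q ![v 0, v 2]) +
      X.αStarL (AB.AL q (v 2)) (AB.BL q ![v 0, v 1]) := by
    simp only [AL_apply, ← X.αStar_eq]
    rfl
  rw [h4]
  simp [h1, h2, h3]
  abel

theorem contDiffAt_curvature3_pull {f : V → P} {x : V}
    (hf : ∀ᶠ z in 𝓝 x, ContMDiffAt 𝓘(ℝ, V) 𝓘(ℝ, EP) ∞ f z) (v : Fin 3 → V) :
    ContDiffAt ℝ ∞ (fun z => AB.curvature3 (f z) (fun i => mD V EP f z (v i))) x := by
  have hfx := hf.self_of_nhds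
  have hD : ∀ v w u, ContDiffAt ℝ ∞ (fun z => fderiv ℝ (fun z => AB.pullB f z v w) z u) x :=
    fun v w u => ((AB.contDiffAt_pullB hfx v w).fderiv_right (m := ∞) (by simp)).clm_apply
      contDiffAt_const
  have hα : ∀ u v w, ContDiffAt ℝ ∞
      (fun z => X.αStarL (AB.pullA f z u) (AB.pullB f z v w)) x := fun u v w =>
    (X.αStarL.contDiff.contDiffAt.comp x (AB.contDiffAt_pullA hfx u)).clm_apply
      (AB.contDiffAt_pullB hfx v w)
  refine ContDiffAt.congr_of_eventuallyEq ?_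
    (by filter_upwards [hf] with z hz using AB.curvature3_pull hz v)
  exact ((((((hD _ _ _).sub (hD _ _ _)).add (hD _ _ _)).add (hα _ _ _)).sub (hα _ _ _)).add
    (hα _ _ _))

/-- Here q' = q·g, and each v'ᵢ differs from the translate of vᵢ by a vertical, hence fundamental,
vector; so `curvature3_translate` applies. -/
theorem curvature3_eq_of_dproj_eq
    (hfix : ∀ (g : G) (q : P) (v : Fin 3 → EP),
      X.αStarGroup g (AB.curvature3 q v) = AB.curvature3 q v)
    {q q' : P} (hq : Q.proj q' = Q.proj q) {v v' : Fin 3 → EP}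
    (hv : ∀ i, mD EP EM Q.proj q' (v' i) = mD EP EM Q.proj q (v i)) :
    AB.curvature3 q' v' = AB.curvature3 q v := by
  obtain ⟨g, rfl⟩ : ∃ g, Q.act q g = q' := ⟨_, Q.act_div q' q hq⟩
  have h : ∀ i, ∃ ξ, v' i - Q.dRL g q (v i) = Q.fundL (Q.act q g) ξ := fun i => by
    refine Q.exists_fundL_of_dproj_eq_zero _ _ ?_
    rw [map_sub, hv, sub_eq_zero]
    exact (congrArg (fun L : EP →L[ℝ] EM => L (v i)) (Q.dproj_dRL g q)).symm
  choose ξ hξ using h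
  have h1 : v' = fun i => Q.dRL g q (v i) + Q.fundL (Q.act q g) (ξ i) := by
    funext i
    rw [← hξ]
    abel
  rw [h1]
  exact (AB.curvature3_translate q g v ξ).trans (hfix _ _ _)

theorem exists_unique_descent
    (hfix : ∀ (g : G) (q : P) (v : Fin 3 → EP),
      X.αStarGroup g (AB.curvature3 q v) = AB.curvature3 q v) :
    ∃! K : MForm EM M 3 EH, K.IsSmooth ∧ (∀ m v, X.tStar (K m v) = 0) ∧
      ∀ (q : P) (v : Fin 3 → TangentSpace 𝓘(ℝ, EP) q),
        K (Q.proj q) (fun i => mfderiv 𝓘(ℝ, EP) 𝓘(ℝ, EM) Q.proj q (v i)) =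
          AB.curvature3 q v := by
  choose s hs using Q.surjective_proj
  choose R hR using Q.exists_dproj_rightInverse
  have hR' : ∀ q v, mD EP EM Q.proj q (R q v) = v := fun q v =>
    congrArg (fun L : EM →L[ℝ] EM => L v) (hR q)
  -- The point `s m` over m and the linear lift `R` of tangent vectors are arbitrary; `hpull` shows
  -- that they do not matter.
  let K' : M → EM [⋀^Fin 3]→L[ℝ] EH := fun m =>
    (AB.curvatureForm (s m)).compContinuousLinearMap (R (s m))
  have hK' : ∀ m v, K' m v = AB.curvature3 (s m) (fun i => R (s m) (v i)) := fun m v =>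
    AB.curvatureForm_apply _ _
  have hpull : ∀ m (q : P), Q.proj q = m → ∀ v : Fin 3 → EP,
      K' m (fun i => mD EP EM Q.proj q (v i)) = AB.curvature3 q v := by
    rintro m q hq v
    rw [hK']
    exact AB.curvature3_eq_of_dproj_eq hfix ((hs m).trans hq.symm) fun i => hR' _ _
  refine ⟨K', ⟨?_, ?_, fun q v => hpull _ q rfl v⟩, ?_⟩
  · intro m₀ y hy
    refine ContDiffAt.contDiffWithinAt (contDiffAt_alternating fun v => ?_)
    let ψ := (extChartAt 𝓘(ℝ, EM) m₀).symm
    obtain ⟨p, hp⟩ := Q.surjective_proj (ψ y)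
    -- The choices `s` and `R` need not be continuous. Near y they are traded for a smooth lift σ of
    -- the inverse chart, along which K' is the pulled back 2-curvature.
    obtain ⟨W, hWt, hW, hyW, σ, hσ, -, hσp⟩ := Q.exists_local_lift (h := ψ)
      (isOpen_extChartAt_target (I := 𝓘(ℝ, EM)) m₀) (contMDiffOn_extChartAt_symm m₀) hy hp
    have hσ' : ∀ z ∈ W, ContMDiffAt 𝓘(ℝ, EM) 𝓘(ℝ, EP) ∞ σ z := fun z hz =>
      hσ.contMDiffAt (hW.mem_nhds hz)
    refine (AB.contDiffAt_curvature3_pull (f := σ) (x := y)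
      (by filter_upwards [hW.mem_nhds hyW] with z hz using hσ' z hz) v).congr_of_eventuallyEq ?_
    filter_upwards [hW.mem_nhds hyW] with z hz
    have h1 : mD EM EM ψ z = mD EP EM Q.proj (σ z) ∘L mD EM EP σ z := by
      have h2 := (Q.hasD_proj (σ z)).comp_univ ((hσ' z hz).mdifferentiableAt (by simp)).hasD
      refine (h2.congr_nhds ?_).mD_eq
      filter_upwards [hW.mem_nhds hz] with w hw using (hσp w hw).symm
    rw [← hpull (ψ z) (σ z) (hσp z hz)]
    change K' (ψ z) (fun i => mD EM EM ψ z (v i)) = _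
    rw [h1]
    rfl
  · intro m v
    exact (congrArg X.tStar (hK' m v)).trans (AB.tStar_curvature3 _ _)
  · rintro K ⟨-, -, hK⟩
    funext m
    obtain ⟨q, rfl⟩ := Q.surjective_proj m
    refine ContinuousAlternatingMap.ext fun v => ?_
    have h1 : v = fun i => mD EP EM Q.proj q (R q (v i)) := by
      funext i
      exact (hR' q (v i)).symm
    rw [h1]
    exact (hK q fun i => R q (v i)).trans (hpull _ q rfl _).symm

end TwoConnection

end Descent

/-! ### Horizontal lifts -/

section Velocity

variable {E : Type*} [NormedAddCommGroup E] [NormedSpace ℝ E]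
  {N : Type*} [TopologicalSpace N] [ChartedSpace E N]

theorem velocity_eq {c : ℝ → N} {t : ℝ} (ht : t ∈ Icc (0 : ℝ) 1) {L : ℝ →L[ℝ] E}
    (h : HasD c (Icc 0 1) t L) : velocity (E := E) c t = L 1 := by
  have h1 := HasMFDerivWithinAt.mfderivWithin h
    ((uniqueDiffOn_Icc zero_lt_one t ht).uniqueMDiffWithinAt)
  exact congrArg (fun L : ℝ →L[ℝ] E => L 1) h1

end Velocity

section HorizontalLift

variable {EG EH G H : Type*}
    [NormedAddCommGroup EG] [NormedSpace ℝ EG] [NormedAddCommGroup EH] [NormedSpace ℝ EH]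
    [TopologicalSpace G] [ChartedSpace EG G] [Group G] [LieGroup 𝓘(ℝ, EG) ∞ G] [T2Space G]
    [TopologicalSpace H] [ChartedSpace EH H] [Group H] [LieGroup 𝓘(ℝ, EH) ∞ H]
    {X : LieCrossedModule EG EH G H}
    {EM EP EP₁ M P P₁ : Type*}
    [NormedAddCommGroup EM] [NormedSpace ℝ EM] [NormedAddCommGroup EP] [NormedSpace ℝ EP]
    [NormedAddCommGroup EP₁] [NormedSpace ℝ EP₁]
    [TopologicalSpace M] [ChartedSpace EM M] [TopologicalSpace P] [ChartedSpace EP P]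
    [TopologicalSpace P₁] [ChartedSpace EP₁ P₁] [IsManifold 𝓘(ℝ, EP) ∞ P]
    [IsManifold 𝓘(ℝ, EM) ∞ M]
    [FiniteDimensional ℝ EG] [FiniteDimensional ℝ EP] [FiniteDimensional ℝ EM]
    {Q : Principal2Bundle X EM EP EP₁ M P P₁}

namespace TwoConnection

variable (AB : TwoConnection Q)

/-- The curve `c` over `γ` has a horizontal derivative at `t` within `J`. -/
def HorAt (γ : ℝ → M) (c : ℝ → P) (J : Set ℝ) (t : ℝ) : Prop :=
  Q.proj (c t) = γ t ∧ ∃ L : ℝ →L[ℝ] EP, HasD c J t L ∧ AB.AL (c t) (L 1) = 0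

variable {AB} in
theorem HorAt.mono {γ : ℝ → M} {c : ℝ → P} {J J' : Set ℝ} {t : ℝ} (h : AB.HorAt γ c J t)
    (hJ : J' ⊆ J) : AB.HorAt γ c J' t := by
  obtain ⟨h1, L, hL, h2⟩ := h
  exact ⟨h1, L, hL.mono hJ, h2⟩

variable {AB} in
theorem HorAt.congr_nhds {γ : ℝ → M} {c c' : ℝ → P} {t : ℝ} (h : AB.HorAt γ c univ t)
    (hc : c' =ᶠ[𝓝 t] c) : AB.HorAt γ c' univ t := by
  obtain ⟨h1, L, hL, h2⟩ := h
  refine ⟨by rwa [hc.self_of_nhds], L, hL.congr_nhds hc, by rwa [hc.self_of_nhds]⟩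

theorem AL_act_deriv (q : P) (g : G) (L : ℝ →L[ℝ] EP) (L' : ℝ →L[ℝ] EG) (v : ℝ) :
    AB.AL (Q.act q g) ((Q.dRL g q ∘L L + Q.fundL (Q.act q g) ∘L L') v) =
      lieAd g⁻¹ (AB.AL q (L v)) + L' v := by
  rw [add_apply, ContinuousLinearMap.comp_apply, ContinuousLinearMap.comp_apply, map_add,
    AL_dRL, AL_fundL]

variable {AB} in
-- Write c' = c·g with g the fibrewise quotient. Horizontality of both curves leaves g⁻¹g' = 0, so g
-- stays at its value 1 at t₀.
theorem HorAt.eqOn {γ : ℝ → M} {c c' : ℝ → P} {J : Set ℝ} (hJ : J.OrdConnected)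
    (hJu : UniqueDiffOn ℝ J) (hc : ∀ t ∈ J, AB.HorAt γ c J t) (hc' : ∀ t ∈ J, AB.HorAt γ c' J t)
    {t₀ : ℝ} (ht₀ : t₀ ∈ J) (h₀ : c t₀ = c' t₀) : EqOn c c' J := by
  have hproj : ∀ t ∈ J, Q.proj (c' t) = Q.proj (c t) := fun t ht =>
    (hc' t ht).1.trans (hc t ht).1.symm
  have hg : ∀ t ∈ J, HasD (fun t => Q.div (c' t) (c t)) J t (0 : ℝ →L[ℝ] EG) := by
    intro t ht
    obtain ⟨-, L, hL, hL0⟩ := hc t ht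
    obtain ⟨-, L', hL', hL0'⟩ := hc' t ht
    obtain ⟨T, hT⟩ := Q.mdifferentiableWithinAt_div hL' hL hproj ht
    have h1 := hT.hasLogD
    set T' := mD EG EG (fun z : G => (Q.div (c' t) (c t))⁻¹ * z) (Q.div (c' t) (c t)) ∘L T
    have h2 := (Q.hasD_act hL h1).congr (g := c') (by
      filter_upwards [self_mem_nhdsWithin] with z hz using (Q.act_div _ _ (hproj z hz)).symm)
      (Q.act_div _ _ (hproj t ht)).symm
    have h3 := h2.unique hL' (hJu t ht)
    have h4 : T' = 0 := by
      ext
      rw [← h3] at hL0'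
      have h6 : AB.AL (Q.act (c t) (Q.div (c' t) (c t)))
          ((Q.dRL (Q.div (c' t) (c t)) (c t) ∘L L +
            Q.fundL (Q.act (c t) (Q.div (c' t) (c t))) ∘L T') 1) = 0 := by
        rw [← Q.act_div _ _ (hproj t ht)] at hL0'
        convert hL0' using 4 <;> simp [Q.act_div _ _ (hproj t ht)]
      rw [AL_act_deriv, hL0, map_zero, zero_add] at h6
      simpa using h6
    rw [h4] at h1
    simpa using h1.hasD
  intro t ht
  have h1 := eq_of_hasD_zero hJ hg ht ht₀
  simp only [h₀, Q.div_self] at h1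
  have h2 := Q.act_div _ _ (hproj t ht)
  rwa [h1, Q.act_one] at h2

/-- Locally take any smooth lift σ of h and correct it to σ·(k⁻¹g). The equation k⁻¹k' = A(∂tσ)
makes the result horizontal, and g, constant in t, adjusts the initial value. As σ and k do not
involve the initial value, neither does the length of the time interval, and the local lifts can be
glued. -/
theorem exists_horizontal_lift [FiniteDimensional ℝ EH] {Λ : Type} [NormedAddCommGroup Λ]
    [NormedSpace ℝ Λ]
    [FiniteDimensional ℝ Λ] {h : Λ → ℝ → M}
    (hh : ContMDiff 𝓘(ℝ, Λ × ℝ) 𝓘(ℝ, EM) ∞ fun z : Λ × ℝ => h z.1 z.2) {x₀ : Λ → P}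
    (hx₀ : ContMDiff 𝓘(ℝ, Λ) 𝓘(ℝ, EP) ∞ x₀) (hx₀' : ∀ l, Q.proj (x₀ l) = h l 0) :
    ∃ c : Λ → ℝ → P, ContMDiff 𝓘(ℝ, Λ × ℝ) 𝓘(ℝ, EP) ∞ (fun z : Λ × ℝ => c z.1 z.2) ∧
      ∀ l, c l 0 = x₀ l ∧ ∀ t, AB.HorAt (h l) (c l) univ t := by
  refine exists_global_solution (Sol := fun l c t => AB.HorAt (h l) c univ t)
    (Fib := fun l t => {p | Q.proj p = h l t}) (fun l c c' t h h' => h'.congr_nhds h.symm)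
    (fun _ _ _ h => h.1) ?_ ?_ x₀ hx₀ hx₀'
  · intro l J c c' hJ hJo hc hc' t₀ ht₀ h
    exact HorAt.eqOn hJo hJ.uniqueDiffOn (fun t ht => (hc t ht).mono (subset_univ _))
      (fun t ht => (hc' t ht).mono (subset_univ _)) ht₀ h
  · intro l₀ t₀
    obtain ⟨p, hp⟩ := Q.surjective_proj (h l₀ t₀)
    obtain ⟨U, -, hU, h0U, σ, hσ, -, hσp⟩ := Q.exists_local_lift isOpen_univ hh.contMDiffOn
      (mem_univ (l₀, t₀)) hp
    have hσ' : ∀ z ∈ U, ContMDiffAt 𝓘(ℝ, Λ × ℝ) 𝓘(ℝ, EP) ∞ σ z := fun z hz =>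
      hσ.contMDiffAt (hU.mem_nhds hz)
    have hb : ContDiffOn ℝ ∞ (fun z => AB.pullA σ z ((0, 1) : Λ × ℝ)) U := fun z hz =>
      (AB.contDiffAt_pullA (hσ' z hz) _).contDiffWithinAt
    obtain ⟨ε, hε, hεU, K⟩ := exists_local_group_ode (G := G) hU hb h0U
    refine ⟨ε, hε, fun t₁ ht₁ W x hW hl₀ hx hxp => ?_⟩
    obtain ⟨k, hk, hk'⟩ := K t₁ ht₁
    let g : Λ → G := fun l => Q.div (x l) (σ (l, t₁))
    have hdom : ∀ l ∈ W ∩ Metric.ball l₀ ε, ∀ t ∈ Metric.ball t₀ ε, (l, t) ∈ U :=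
      fun l hl t ht => hεU ⟨hl.2, ht⟩
    have hgp : ∀ l ∈ W ∩ Metric.ball l₀ ε, Q.proj (x l) = Q.proj (σ (l, t₁)) := fun l hl =>
      (hxp l hl.1).trans (hσp _ (hdom l hl t₁ ht₁)).symm
    have hg : ContMDiffOn 𝓘(ℝ, Λ) 𝓘(ℝ, EG) ∞ g (W ∩ Metric.ball l₀ ε) := by
      have h1 : ContMDiffOn 𝓘(ℝ, Λ) 𝓘(ℝ, EP) ∞ (fun l => σ (l, t₁)) (W ∩ Metric.ball l₀ ε) := by
        have h2 : ContMDiff 𝓘(ℝ, Λ) 𝓘(ℝ, Λ × ℝ) ∞ fun l : Λ => (l, t₁) :=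
          ContDiff.contMDiff (by fun_prop)
        exact hσ.comp h2.contMDiffOn fun l hl => hdom l hl t₁ ht₁
      have h2 : W ∩ Metric.ball l₀ ε ⊆ (fun l => (x l, σ (l, t₁))) ⁻¹'
          {z : P × P | Q.proj z.1 = Q.proj z.2} := fun l hl => hgp l hl
      exact Q.contMDiffOn_div.comp ((hx.mono inter_subset_left).prodMk h1) h2
    refine ⟨W ∩ Metric.ball l₀ ε, inter_subset_left, hW.inter Metric.isOpen_ball,
      ⟨hl₀, Metric.mem_ball_self hε⟩, fun l t => Q.act (σ (l, t)) ((k l t)⁻¹ * g l), ?_,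
      fun l hl => ⟨?_, fun t ht => ⟨?_, ?_⟩⟩⟩
    · have h1 : ContMDiffOn 𝓘(ℝ, Λ × ℝ) 𝓘(ℝ, EG) ∞ (fun z : Λ × ℝ => g z.1)
          ((W ∩ Metric.ball l₀ ε) ×ˢ Metric.ball t₀ ε) := by
        have h2 : ContMDiff 𝓘(ℝ, Λ × ℝ) 𝓘(ℝ, Λ) ∞ fun z : Λ × ℝ => z.1 :=
          ContDiff.contMDiff (by fun_prop)
        exact hg.comp h2.contMDiffOn fun z hz => hz.1
      have h2 := ((hk.mono (prod_mono inter_subset_right subset_rfl)).inv).mul h1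
      have h3 := hσ.mono fun z (hz : z ∈ (W ∩ Metric.ball l₀ ε) ×ˢ Metric.ball t₀ ε) =>
        hdom z.1 hz.1 z.2 hz.2
      exact Q.contMDiff_act.comp_contMDiffOn (h3.prodMk h2)
    · change Q.act (σ (l, t₁)) ((k l t₁)⁻¹ * g l) = x l
      rw [(hk' l hl.2).1, inv_one, one_mul]
      exact Q.act_div _ _ (hgp l hl)
    · rw [Q.proj_act]
      exact hσp _ (hdom l hl t ht)
    · have hlt := hdom l hl t ht
      have h1 : HasD (fun t => σ (l, t)) univ t
          (mD (Λ × ℝ) EP σ (l, t) ∘L ContinuousLinearMap.inr ℝ Λ ℝ) :=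
        ((hσ' _ hlt).mdifferentiableAt (by simp)).hasD.comp_univ (f := fun t => (l, t))
          (hasD_univ_iff_hasFDerivAt.2 (hasFDerivAt_prodMk_right l t))
      have h2 := ((hk' l hl.2).2 t ht).inv.mul (hasLogD_const (E := EG) (g l) univ t)
      refine ⟨_, Q.hasD_act h1 h2, ?_⟩
      have h3 : AB.AL (σ (l, t)) ((mD (Λ × ℝ) EP σ (l, t) ∘L ContinuousLinearMap.inr ℝ Λ ℝ) 1) =
          AB.pullA σ (l, t) (0, 1) := rfl
      change AB.AL (Q.act (σ (l, t)) ((k l t)⁻¹ * g l)) _ = 0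
      rw [AL_act_deriv, h3, mul_inv_rev, inv_inv, lieAd_mul]
      simp

/-- Uniqueness identifies the curve chosen in the definition of `horLift`, but only on [0, 1];
outside it the choice is arbitrary. -/
theorem horLift_eqOn {γ : ℝ → M} {p : P} {c : ℝ → P}
    (hc : ContMDiffOn 𝓘(ℝ, ℝ) 𝓘(ℝ, EP) ∞ c (Icc 0 1))
    (hh : ∀ t ∈ Icc (0 : ℝ) 1, AB.HorAt γ c (Icc 0 1) t) (h0 : c 0 = p) :
    EqOn (AB.horLift γ p) c (Icc 0 1) := by
  have hex : ∃ c : ℝ → P, AB.IsHorizontalLift γ c ∧ c 0 = p := by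
    refine ⟨c, ⟨hc, fun t ht => ⟨(hh t ht).1, ?_⟩⟩, h0⟩
    obtain ⟨-, L, hL, hL0⟩ := hh t ht
    rw [velocity_eq ht hL]
    rw [AL_apply] at hL0
    exact hL0
  have hs := hex.choose_spec
  have hdef : AB.horLift γ p = hex.choose := dif_pos hex
  rw [hdef]
  refine HorAt.eqOn (AB := AB) (γ := γ) ordConnected_Icc (uniqueDiffOn_Icc zero_lt_one)
    (fun t ht => ⟨(hs.1.2 t ht).1, ?_⟩) hh (left_mem_Icc.2 zero_le_one) (hs.2.trans h0.symm)
  have h1 : HasD hex.choose (Icc 0 1) t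
      (show ℝ →L[ℝ] EP from mfderivWithin 𝓘(ℝ, ℝ) 𝓘(ℝ, EP) hex.choose (Icc 0 1) t) :=
    (((hs.1.1 t ht).mdifferentiableWithinAt (by simp))).hasMFDerivWithinAt
  refine ⟨_, h1, ?_⟩
  rw [AL_apply]
  exact (hs.1.2 t ht).2

end TwoConnection

end HorizontalLift

/-! ### Variation of path ordered exponentials -/

section Variation

variable {E : Type u} [NormedAddCommGroup E] [NormedSpace ℝ E] [FiniteDimensional ℝ E]
  {H : Type*} [TopologicalSpace H] [ChartedSpace E H] [Group H] [LieGroup 𝓘(ℝ, E) ∞ H]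
  [T2Space H]

/-- A solution of `v' = [v, b]` that vanishes at `0` is zero. -/
theorem eq_zero_of_hasDerivWithinAt_lieBr {b v : ℝ → E} {k : ℝ → H}
    (hk : ∀ s ∈ Icc (0 : ℝ) 1,
      HasLogD k (Icc 0 1) s ((ContinuousLinearMap.id ℝ ℝ).smulRight (b s)))
    (hv : ∀ s ∈ Icc (0 : ℝ) 1,
      HasDerivWithinAt v (lieBrL E H (v s) (b s)) (Icc 0 1) s) (hv0 : v 0 = 0) : v 1 = 0 := by
  -- The derivative of Ad_k v is Ad_k([b, v] + v'), which vanishes by the equation.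
  have h1 : ∀ s ∈ Icc (0 : ℝ) 1,
      HasD (fun s => lieAd (EG := E) (k s) (v s)) (Icc 0 1) s (0 : ℝ →L[ℝ] E) := by
    intro s hs
    have h2 := (LieCrossedModule.conj E H).hasFDerivWithinAt_αStarGroup (hk s hs)
    have h3 := h2.clm_apply (hv s hs).hasFDerivWithinAt
    rw [hasD_iff_hasFDerivWithinAt]
    refine h3.congr_fderiv ?_
    ext
    have h4 : (LieCrossedModule.conj E H).αStarL (b s) (v s) = -lieBrL E H (v s) (b s) := by
      rw [LieCrossedModule.conj_αStarL, ← lieBr_eq_lieBrL, lieBr_swap]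
    simp [h4]
  have h2 := eq_of_hasD_zero ordConnected_Icc h1 (right_mem_Icc.2 zero_le_one)
    (left_mem_Icc.2 zero_le_one)
  rw [hv0, map_zero] at h2
  have h3 := congrArg (fun L : E →L[ℝ] E => L (v 1)) (lieAd_inv_comp (E := E) (k 1))
  simp only [ContinuousLinearMap.comp_apply] at h3
  rw [h2, map_zero] at h3
  exact h3.symm

/-- For w = k⁻¹∂u k the Maurer–Cartan equation gives w' = ∂u b + [w, b]. Substituting ∂u b = κ + c'
- [c, b], and using that Y = ∫κ is central, v = w - c - Y satisfies v' = [v, b] and v(0) = 0, hence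
v(1) = 0. So c acts as a gauge correction that disappears at both ends. -/
theorem logD_variation {k : ℝ → ℝ → H}
    (hk : ContMDiff 𝓘(ℝ, ℝ × ℝ) 𝓘(ℝ, E) ∞ (fun z : ℝ × ℝ => k z.1 z.2)) {b : ℝ × ℝ → E}
    (hb : ∀ u s, HasLogD (k u) univ s ((ContinuousLinearMap.id ℝ ℝ).smulRight (b (u, s))))
    (hk0 : ∀ u, k u 0 = 1) {u : ℝ} {c c' κ : ℝ → E}
    (hc : ∀ s ∈ Icc (0 : ℝ) 1, HasDerivWithinAt c (c' s) (Icc 0 1) s) (hc0 : c 0 = 0)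
    (hc1 : c 1 = 0) (hκ : Continuous κ)
    (hκc : ∀ s ∈ Icc (0 : ℝ) 1, ∀ η, lieBrL E H (κ s) η = 0)
    (hκe : ∀ s ∈ Icc (0 : ℝ) 1,
      κ s = fderiv ℝ b (u, s) (1, 0) - c' s + lieBrL E H (c s) (b (u, s))) :
    logD E (fun z : ℝ × ℝ => k z.1 z.2) (u, 1) (1, 0) = ∫ s in (0 : ℝ)..1, κ s := by
  have : CompleteSpace E := FiniteDimensional.complete ℝ E
  let K : ℝ × ℝ → H := fun z => k z.1 z.2
  have hKl : ∀ z, HasLogD K univ z (logD E K z) := fun z =>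
    hasLogD_logD (hk.mdifferentiable (by simp) z)
  have hKb : ∀ z, logD E K z (0, 1) = b z := by
    intro z
    have h1 := HasLogD.comp (g := fun s : ℝ => (z.1, s)) (x := z.2) (s := univ) (hKl z)
      (hasFDerivAt_prodMk_right z.1 z.2).hasFDerivWithinAt (mapsTo_univ _ _)
    simpa using congrArg (fun L : ℝ →L[ℝ] E => L 1) (h1.unique_univ (hb z.1 z.2))
  have hKs : ContDiff ℝ ∞ (logD E K) := contDiff_iff_contDiffAt.2 fun z => contDiffAt_logD (hk z)
  have hKd : ∀ z, HasFDerivAt (logD E K) (fderiv ℝ (logD E K) z) z := fun z =>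
    (hKs.differentiable (by simp) z).hasFDerivAt
  let w : ℝ → E := fun s => logD E K (u, s) (1, 0)
  have hw0 : w 0 = 0 := by
    have h1 := HasLogD.comp (g := fun u : ℝ => (u, (0 : ℝ))) (x := u) (s := univ) (hKl (u, 0))
      (hasFDerivAt_prodMk_left u (0 : ℝ)).hasFDerivWithinAt (mapsTo_univ _ _)
    have h2 : (fun u : ℝ => K (u, (0 : ℝ))) = fun _ => 1 := funext hk0
    rw [h2] at h1
    simpa using congrArg (fun L : ℝ →L[ℝ] E => L 1)
      (h1.unique_univ (hasLogD_const (E := E) (1 : H) univ u))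
  have hw : ∀ s, HasDerivAt w (fderiv ℝ b (u, s) (1, 0) + lieBrL E H (w s) (b (u, s))) s := by
    intro s
    have h1 := (hKd (u, s)).comp_hasDerivAt s
      ((hasDerivAt_const s u).prodMk (hasDerivAt_id s))
    have h2 := h1.clm_apply (hasDerivAt_const s ((1, 0) : ℝ × ℝ))
    refine h2.congr_deriv ?_
    have h3 := maurerCartan (hk (u, s)) (0, 1) (1, 0)
    have h4 : HasFDerivAt b ((ContinuousLinearMap.apply ℝ E ((0, 1) : ℝ × ℝ)) ∘L
        fderiv ℝ (logD E K) (u, s)) (u, s) := by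
      have h5 := (ContinuousLinearMap.apply ℝ E ((0, 1) : ℝ × ℝ)).hasFDerivAt.comp (u, s)
        (hKd (u, s))
      have h6 : b = (ContinuousLinearMap.apply ℝ E ((0, 1) : ℝ × ℝ)) ∘ logD E K :=
        funext fun z => (hKb z).symm
      rw [h6]
      exact h5
    rw [h4.fderiv]
    rw [lieBr_eq_lieBrL, ← lieBr_eq_lieBrL, lieBr_swap, neg_neg, lieBr_eq_lieBrL] at h3
    have h7 : logD E (fun z : ℝ × ℝ => k z.1 z.2) (u, s) (0, 1) = b (u, s) := hKb (u, s)
    rw [h7, sub_eq_iff_eq_add'] at h3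
    simpa [w] using h3
  let Y : ℝ → E := fun s => ∫ r in (0 : ℝ)..s, κ r
  have hY : ∀ s, HasDerivAt Y (κ s) s := fun s => hκ.integral_hasStrictDerivAt 0 s |>.hasDerivAt
  have hYc : ∀ s ∈ Icc (0 : ℝ) 1, ∀ η, lieBrL E H (Y s) η = 0 := by
    intro s hs η
    have h1 := ((lieBrL E H).flip η).intervalIntegral_comp_comm (hκ.intervalIntegrable
      (μ := MeasureTheory.volume) 0 s)
    have h2 : ∀ r ∈ uIcc 0 s, (lieBrL E H).flip η (κ r) = 0 := by
      intro r hr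
      rw [uIcc_of_le hs.1] at hr
      exact hκc r ⟨hr.1, hr.2.trans hs.2⟩ η
    rw [intervalIntegral.integral_congr (g := fun _ => 0) h2] at h1
    simpa using h1.symm
  have hv := eq_zero_of_hasDerivWithinAt_lieBr (H := H) (b := fun s => b (u, s))
    (v := fun s => w s - c s - Y s) (k := k u) (fun s _ => (hb u s).mono (subset_univ _))
    (fun s hs => by
      refine (((hw s).hasDerivWithinAt.sub (hc s hs)).sub (hY s).hasDerivWithinAt).congr_deriv ?_
      rw [hκe s hs, map_sub, map_sub, sub_apply, sub_apply, hYc s hs]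
      abel)
    (by simp [hw0, hc0, Y])
  simp only [hc1, sub_zero] at hv
  exact sub_eq_zero.1 hv

/-- The path ordered exponential of a curve of central elements is the exponential of its
integral. -/
theorem pathOrderedExp_of_central {Z : ℝ → E} (hZ : ContDiff ℝ ∞ Z)
    (hZc : ∀ s ∈ Icc (0 : ℝ) 1, ∀ η, lieBrL E H (Z s) η = 0) :
    pathOrderedExp (E := E) (H := H) Z = lieExp (E := E) (H := H) (∫ s in (0 : ℝ)..1, Z s : E) := by
  have : CompleteSpace E := FiniteDimensional.complete ℝ E
  set Zm : E := ∫ s in (0 : ℝ)..1, Z s with hZm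
  have hZmc : ∀ η, lieBrL E H Zm η = 0 := by
    intro η
    have h1 := ((lieBrL E H).flip η).intervalIntegral_comp_comm (hZ.continuous.intervalIntegrable
      (μ := MeasureTheory.volume) 0 1)
    have h2 : ∀ r ∈ uIcc (0 : ℝ) 1, (lieBrL E H).flip η (Z r) = 0 := by
      intro r hr
      rw [uIcc_of_le zero_le_one] at hr
      exact hZc r hr η
    rw [intervalIntegral.integral_congr (g := fun _ => 0) h2] at h1
    simpa using h1.symm
  -- Interpolate linearly between Z and its mean. The u-derivative is central with integral zero, so
  -- by the variation formula the end point of the solution does not depend on u.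
  let b : ℝ × ℝ → E := fun z => Z z.2 + z.1 • (Zm - Z z.2)
  have hb : ContDiff ℝ ∞ b := by fun_prop
  obtain ⟨k, hk, hk'⟩ := exists_group_ode (G := H) hb
  have hb' : ∀ u s, fderiv ℝ b (u, s) (1, 0) = Zm - Z s := by
    intro u s
    have h1 := HasFDerivAt.comp (g := b) (f := fun u : ℝ => (u, s)) u
      (hb.differentiable (by simp) (u, s)).hasFDerivAt (hasFDerivAt_prodMk_left u s)
    have h2 : HasDerivAt (fun u => Z s + u • (Zm - Z s)) (Zm - Z s) u := by
      simpa using ((hasDerivAt_id u).smul_const (Zm - Z s)).const_add (Z s)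
    simpa using congrArg (fun L : ℝ →L[ℝ] E => L 1) (h1.unique h2.hasFDerivAt)
  have h0 : pathOrderedExp (E := E) (H := H) Z = k 0 1 :=
    pathOrderedExp_eq (hk' 0).1 fun s _ => by
      simpa [b] using ((hk' 0).2 s).mono (subset_univ (Icc 0 1))
  have h1 : lieExp (E := E) (H := H) Zm = k 1 1 :=
    pathOrderedExp_eq (hk' 1).1 fun s _ => by
      simpa [b] using ((hk' 1).2 s).mono (subset_univ (Icc 0 1))
  have hlog : ∀ u, logD E (fun z : ℝ × ℝ => k z.1 z.2) (u, 1) (1, 0) = 0 := by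
    intro u
    rw [logD_variation hk (fun u s => (hk' u).2 s) (fun u => (hk' u).1) (c := fun _ => 0)
      (c' := fun _ => 0) (κ := fun s => Zm - Z s) (fun s _ => hasDerivWithinAt_const _ _ _) rfl rfl
      (by fun_prop) (fun s hs η => by rw [map_sub, sub_apply, hZmc, hZc s hs, sub_zero])
      (fun s _ => by simp [hb'])]
    rw [intervalIntegral.integral_sub (by simp) (hZ.continuous.intervalIntegrable _ _)]
    simp [hZm]
  have h2 : ∀ u ∈ (univ : Set ℝ), HasD (fun u => k u 1) univ u (0 : ℝ →L[ℝ] E) := by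
    intro u _
    have h3 := HasLogD.comp (g := fun u : ℝ => (u, (1 : ℝ))) (x := u) (s := univ)
      (hasLogD_logD (hk.mdifferentiable (by simp) (u, 1)))
      (hasFDerivAt_prodMk_left u (1 : ℝ)).hasFDerivWithinAt (mapsTo_univ _ _)
    have h4 : logD E (fun z : ℝ × ℝ => k z.1 z.2) (u, 1) ∘L ContinuousLinearMap.inl ℝ ℝ ℝ = 0 := by
      ext
      simpa using hlog u
    rw [h4] at h3
    simpa using h3.hasD
  rw [h0, h1]
  exact eq_of_hasD_zero ordConnected_univ h2 (mem_univ 0) (mem_univ 1)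

end Variation

/-! ### Smooth maps near a cube and their horizontal lifts -/

section Extension

/-- A smooth map of the line to a neighbourhood of `[0, 1]` that is the identity on `[0, 1]`. -/
theorem exists_smooth_map_near_Icc {ε : ℝ} (hε : 0 < ε) : ∃ r : ℝ → ℝ, ContDiff ℝ ∞ r ∧
    (∀ x ∈ Icc (0 : ℝ) 1, r x = x) ∧ ∀ x, ∃ y ∈ Icc (0 : ℝ) 1, dist (r x) y < ε := by
  -- The function ρ is 1 on [0, 1] and vanishes farther than 1/2 + ε/2 from the midpoint, so 1/2 +
  -- ρ(x)(x - 1/2) is never more than ε/2 away from [0, 1].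
  let ρ : ContDiffBump (1 / 2 : ℝ) := ⟨1 / 2, 1 / 2 + ε / 2, by norm_num, by linarith⟩
  refine ⟨fun x => 1 / 2 + ρ x * (x - 1 / 2),
    contDiff_const.add (ρ.contDiff.mul (contDiff_id.sub contDiff_const)), fun x hx => ?_,
    fun x => ?_⟩
  · change 1 / 2 + ρ x * (x - 1 / 2) = x
    rw [ρ.one_of_mem_closedBall]
    · ring
    · change |x - 1 / 2| ≤ 1 / 2
      rw [abs_le]
      constructor <;> linarith [hx.1, hx.2]
  · have h1 : |ρ x * (x - 1 / 2)| ≤ 1 / 2 + ε / 2 := by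
      by_cases hx : ρ.rOut ≤ dist x (1 / 2)
      · rw [ρ.zero_of_le_dist hx, zero_mul, abs_zero]
        positivity
      · rw [abs_mul, abs_of_nonneg ρ.nonneg]
        have h2 : |x - 1 / 2| ≤ 1 / 2 + ε / 2 := (not_le.1 hx).le
        calc ρ x * |x - 1 / 2| ≤ 1 * |x - 1 / 2| :=
              mul_le_mul_of_nonneg_right ρ.le_one (abs_nonneg _)
          _ ≤ _ := by rwa [one_mul]
    rw [abs_le] at h1
    refine ⟨max 0 (min 1 (1 / 2 + ρ x * (x - 1 / 2))), ⟨le_max_left _ _, ?_⟩, ?_⟩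
    · exact max_le zero_le_one (min_le_left _ _)
    · rw [Real.dist_eq, abs_lt]
      rcases max_cases 0 (min 1 (1 / 2 + ρ x * (x - 1 / 2))) with h2 | h2 <;>
        rcases min_cases 1 (1 / 2 + ρ x * (x - 1 / 2)) with h3 | h3 <;>
        constructor <;> linarith [h1.1, h1.2]

variable {EM M : Type*} [NormedAddCommGroup EM] [NormedSpace ℝ EM]
  [TopologicalSpace M] [ChartedSpace EM M]

/-- Values in a manifold cannot be cut off, so the arguments are modified instead: r maps ℝ into the
ε-neighbourhood of [0, 1], and compactness of the cube provides ε. The result is defined on all of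
ℝ³, so the global existence theorems for lifts apply. -/
theorem SmoothNear.exists_extension {h : ℝ → ℝ → ℝ → M}
    (hs : SmoothNear EM (fun z : ℝ × ℝ × ℝ => h z.1 z.2.1 z.2.2)
      (Icc 0 1 ×ˢ Icc 0 1 ×ˢ Icc 0 1)) :
    ∃ r : ℝ → ℝ, ContDiff ℝ ∞ r ∧ (∀ x ∈ Icc (0 : ℝ) 1, r x = x) ∧
      ContMDiff 𝓘(ℝ, ℝ × ℝ × ℝ) 𝓘(ℝ, EM) ∞
        fun z : ℝ × ℝ × ℝ => h (r z.1) (r z.2.1) (r z.2.2) := by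
  obtain ⟨U, hU, hCU, hh⟩ := hs
  have hC : IsCompact (Icc (0 : ℝ) 1 ×ˢ Icc (0 : ℝ) 1 ×ˢ Icc (0 : ℝ) 1) :=
    isCompact_Icc.prod (isCompact_Icc.prod isCompact_Icc)
  obtain ⟨ε, hε, hεU⟩ := hC.exists_thickening_subset_open hU hCU
  obtain ⟨r, hr, hr1, hr2⟩ := exists_smooth_map_near_Icc hε
  refine ⟨r, hr, hr1, ?_⟩
  have h1 : ContMDiff 𝓘(ℝ, ℝ × ℝ × ℝ) 𝓘(ℝ, ℝ × ℝ × ℝ) ∞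
      fun z : ℝ × ℝ × ℝ => (r z.1, r z.2.1, r z.2.2) := ContDiff.contMDiff (by fun_prop)
  refine hh.comp_contMDiff h1 fun z => hεU (Metric.mem_thickening_iff.2 ?_)
  obtain ⟨y₁, hy₁, hd₁⟩ := hr2 z.1
  obtain ⟨y₂, hy₂, hd₂⟩ := hr2 z.2.1
  obtain ⟨y₃, hy₃, hd₃⟩ := hr2 z.2.2
  exact ⟨(y₁, y₂, y₃), ⟨hy₁, hy₂, hy₃⟩, max_lt hd₁ (max_lt hd₂ hd₃)⟩

end Extension

/-! ### The horizontal lift of a homotopy and integration along it -/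

section CubeLift

variable {EG EH G H : Type*}
    [NormedAddCommGroup EG] [NormedSpace ℝ EG] [NormedAddCommGroup EH] [NormedSpace ℝ EH]
    [TopologicalSpace G] [ChartedSpace EG G] [Group G] [LieGroup 𝓘(ℝ, EG) ∞ G] [T2Space G]
    [TopologicalSpace H] [ChartedSpace EH H] [Group H] [LieGroup 𝓘(ℝ, EH) ∞ H]
    {X : LieCrossedModule EG EH G H}
    {EM EP EP₁ M P P₁ : Type*}
    [NormedAddCommGroup EM] [NormedSpace ℝ EM] [NormedAddCommGroup EP] [NormedSpace ℝ EP]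
    [NormedAddCommGroup EP₁] [NormedSpace ℝ EP₁]
    [TopologicalSpace M] [ChartedSpace EM M] [TopologicalSpace P] [ChartedSpace EP P]
    [TopologicalSpace P₁] [ChartedSpace EP₁ P₁] [IsManifold 𝓘(ℝ, EP) ∞ P]
    [IsManifold 𝓘(ℝ, EM) ∞ M]
    [FiniteDimensional ℝ EG] [FiniteDimensional ℝ EH] [FiniteDimensional ℝ EP]
    [FiniteDimensional ℝ EM]
    {Q : Principal2Bundle X EM EP EP₁ M P P₁}

namespace TwoConnection

variable (AB : TwoConnection Q)

variable {AB} in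
theorem HorAt.congr_base {γ γ' : ℝ → M} {c : ℝ → P} {J : Set ℝ} {t : ℝ} (h : AB.HorAt γ c J t)
    (hγ : γ t = γ' t) : AB.HorAt γ' c J t := ⟨h.1.trans hγ, h.2⟩

/-- Outside the cube the extended homotopy need not start at x, so a smooth family of initial points
over t = 0 is needed first. It is obtained by lifting the radial paths τ ↦ (τu, τs) in the face t =
0 from p. For (u, s) in the square these paths are constant in M, so the initial point is p, as
required. -/
theorem exists_cube_lift {h : ℝ → ℝ → ℝ → M}
    (hs : SmoothNear EM (fun z : ℝ × ℝ × ℝ => h z.1 z.2.1 z.2.2)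
      (Icc 0 1 ×ˢ Icc 0 1 ×ˢ Icc 0 1)) {x : M} {p : P} (hp : Q.proj p = x)
    (hx : ∀ u ∈ Icc (0 : ℝ) 1, ∀ s ∈ Icc (0 : ℝ) 1, h u s 0 = x) :
    ∃ F : (ℝ × ℝ) × ℝ → P, ContMDiff 𝓘(ℝ, (ℝ × ℝ) × ℝ) 𝓘(ℝ, EP) ∞ F ∧
      (∀ z, AB.pullA F z (0, 1) = 0) ∧
      (∀ u ∈ Icc (0 : ℝ) 1, ∀ s ∈ Icc (0 : ℝ) 1, F ((u, s), 0) = p) ∧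
      (∀ u ∈ Icc (0 : ℝ) 1, ∀ s ∈ Icc (0 : ℝ) 1, ∀ t ∈ Icc (0 : ℝ) 1,
        Q.proj (F ((u, s), t)) = h u s t ∧ AB.horLift (h u s) p t = F ((u, s), t)) := by
  obtain ⟨r, hr, hr1, hh⟩ := hs.exists_extension
  have hr0 : r 0 = 0 := hr1 0 ⟨le_rfl, zero_le_one⟩
  have hh₀ : ContMDiff 𝓘(ℝ, (ℝ × ℝ) × ℝ) 𝓘(ℝ, EM) ∞
      fun z : (ℝ × ℝ) × ℝ => h (r (z.2 * z.1.1)) (r (z.2 * z.1.2)) (r 0) := by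
    have h1 : ContMDiff 𝓘(ℝ, (ℝ × ℝ) × ℝ) 𝓘(ℝ, ℝ × ℝ × ℝ) ∞
        fun z : (ℝ × ℝ) × ℝ => (z.2 * z.1.1, z.2 * z.1.2, (0 : ℝ)) :=
      ContDiff.contMDiff (by fun_prop)
    exact hh.comp h1
  obtain ⟨c₀, hc₀, hc₀'⟩ := AB.exists_horizontal_lift (Λ := ℝ × ℝ)
    (h := fun l τ => h (r (τ * l.1)) (r (τ * l.2)) (r 0)) hh₀ (x₀ := fun _ => p) contMDiff_const
    (fun l => by
      simp only [zero_mul, hr0]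
      rw [hp, hx 0 ⟨le_rfl, zero_le_one⟩ 0 ⟨le_rfl, zero_le_one⟩])
  have hh₁ : ContMDiff 𝓘(ℝ, (ℝ × ℝ) × ℝ) 𝓘(ℝ, EM) ∞
      fun z : (ℝ × ℝ) × ℝ => h (r z.1.1) (r z.1.2) (r z.2) := by
    have h1 : ContMDiff 𝓘(ℝ, (ℝ × ℝ) × ℝ) 𝓘(ℝ, ℝ × ℝ × ℝ) ∞
        fun z : (ℝ × ℝ) × ℝ => (z.1.1, z.1.2, z.2) := ContDiff.contMDiff (by fun_prop)
    exact hh.comp h1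
  have hc₁ : ContMDiff 𝓘(ℝ, ℝ × ℝ) 𝓘(ℝ, EP) ∞ fun l : ℝ × ℝ => c₀ l 1 := by
    have h1 : ContMDiff 𝓘(ℝ, ℝ × ℝ) 𝓘(ℝ, (ℝ × ℝ) × ℝ) ∞ fun l : ℝ × ℝ => (l, (1 : ℝ)) :=
      ContDiff.contMDiff (by fun_prop)
    exact hc₀.comp h1
  obtain ⟨c, hc, hc'⟩ := AB.exists_horizontal_lift (Λ := ℝ × ℝ)
    (h := fun l t => h (r l.1) (r l.2) (r t)) hh₁ hc₁ (fun l => by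
      simpa using ((hc₀' l).2 1).1)
  have hstart : ∀ u ∈ Icc (0 : ℝ) 1, ∀ s ∈ Icc (0 : ℝ) 1, c (u, s) 0 = p := by
    intro u hu s hs
    rw [(hc' (u, s)).1]
    refine HorAt.eqOn (AB := AB) (γ := fun _ => x) (c' := fun _ => p) ordConnected_Icc
      (uniqueDiffOn_Icc zero_lt_one) (fun τ hτ => (((hc₀' (u, s)).2 τ).mono
        (subset_univ _)).congr_base ?_) (fun τ _ => ⟨hp, 0, hasD_const _ _ _, by simp⟩)
      (left_mem_Icc.2 zero_le_one) (hc₀' (u, s)).1 (right_mem_Icc.2 zero_le_one)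
    have h1 : τ * u ∈ Icc (0 : ℝ) 1 := ⟨mul_nonneg hτ.1 hu.1, mul_le_one₀ hτ.2 hu.1 hu.2⟩
    have h2 : τ * s ∈ Icc (0 : ℝ) 1 := ⟨mul_nonneg hτ.1 hs.1, mul_le_one₀ hτ.2 hs.1 hs.2⟩
    simp only [hr1 _ h1, hr1 _ h2, hr0]
    exact hx _ h1 _ h2
  refine ⟨fun z => c z.1 z.2, hc, fun z => ?_, hstart, fun u hu s hs t ht => ?_⟩
  · obtain ⟨-, L, hL, hL0⟩ := (hc' z.1).2 z.2
    have h1 := (hc.mdifferentiable (by simp) z).hasD.comp_univ (f := fun t => (z.1, t))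
      (hasD_univ_iff_hasFDerivAt.2 (hasFDerivAt_prodMk_right z.1 z.2))
    rw [hL.unique_univ h1] at hL0
    simpa [pullA] using hL0
  · have hb : ∀ t ∈ Icc (0 : ℝ) 1, h (r u) (r s) (r t) = h u s t := fun t ht => by
      rw [hr1 u hu, hr1 s hs, hr1 t ht]
    refine ⟨((hc' (u, s)).2 t).1.trans (hb t ht), ?_⟩
    have h1 : ContMDiff 𝓘(ℝ, ℝ) 𝓘(ℝ, (ℝ × ℝ) × ℝ) ∞ fun t : ℝ => ((u, s), t) :=
      ContDiff.contMDiff (by fun_prop)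
    exact AB.horLift_eqOn (c := c (u, s)) (hc.comp h1).contMDiffOn
      (fun t ht => (((hc' (u, s)).2 t).mono (subset_univ _)).congr_base (hb t ht))
      (hstart u hu s hs) ht

/-! ### Integration of the 2-connection along horizontal curves -/

section LiftIntegral

variable {Λ : Type} [NormedAddCommGroup Λ] [NormedSpace ℝ Λ] [FiniteDimensional ℝ Λ]

/-- The integral of `-(F^*B)(e, ∂_t)` over the line from `(z.1, 0)` to `z`. -/
noncomputable def lineB (F : Λ × ℝ → P) (e : Λ) (z : Λ × ℝ) : EH :=
  -∫ r in (0 : ℝ)..z.2, AB.pullB F (z.1, r) (e, 0) (0, 1)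

variable {F : Λ × ℝ → P} (hF : ContMDiff 𝓘(ℝ, Λ × ℝ) 𝓘(ℝ, EP) ∞ F)
include hF

theorem contDiff_pullA (v : Λ × ℝ) : ContDiff ℝ ∞ fun z => AB.pullA F z v :=
  contDiff_iff_contDiffAt.2 fun z => AB.contDiffAt_pullA (hF z) v

theorem contDiff_pullB (v w : Λ × ℝ) : ContDiff ℝ ∞ fun z => AB.pullB F z v w :=
  contDiff_iff_contDiffAt.2 fun z => AB.contDiffAt_pullB (hF z) v w

theorem contDiff_lineB (e : Λ) : ContDiff ℝ ∞ (AB.lineB F e) :=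
  (contDiff_parametric_primitive (β := fun l t => AB.pullB F (l, t) (e, 0) (0, 1))
    (AB.contDiff_pullB hF _ _)).neg

theorem hasDerivAt_lineB (e : Λ) (l : Λ) (t : ℝ) :
    HasDerivAt (fun t => AB.lineB F e (l, t)) (-AB.pullB F (l, t) (e, 0) (0, 1)) t := by
  have : CompleteSpace EH := FiniteDimensional.complete ℝ EH
  have h1 : Continuous fun t => AB.pullB F (l, t) (e, 0) (0, 1) :=
    (AB.contDiff_pullB hF (e, 0) (0, 1)).continuous.comp (by fun_prop)
  exact (h1.integral_hasStrictDerivAt 0 t).hasDerivAt.neg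

theorem fderiv_lineB (e : Λ) (z : Λ × ℝ) :
    fderiv ℝ (AB.lineB F e) z (0, 1) = -AB.pullB F z (e, 0) (0, 1) := by
  have h1 := (((AB.contDiff_lineB hF e).differentiable (by simp) (z.1, z.2)).hasFDerivAt).comp_hasDerivAt
    z.2 ((hasDerivAt_const z.2 z.1).prodMk (hasDerivAt_id z.2))
  exact h1.unique (AB.hasDerivAt_lineB hF e z.1 z.2)

/-- Along a horizontal curve, the form `A` is determined by `B`, by vanishing fake curvature. -/
theorem pullA_eq_tStar_lineB (hFt : ∀ z, AB.pullA F z (0, 1) = 0) {l e : Λ}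
    (h0 : AB.pullA F (l, 0) (e, 0) = 0) (t : ℝ) :
    AB.pullA F (l, t) (e, 0) = X.tStar (AB.lineB F e (l, t)) := by
  have h1 : ∀ t ∈ (univ : Set ℝ), HasD (fun t => AB.pullA F (l, t) (e, 0) -
      X.tStar (AB.lineB F e (l, t))) univ t (0 : ℝ →L[ℝ] EG) := by
    intro t _
    rw [hasD_univ_iff_hasFDerivAt]
    have h2 := (((AB.contDiff_pullA hF (e, 0)).differentiable (by simp)
      (l, t)).hasFDerivAt).comp_hasDerivAt t ((hasDerivAt_const t l).prodMk (hasDerivAt_id t))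
    have h3 := X.tStar.hasFDerivAt.comp_hasDerivAt t (AB.hasDerivAt_lineB hF e l t)
    have h4 := h2.sub h3
    -- Since A(∂t) vanishes identically, its derivative along e and the bracket drop out, leaving
    -- t_*B(e, ∂t) = -∂t A(e).
    have h5 := AB.tStar_pullB (hF (l, t)) (e, 0) (0, 1)
    simp only [hFt, map_zero, add_zero] at h5
    rw [map_neg, h5] at h4
    exact h4.hasFDerivAt.congr_fderiv (by ext; simp)
  have h2 := eq_of_hasD_zero ordConnected_univ h1 (mem_univ t) (mem_univ 0)
  simp only [h0, lineB, intervalIntegral.integral_same, neg_zero, map_zero, sub_zero] at h2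
  exact sub_eq_zero.1 h2

/-- The integral of the 2-curvature over a horizontal curve. -/
theorem integral_curvature3_line (hFt : ∀ z, AB.pullA F z (0, 1) = 0) {l e e' : Λ}
    (h0 : AB.pullA F (l, 0) (e, 0) = 0) (h0' : AB.pullA F (l, 0) (e', 0) = 0) :
    ∫ r in (0 : ℝ)..1, -AB.curvature3 (F (l, r))
        (fun i => mD (Λ × ℝ) EP F (l, r) ((![(e, 0), (e', 0), (0, 1)] : Fin 3 → Λ × ℝ) i)) =
      fderiv ℝ (AB.lineB F e') (l, 1) (e, 0) - fderiv ℝ (AB.lineB F e) (l, 1) (e', 0) +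
        lieBrL EH H (AB.lineB F e (l, 1)) (AB.lineB F e' (l, 1)) -
        AB.pullB F (l, 1) (e, 0) (e', 0) + AB.pullB F (l, 0) (e, 0) (e', 0) := by
  have : CompleteSpace EH := FiniteDimensional.complete ℝ EH
  have hline : ∀ t : ℝ, HasDerivAt (fun t => (l, t)) ((0, 1) : Λ × ℝ) t := fun t =>
    (hasDerivAt_const t l).prodMk (hasDerivAt_id t)
  -- Symmetry of second derivatives moves ∂t inside, where it turns `lineB` into -B(e, ∂t).
  have hmix : ∀ (e e' : Λ) (t : ℝ), HasDerivAt (fun t => fderiv ℝ (AB.lineB F e) (l, t) (e', 0))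
      (-fderiv ℝ (fun z => AB.pullB F z (e, 0) (0, 1)) (l, t) (e', 0)) t := by
    intro e e' t
    have hc := AB.contDiff_lineB hF e
    have hd : Differentiable ℝ (fderiv ℝ (AB.lineB F e)) :=
      (hc.fderiv_right (m := ∞) (by simp)).differentiable (by simp)
    have h1 := ((hd (l, t)).hasFDerivAt.comp_hasDerivAt t (hline t)).clm_apply
      (hasDerivAt_const t ((e', 0) : Λ × ℝ))
    refine h1.congr_deriv ?_
    have h2 := ((hc.contDiffAt (x := (l, t))).isSymmSndFDerivAt
      (by simpa using ENat.LEInfty.out)).eq (0, 1) (e', 0)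
    have h3 : HasFDerivAt (fun z => fderiv ℝ (AB.lineB F e) z (0, 1)) _ (l, t) :=
      (hd (l, t)).hasFDerivAt.clm_apply (hasFDerivAt_const ((0, 1) : Λ × ℝ) (l, t))
    simp only [AB.fderiv_lineB hF] at h3
    have h4 := congrArg (fun L : Λ × ℝ →L[ℝ] EH => L (e', 0)) h3.fderiv
    rw [fderiv_fun_neg] at h4
    simp only [map_zero, add_zero]
    rw [h2]
    simpa using h4.symm
  -- The bracket accounts for the terms α_*(A, B): A(e) and A(e') are t_* of `lineB`, so α_* becomes
  -- the bracket of 𝔥, while α_*(A(∂t), ·) vanishes.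
  have hd : ∀ t, HasDerivAt (fun t => fderiv ℝ (AB.lineB F e') (l, t) (e, 0) -
      fderiv ℝ (AB.lineB F e) (l, t) (e', 0) +
        lieBrL EH H (AB.lineB F e (l, t)) (AB.lineB F e' (l, t)) -
        AB.pullB F (l, t) (e, 0) (e', 0)) (-AB.curvature3 (F (l, t))
        (fun i => mD (Λ × ℝ) EP F (l, t) ((![(e, 0), (e', 0), (0, 1)] : Fin 3 → Λ × ℝ) i))) t := by
    intro t
    have h1 := (AB.contDiff_pullB hF (e, 0) (e', 0)).differentiable (by simp) (l, t)
      |>.hasFDerivAt.comp_hasDerivAt t (hline t)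
    have h2 := ((lieBrL EH H).hasFDerivAt.comp_hasDerivAt t
      (AB.hasDerivAt_lineB hF e l t)).clm_apply (AB.hasDerivAt_lineB hF e' l t)
    refine ((((hmix e' e t).sub (hmix e e' t)).add h2).sub h1).congr_deriv ?_
    rw [AB.curvature3_pull (hF (l, t))]
    simp only [Matrix.cons_val_zero, Matrix.cons_val_one, Matrix.cons_val]
    rw [hFt, AB.pullA_eq_tStar_lineB hF hFt h0, AB.pullA_eq_tStar_lineB hF hFt h0',
      X.αStarL_tStar, X.αStarL_tStar, lieBr_swap (AB.lineB F e' (l, t)), lieBr_eq_lieBrL,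
      lieBr_eq_lieBrL]
    simp only [map_zero, zero_apply, map_neg, neg_apply, Function.comp_apply]
    abel
  have hK : Continuous fun r : ℝ => -AB.curvature3 (F (l, r))
        (fun i => mD (Λ × ℝ) EP F (l, r) ((![(e, 0), (e', 0), (0, 1)] : Fin 3 → Λ × ℝ) i)) := by
    have h1 : ContDiff ℝ ∞ fun z => AB.curvature3 (F z)
        (fun i => mD (Λ × ℝ) EP F z ((![(e, 0), (e', 0), (0, 1)] : Fin 3 → Λ × ℝ) i)) :=
      contDiff_iff_contDiffAt.2 fun z =>
        AB.contDiffAt_curvature3_pull (Eventually.of_forall hF) _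
    exact (h1.continuous.comp (by fun_prop : Continuous fun r : ℝ => (l, r))).neg
  rw [intervalIntegral.integral_eq_sub_of_hasDerivAt (fun t _ => hd t)
    (hK.intervalIntegrable _ _)]
  -- `lineB` vanishes for all parameters at t = 0, so the lower end contributes only a value of B.
  have hz : ∀ e e' : Λ, fderiv ℝ (AB.lineB F e) (l, 0) (e', 0) = 0 := by
    intro e e'
    have h1 := HasFDerivAt.comp (g := AB.lineB F e) (f := fun l : Λ => (l, (0 : ℝ))) l
      ((AB.contDiff_lineB hF e).differentiable (by simp) (l, 0)).hasFDerivAt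
      (hasFDerivAt_prodMk_left l (0 : ℝ))
    have h2 : (AB.lineB F e ∘ fun l : Λ => (l, (0 : ℝ))) = fun _ => 0 :=
      funext fun l => by simp [lineB]
    rw [h2] at h1
    simpa using congrArg (fun L : Λ →L[ℝ] EH => L e') (h1.unique (hasFDerivAt_const 0 l))
  have hz' : AB.lineB F e (l, 0) = 0 := by simp [lineB]
  rw [hz, hz, hz', map_zero, zero_apply]
  abel

end LiftIntegral

/-! ### Vertical vectors -/

theorem BL_eq_zero_left (q : P) {v : EP} (w : EP) (hv : mD EP EM Q.proj q v = 0) :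
    AB.BL q ![v, w] = 0 := by
  obtain ⟨ξ, rfl⟩ := Q.exists_fundL_of_dproj_eq_zero q v hv
  exact AB.B_horizontal q ξ w

end TwoConnection

end CubeLift

/-! ### Maps that are constant along a curve -/

section Lines

variable {V : Type*} [NormedAddCommGroup V] [NormedSpace ℝ V]
  {E : Type*} [NormedAddCommGroup E] [NormedSpace ℝ E]
  {N : Type*} [TopologicalSpace N] [ChartedSpace E N]

theorem mD_eq_zero_of_const_on_curve {f : V → N} {a : ℝ → V} {t : ℝ} {e : V} {c : N}
    (hf : MDifferentiableAt 𝓘(ℝ, V) 𝓘(ℝ, E) f (a t)) (ha : HasDerivAt a e t)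
    (ht : t ∈ Icc (0 : ℝ) 1) (hc : ∀ s ∈ Icc (0 : ℝ) 1, f (a s) = c) :
    mD V E f (a t) e = 0 := by
  have h1 := (hf.hasD.comp_univ (f := a) (hasD_univ_iff_hasFDerivAt.2 ha.hasFDerivAt)).mono
    (subset_univ (Icc 0 1))
  have h2 : HasD (fun s => f (a s)) (Icc 0 1) t (0 : ℝ →L[ℝ] E) :=
    (hasD_const c _ _).congr (eventually_of_mem self_mem_nhdsWithin hc) (hc t ht)
  have h3 := h1.unique h2 (uniqueDiffOn_Icc zero_lt_one t ht)
  simpa using congrArg (fun L : ℝ →L[ℝ] E => L 1) h3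

end Lines

/-! ### The higher non-Abelian Stokes theorem -/

section Integrals

theorem clm_integral_eq_zero {E F : Type*} [NormedAddCommGroup E] [NormedSpace ℝ E]
    [NormedAddCommGroup F] [NormedSpace ℝ F] [FiniteDimensional ℝ E] [FiniteDimensional ℝ F]
    (L : E →L[ℝ] F) {f : ℝ → E} (hf : Continuous f) (h : ∀ t ∈ Icc (0 : ℝ) 1, L (f t) = 0) :
    L (∫ t in (0 : ℝ)..1, f t) = 0 := by
  have : CompleteSpace E := FiniteDimensional.complete ℝ E
  have : CompleteSpace F := FiniteDimensional.complete ℝ F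
  rw [← L.intervalIntegral_comp_comm (hf.intervalIntegrable 0 1),
    intervalIntegral.integral_congr (g := fun _ => 0)]
  · simp
  · intro t ht
    rw [uIcc_of_le zero_le_one] at ht
    exact h t ht

variable {E N V : Type*} [NormedAddCommGroup E] [NormedSpace ℝ E]
    [TopologicalSpace N] [ChartedSpace E N] [NormedAddCommGroup V] [NormedSpace ℝ V]

/-- Agreement on [0, 1] suffices because `velocity` is taken within [0, 1]; this matters for
`horLift`, which is controlled only there. -/
theorem velocity_eq_mD {W : Type*} [NormedAddCommGroup W] [NormedSpace ℝ W] {F : W → N}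
    {a : ℝ → W} {c : ℝ → N} {t : ℝ} {e : W} (hF : MDifferentiableAt 𝓘(ℝ, W) 𝓘(ℝ, E) F (a t))
    (ha : HasDerivAt a e t) (ht : t ∈ Icc (0 : ℝ) 1) (hc : ∀ t ∈ Icc (0 : ℝ) 1, c t = F (a t)) :
    velocity (E := E) c t = mD W E F (a t) e := by
  have h1 := (hF.hasD.comp_univ (f := a) (hasD_univ_iff_hasFDerivAt.2 ha.hasFDerivAt)).mono
    (subset_univ (Icc 0 1))
  have h2 := h1.congr (g := c) (eventually_of_mem self_mem_nhdsWithin hc) (hc t ht)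
  rw [velocity_eq ht h2]
  change (mD W E F (a t) (ContinuousLinearMap.toSpanSingleton ℝ e 1) : E) = mD W E F (a t) e
  rw [ContinuousLinearMap.toSpanSingleton_apply, one_smul]

variable {F : (ℝ × ℝ) × ℝ → N} (hF : MDifferentiable 𝓘(ℝ, (ℝ × ℝ) × ℝ) 𝓘(ℝ, E) F)
  {f : ℝ → ℝ → ℝ → N}
  (hf : ∀ u ∈ Icc (0 : ℝ) 1, ∀ s ∈ Icc (0 : ℝ) 1, ∀ t ∈ Icc (0 : ℝ) 1, f u s t = F ((u, s), t))
  {u s t : ℝ} (hu : u ∈ Icc (0 : ℝ) 1) (hs : s ∈ Icc (0 : ℝ) 1) (ht : t ∈ Icc (0 : ℝ) 1)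
include hF hf hu hs ht

theorem velocity_cube_fst :
    velocity (E := E) (fun u' => f u' s t) u = mD ((ℝ × ℝ) × ℝ) E F ((u, s), t) ((1, 0), 0) :=
  velocity_eq_mD (a := fun u => ((u, s), t)) (hF _)
    (((hasDerivAt_id u).prodMk (hasDerivAt_const u s)).prodMk (hasDerivAt_const u t)) hu
    fun u hu => hf u hu s hs t ht

theorem velocity_cube_snd :
    velocity (E := E) (fun s' => f u s' t) s = mD ((ℝ × ℝ) × ℝ) E F ((u, s), t) ((0, 1), 0) :=
  velocity_eq_mD (a := fun s => ((u, s), t)) (hF _)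
    (((hasDerivAt_const s u).prodMk (hasDerivAt_id s)).prodMk (hasDerivAt_const s t)) hs
    fun s hs => hf u hu s hs t ht

theorem velocity_cube_thd :
    velocity (E := E) (fun t' => f u s t') t = mD ((ℝ × ℝ) × ℝ) E F ((u, s), t) (0, 1) :=
  velocity_eq_mD (a := fun t => ((u, s), t)) (hF _)
    ((hasDerivAt_const t (u, s)).prodMk (hasDerivAt_id t)) ht fun t ht => hf u hu s hs t ht

omit hu hs ht in
theorem cubeIntegral_eq (θ : (p : N) → (Fin 3 → TangentSpace 𝓘(ℝ, E) p) → V) :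
    cubeIntegral θ f = ∫ u in (0 : ℝ)..1, ∫ s in (0 : ℝ)..1, ∫ t in (0 : ℝ)..1,
      θ (F ((u, s), t)) (fun i => mD ((ℝ × ℝ) × ℝ) E F ((u, s), t)
        ((![((1, 0), 0), ((0, 1), 0), (0, 1)] : Fin 3 → (ℝ × ℝ) × ℝ) i)) := by
  refine intervalIntegral.integral_congr fun u hu => intervalIntegral.integral_congr fun s hs =>
    intervalIntegral.integral_congr fun t ht => ?_
  rw [uIcc_of_le zero_le_one] at hu hs ht
  have h1 : ∀ q, q = F ((u, s), t) → ∀ v : Fin 3 → E, θ q v = θ (F ((u, s), t)) v := by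
    rintro _ rfl _
    rfl
  refine Eq.trans ?_ (h1 _ (hf u hu s hs t ht) _)
  refine congrArg (θ (f u s t)) (funext fun i => ?_)
  fin_cases i
  · exact velocity_cube_fst hF hf hu hs ht
  · exact velocity_cube_snd hF hf hu hs ht
  · exact velocity_cube_thd hF hf hu hs ht

end Integrals

/-! ### Variation of the 2-transport and the Stokes formula -/

section Stokes

variable {EG EH G H : Type*}
    [NormedAddCommGroup EG] [NormedSpace ℝ EG] [NormedAddCommGroup EH] [NormedSpace ℝ EH]
    [TopologicalSpace G] [ChartedSpace EG G] [Group G] [LieGroup 𝓘(ℝ, EG) ∞ G] [T2Space G]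
    [TopologicalSpace H] [ChartedSpace EH H] [Group H] [LieGroup 𝓘(ℝ, EH) ∞ H] [T2Space H]
    {X : LieCrossedModule EG EH G H}
    {EM EP EP₁ M P P₁ : Type*}
    [NormedAddCommGroup EM] [NormedSpace ℝ EM] [NormedAddCommGroup EP] [NormedSpace ℝ EP]
    [NormedAddCommGroup EP₁] [NormedSpace ℝ EP₁]
    [TopologicalSpace M] [ChartedSpace EM M] [TopologicalSpace P] [ChartedSpace EP P]
    [TopologicalSpace P₁] [ChartedSpace EP₁ P₁] [IsManifold 𝓘(ℝ, EP) ∞ P]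
    [IsManifold 𝓘(ℝ, EM) ∞ M]
    [FiniteDimensional ℝ EG] [FiniteDimensional ℝ EH] [FiniteDimensional ℝ EP]
    [FiniteDimensional ℝ EM]
    {Q : Principal2Bundle X EM EP EP₁ M P P₁}

theorem Principal2Bundle.div₁_act₁_inl (Q : Principal2Bundle X EM EP EP₁ M P P₁) (a : P₁)
    (k k' : H) : Q.div₁ (Q.act₁ a (SemidirectProduct.inl k')) (Q.act₁ a (SemidirectProduct.inl k)) =
      SemidirectProduct.inl (k⁻¹ * k') := by
  rw [← mul_inv_cancel_left k k', map_mul, Q.act₁_mul, Q.div₁_act₁, mul_inv_cancel_left]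

namespace TwoConnection

variable (AB : TwoConnection Q)

/-- If the logarithmic derivative of the end point `k u 1` is central, then the end points of
`k 0` and `k 1` differ by the exponential of its integral. -/
theorem inv_mul_eq_lieExp {k : ℝ → ℝ → H}
    (hk : ContMDiff 𝓘(ℝ, ℝ × ℝ) 𝓘(ℝ, EH) ∞ (fun z : ℝ × ℝ => k z.1 z.2)) {z : ℝ → EH}
    (hz : ∀ u ∈ Icc (0 : ℝ) 1, logD EH (fun z : ℝ × ℝ => k z.1 z.2) (u, 1) (1, 0) = z u)
    (hzc : ∀ u ∈ Icc (0 : ℝ) 1, ∀ η, lieBrL EH H (z u) η = 0) :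
    (k 0 1)⁻¹ * k 1 1 = lieExp (E := EH) (H := H) (∫ u in (0 : ℝ)..1, z u : EH) := by
  -- The curve z is controlled only on [0, 1]; Z is globally smooth with the same values there, as
  -- the statement on central path ordered exponentials requires.
  let Z : ℝ → EH := fun u => logD EH (fun z : ℝ × ℝ => k z.1 z.2) (u, 1) (1, 0)
  have hZ : ContDiff ℝ ∞ Z := by
    have h1 : ContDiff ℝ ∞ (logD EH fun z : ℝ × ℝ => k z.1 z.2) :=
      contDiff_iff_contDiffAt.2 fun z => contDiffAt_logD (hk z)
    exact (h1.comp (by fun_prop : ContDiff ℝ ∞ fun u : ℝ => (u, (1 : ℝ)))).clm_apply contDiff_const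
  have h1 : (∫ u in (0 : ℝ)..1, z u) = ∫ u in (0 : ℝ)..1, Z u :=
    intervalIntegral.integral_congr fun u hu => by
      rw [uIcc_of_le zero_le_one] at hu
      exact (hz u hu).symm
  rw [h1, ← pathOrderedExp_of_central hZ fun u hu => by simpa only [Z, hz u hu] using hzc u hu]
  refine (pathOrderedExp_eq (k := fun u => (k 0 1)⁻¹ * k u 1) (inv_mul_cancel _)
    fun u _ => HasLogD.const_mul ?_ _).symm
  have h3 := HasLogD.comp (g := fun u : ℝ => (u, (1 : ℝ))) (x := u) (s := Icc 0 1)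
    (hasLogD_logD (hk.mdifferentiable (by simp) (u, 1)))
    (hasFDerivAt_prodMk_left u (1 : ℝ)).hasFDerivWithinAt (mapsTo_univ _ _)
  convert h3 using 1
  ext
  simp [Z]

section Cube

variable {F : (ℝ × ℝ) × ℝ → P} (hF : ContMDiff 𝓘(ℝ, (ℝ × ℝ) × ℝ) 𝓘(ℝ, EP) ∞ F)
  (hFt : ∀ z, AB.pullA F z (0, 1) = 0)

/-- The coefficient of the pullback of the 2-curvature under `F`. -/
noncomputable def cubeK (F : (ℝ × ℝ) × ℝ → P) (z : (ℝ × ℝ) × ℝ) : EH :=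
  AB.curvature3 (F z) (fun i => mD ((ℝ × ℝ) × ℝ) EP F z
    ((![((1, 0), 0), ((0, 1), 0), (0, 1)] : Fin 3 → (ℝ × ℝ) × ℝ) i))

/-- The integral of the 2-curvature of `F` over the line with parameters `(u, s)`. -/
noncomputable def lineK (F : (ℝ × ℝ) × ℝ → P) (l : ℝ × ℝ) : EH :=
  ∫ t in (0 : ℝ)..1, -AB.cubeK F (l, t)

include hF

theorem contDiff_cubeK : ContDiff ℝ ∞ (AB.cubeK F) :=
  contDiff_iff_contDiffAt.2 fun _ =>
    AB.contDiffAt_curvature3_pull (Eventually.of_forall hF) _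

theorem contDiff_lineK : ContDiff ℝ ∞ (AB.lineK F) := by
  have h1 := contDiff_parametric_primitive (Λ := ℝ × ℝ) (F := EH)
    (β := fun l t => -AB.cubeK F (l, t)) (AB.contDiff_cubeK hF).neg
  have h2 : ContDiff ℝ ∞ fun l : ℝ × ℝ => (l, (1 : ℝ)) := by fun_prop
  have h3 := ContDiff.comp (g := fun z : (ℝ × ℝ) × ℝ => ∫ t in (0 : ℝ)..z.2, -AB.cubeK F (z.1, t))
    h1 h2
  have h4 : AB.lineK F = fun l => ∫ t in (0 : ℝ)..1, -AB.cubeK F (l, t) := funext fun _ => rfl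
  rw [h4]
  simpa only [Function.comp_def] using h3

theorem tStar_lineK (l : ℝ × ℝ) : X.tStar (AB.lineK F l) = 0 := by
  refine clm_integral_eq_zero X.tStar (f := fun t => -AB.cubeK F (l, t)) ?_ fun t _ => ?_
  · exact ((AB.contDiff_cubeK hF).continuous.comp
      (by fun_prop : Continuous fun t : ℝ => (l, t))).neg
  · rw [map_neg, cubeK, AB.tStar_curvature3, neg_zero]

include hFt in
/-- The variation of the 2-transport of the bigons in a cube with fixed boundary. -/
theorem logD_transport_cube {p : P} {γ₀ γ₁ : ℝ → M} {y : M}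
    (h0 : ∀ u ∈ Icc (0 : ℝ) 1, ∀ s ∈ Icc (0 : ℝ) 1, F ((u, s), 0) = p)
    (h1 : ∀ u ∈ Icc (0 : ℝ) 1, ∀ s ∈ Icc (0 : ℝ) 1, Q.proj (F ((u, s), 1)) = y)
    (hs0 : ∀ u ∈ Icc (0 : ℝ) 1, ∀ t ∈ Icc (0 : ℝ) 1, Q.proj (F ((u, 0), t)) = γ₀ t)
    (hs1 : ∀ u ∈ Icc (0 : ℝ) 1, ∀ t ∈ Icc (0 : ℝ) 1, Q.proj (F ((u, 1), t)) = γ₁ t)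
    {k : ℝ → ℝ → H} (hk : ContMDiff 𝓘(ℝ, ℝ × ℝ) 𝓘(ℝ, EH) ∞ (fun z : ℝ × ℝ => k z.1 z.2))
    (hk0 : ∀ u, k u 0 = 1) (hkb : ∀ u s, HasLogD (k u) univ s
      ((ContinuousLinearMap.id ℝ ℝ).smulRight (AB.lineB F (0, 1) ((u, s), 1))))
    {u : ℝ} (hu : u ∈ Icc (0 : ℝ) 1) :
    logD EH (fun z : ℝ × ℝ => k z.1 z.2) (u, 1) (1, 0) = ∫ s in (0 : ℝ)..1, AB.lineK F (u, s) := by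
  have hFd : MDifferentiable 𝓘(ℝ, (ℝ × ℝ) × ℝ) 𝓘(ℝ, EP) F := hF.mdifferentiable (by simp)
  have hpd : MDifferentiable 𝓘(ℝ, (ℝ × ℝ) × ℝ) 𝓘(ℝ, EM) fun z => Q.proj (F z) :=
    (Q.contMDiff_proj.comp hF).mdifferentiable (by simp)
  have hpD : ∀ z v, mD ((ℝ × ℝ) × ℝ) EM (fun z => Q.proj (F z)) z v = mD EP EM Q.proj (F z) (mD ((ℝ × ℝ) × ℝ) EP F z v) :=
    fun z v => by rw [((Q.hasD_proj (F z)).comp_univ (hFd z).hasD).mD_eq]; rfl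
  have hdu : ∀ s t : ℝ, HasDerivAt (fun u : ℝ => ((u, s), t)) ((1, 0), 0) u := fun s t =>
    ((hasDerivAt_id u).prodMk (hasDerivAt_const u s)).prodMk (hasDerivAt_const u t)
  have hds : ∀ s t : ℝ, HasDerivAt (fun s : ℝ => ((u, s), t)) ((0, 1), 0) s := fun s t =>
    ((hasDerivAt_const s u).prodMk (hasDerivAt_id s)).prodMk (hasDerivAt_const s t)
  have hAu : ∀ s ∈ Icc (0 : ℝ) 1, AB.pullA F ((u, s), 0) ((1, 0), 0) = 0 := fun s hs => by
    rw [pullA, ContinuousLinearMap.comp_apply, mD_eq_zero_of_const_on_curve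
      (a := fun u => ((u, s), (0 : ℝ))) (hFd _) (hdu s 0) hu fun u hu => h0 u hu s hs, map_zero]
  have hAs : ∀ s ∈ Icc (0 : ℝ) 1, AB.pullA F ((u, s), 0) ((0, 1), 0) = 0 := fun s hs => by
    rw [pullA, ContinuousLinearMap.comp_apply, mD_eq_zero_of_const_on_curve
      (a := fun s => ((u, s), (0 : ℝ))) (hFd _) (hds s 0) hs fun s hs => h0 u hu s hs, map_zero]
  -- On a face of the cube whose image in M does not depend on u, the vector ∂uF is vertical and B
  -- annihilates it. This serves for the faces s = 0, 1 and t = 0, 1.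
  have hBu : ∀ (s t : ℝ) (v : (ℝ × ℝ) × ℝ) (m : M),
      (∀ u ∈ Icc (0 : ℝ) 1, Q.proj (F ((u, s), t)) = m) →
      AB.pullB F ((u, s), t) ((1, 0), 0) v = 0 := by
    intro s t v m hm
    refine AB.BL_eq_zero_left _ _ ?_
    rw [← hpD]
    exact mD_eq_zero_of_const_on_curve (a := fun u => ((u, s), t)) (hpd _) (hdu s t) hu hm
  have hc : ∀ (s : ℝ) (γ : ℝ → M),
      (∀ u ∈ Icc (0 : ℝ) 1, ∀ t ∈ Icc (0 : ℝ) 1, Q.proj (F ((u, s), t)) = γ t) →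
      AB.lineB F (1, 0) ((u, s), 1) = 0 := by
    intro s γ hγ
    rw [lineB, intervalIntegral.integral_congr (g := fun _ => 0)]
    · simp
    · intro t ht
      rw [uIcc_of_le zero_le_one] at ht
      exact hBu s t _ (γ t) fun u hu => hγ u hu t ht
  have hdl : ∀ (e : ℝ × ℝ) (z : (ℝ × ℝ) × ℝ), HasFDerivAt (AB.lineB F e)
      (fderiv ℝ (AB.lineB F e) z) z := fun e z =>
    ((AB.contDiff_lineB hF e).differentiable (by simp) z).hasFDerivAt
  -- In the variation formula b and c are the integrals of -B(∂s, ∂t) and -B(∂u, ∂t) over the whole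
  -- line, and κ is `lineK`, central because t_* annihilates it.
  refine logD_variation hk hkb hk0 (c := fun s => AB.lineB F (1, 0) ((u, s), 1))
    (c' := fun s => fderiv ℝ (AB.lineB F (1, 0)) ((u, s), 1) ((0, 1), 0))
    (b := fun l => AB.lineB F (0, 1) (l, 1))
    (fun s _ => (HasFDerivAt.comp_hasDerivAt (f := fun s => ((u, s), (1 : ℝ))) s
      (hdl (1, 0) ((u, s), 1)) (hds s 1)).hasDerivWithinAt)
    (hc 0 γ₀ hs0) (hc 1 γ₁ hs1)
    ((AB.contDiff_lineK hF).continuous.comp (by fun_prop : Continuous fun s : ℝ => (u, s)))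
    (fun s _ η => ?_) (fun s hs => ?_)
  · rw [← lieBr_eq_lieBrL, ← X.αStarL_tStar, AB.tStar_lineK hF, map_zero, zero_apply]
  · have h2 := AB.integral_curvature3_line hF hFt (hAu s hs) (hAs s hs)
    rw [hBu s 1 _ y fun u hu => h1 u hu s hs, hBu s 0 _ (Q.proj p) fun u hu => by
      rw [h0 u hu s hs], sub_zero, add_zero] at h2
    refine h2.trans ?_
    have h3 := HasFDerivAt.comp (g := AB.lineB F (0, 1)) (f := fun l : ℝ × ℝ => (l, (1 : ℝ)))
      (u, s) (hdl (0, 1) ((u, s), 1)) (hasFDerivAt_prodMk_left (u, s) (1 : ℝ))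
    have h4 : fderiv ℝ (fun l => AB.lineB F (0, 1) (l, 1)) (u, s) (1, 0) =
        fderiv ℝ (AB.lineB F (0, 1)) ((u, s), 1) ((1, 0), 0) :=
      congrArg (fun L : ℝ × ℝ →L[ℝ] EH => L (1, 0)) h3.fderiv
    rw [h4]

end Cube

/-- One vector I serves the lifted and the base formula: the cube integrals agree because the lift F
projects to h on the cube. -/
theorem stokes {h : ℝ → ℝ → ℝ → M} {γ₀ γ₁ : ℝ → M} {x y : M} {p : P}
    (hh : IsBigonHomotopy EM h γ₀ γ₁ x y) (hp : Q.proj p = x) :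
    ∃ I : EH, Q.div₁ (AB.tra2 (h 1) p) (AB.tra2 (h 0) p) =
        SemidirectProduct.inl (lieExp (E := EH) (H := H) (-I : EH)) ∧
      cubeIntegral (V := EH) AB.curvature3 (fun u s t => AB.horLift (h u s) p t) = I ∧
      ∀ K : MForm EM M 3 EH, (∀ (q : P) (v : Fin 3 → EP),
          K (Q.proj q) (fun i => mD EP EM Q.proj q (v i)) = AB.curvature3 q v) →
        cubeIntegral (V := EH) (fun m v => K m v) h = I := by
  have i0 : (0 : ℝ) ∈ Icc (0 : ℝ) 1 := left_mem_Icc.2 zero_le_one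
  have i1 : (1 : ℝ) ∈ Icc (0 : ℝ) 1 := right_mem_Icc.2 zero_le_one
  obtain ⟨F, hF, hFt, hF0, hFh⟩ := AB.exists_cube_lift hh.smooth hp fun u hu s hs =>
    (hh.bigon u hu).start s hs
  have hFd : MDifferentiable 𝓘(ℝ, (ℝ × ℝ) × ℝ) 𝓘(ℝ, EP) F := hF.mdifferentiable (by simp)
  have hpd : MDifferentiable 𝓘(ℝ, (ℝ × ℝ) × ℝ) 𝓘(ℝ, EM) fun z => Q.proj (F z) :=
    (Q.contMDiff_proj.comp hF).mdifferentiable (by simp)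
  have hFL : ∀ u ∈ Icc (0 : ℝ) 1, ∀ s ∈ Icc (0 : ℝ) 1, ∀ t ∈ Icc (0 : ℝ) 1,
    AB.horLift (h u s) p t = F ((u, s), t) := fun u hu s hs t ht => (hFh u hu s hs t ht).2
  have hb : ContDiff ℝ ∞ fun l : ℝ × ℝ => AB.lineB F (0, 1) (l, 1) :=
    (AB.contDiff_lineB hF (0, 1)).comp (by fun_prop : ContDiff ℝ ∞ fun l : ℝ × ℝ => (l, (1 : ℝ)))
  obtain ⟨k, hk, hk'⟩ := exists_group_ode (G := H) hb
  have hbig : ∀ u ∈ Icc (0 : ℝ) 1, ∀ s ∈ Icc (0 : ℝ) 1,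
      AB.bigonIntegrand (h u) p s = AB.lineB F (0, 1) ((u, s), 1) := by
    intro u hu s hs
    refine congrArg Neg.neg (intervalIntegral.integral_congr fun t ht => ?_)
    rw [uIcc_of_le zero_le_one] at ht
    have h2 := velocity_cube_snd hFd hFL hu hs ht
    have h3 := velocity_cube_thd hFd hFL hu hs ht
    change AB.BL (AB.horLift (h u s) p t) ![_, _] = AB.BL _ ![_, _]
    rw [hFL u hu s hs t ht, ← h2, ← h3]
  have hexp : ∀ u ∈ Icc (0 : ℝ) 1,
      pathOrderedExp (E := EH) (H := H) (AB.bigonIntegrand (h u) p) = k u 1 := by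
    intro u hu
    refine pathOrderedExp_eq (hk' u).1 fun s hs => ?_
    rw [hbig u hu s hs]
    exact ((hk' u).2 s).mono (subset_univ _)
  have hhor : ∀ u ∈ Icc (0 : ℝ) 1, ∀ t ∈ Icc (0 : ℝ) 1,
      AB.HorAt γ₀ (fun t => F ((u, 0), t)) (Icc 0 1) t := by
    intro u hu t ht
    refine ⟨(hFh u hu 0 i0 t ht).1.trans ((hh.bigon u hu).source t ht), _,
      ((hFd ((u, 0), t)).hasD.comp_univ (f := fun t => ((u, (0 : ℝ)), t))
      (hasD_univ_iff_hasFDerivAt.2 (hasFDerivAt_prodMk_right (u, (0 : ℝ)) t))).mono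
        (subset_univ _), ?_⟩
    simpa [pullA] using hFt ((u, 0), t)
  -- The paths h 1 0 and h 0 0 agree with γ₀ only on [0, 1] and may differ elsewhere, so the end
  -- points are compared through uniqueness of horizontal curves over γ₀.
  have htra : AB.tra1 (h 1 0) p = AB.tra1 (h 0 0) p := by
    rw [tra1, tra1, hFL 1 i1 0 i0 1 i1, hFL 0 i0 0 i0 1 i1]
    exact HorAt.eqOn ordConnected_Icc (uniqueDiffOn_Icc zero_lt_one) (hhor 1 i1) (hhor 0 i0) i0
      ((hF0 1 i1 0 i0).trans (hF0 0 i0 0 i0).symm) i1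
  have hlog : ∀ u ∈ Icc (0 : ℝ) 1, logD EH (fun z : ℝ × ℝ => k z.1 z.2) (u, 1) (1, 0) =
      ∫ s in (0 : ℝ)..1, AB.lineK F (u, s) := fun u hu =>
    AB.logD_transport_cube hF hFt hF0
      (fun u hu s hs => (hFh u hu s hs 1 i1).1.trans ((hh.bigon u hu).finish s hs))
      (fun u hu t ht => (hFh u hu 0 i0 t ht).1.trans ((hh.bigon u hu).source t ht))
      (fun u hu t ht => (hFh u hu 1 i1 t ht).1.trans ((hh.bigon u hu).target t ht))
      hk (fun u => (hk' u).1) (fun u => (hk' u).2) hu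
  have hmain := inv_mul_eq_lieExp hk hlog fun u _ η => by
    rw [← lieBr_eq_lieBrL, ← X.αStarL_tStar, clm_integral_eq_zero X.tStar
      (f := fun s => AB.lineK F (u, s))
      ((AB.contDiff_lineK hF).continuous.comp (by fun_prop : Continuous fun s : ℝ => (u, s)))
      fun s _ => AB.tStar_lineK hF (u, s), map_zero, zero_apply]
  have hcube := cubeIntegral_eq hFd hFL (fun q v => AB.curvature3 q v)
  refine ⟨_, ?_, rfl, fun K hK => ?_⟩
  · rw [tra2, tra2, htra, hexp 1 i1, hexp 0 i0, Q.div₁_act₁_inl, hmain, hcube]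
    simp only [lineK, intervalIntegral.integral_neg]
    rfl
  · rw [hcube, cubeIntegral_eq hpd (fun u hu s hs t ht => (hFh u hu s hs t ht).1.symm)
      (fun m v => K m v)]
    congr! 6 with u s t
    have h3 : ∀ i : Fin 3, mD ((ℝ × ℝ) × ℝ) EM (fun z => Q.proj (F z)) ((u, s), t)
        ((![((1, 0), 0), ((0, 1), 0), (0, 1)] : Fin 3 → (ℝ × ℝ) × ℝ) i) =
        mD EP EM Q.proj (F ((u, s), t)) (mD ((ℝ × ℝ) × ℝ) EP F ((u, s), t)
        ((![((1, 0), 0), ((0, 1), 0), (0, 1)] : Fin 3 → (ℝ × ℝ) × ℝ) i)) := fun i => by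
      rw [((Q.hasD_proj (F ((u, s), t))).comp_univ (hFd ((u, s), t)).hasD).mD_eq]
      rfl
    simp only [h3]
    exact hK (F ((u, s), t)) _

end TwoConnection

end Stokes

/-! ### The theorem -/

theorem mainTheorem3 {EG EH G H EM EP EP₁ M P P₁ : Type*}
    [NormedAddCommGroup EG] [NormedSpace ℝ EG] [FiniteDimensional ℝ EG]
    [NormedAddCommGroup EH] [NormedSpace ℝ EH] [FiniteDimensional ℝ EH]
    [NormedAddCommGroup EM] [NormedSpace ℝ EM] [FiniteDimensional ℝ EM]
    [NormedAddCommGroup EP] [NormedSpace ℝ EP] [FiniteDimensional ℝ EP]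
    [NormedAddCommGroup EP₁] [NormedSpace ℝ EP₁] [FiniteDimensional ℝ EP₁]
    [TopologicalSpace G] [ChartedSpace EG G] [Group G] [LieGroup 𝓘(ℝ, EG) ∞ G] [T2Space G]
    [TopologicalSpace H] [ChartedSpace EH H] [Group H] [LieGroup 𝓘(ℝ, EH) ∞ H] [T2Space H]
    [TopologicalSpace M] [ChartedSpace EM M] [IsManifold 𝓘(ℝ, EM) ∞ M] [T2Space M]
    [TopologicalSpace P] [ChartedSpace EP P] [IsManifold 𝓘(ℝ, EP) ∞ P] [T2Space P]
    [TopologicalSpace P₁] [ChartedSpace EP₁ P₁] [IsManifold 𝓘(ℝ, EP₁) ∞ P₁] [T2Space P₁]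
    (X : LieCrossedModule EG EH G H) (Q : Principal2Bundle X EM EP EP₁ M P P₁)
    (AB : TwoConnection Q) :
    -- the 2-curvature takes values in `ker t_*`
    (∀ (q : P) (v : Fin 3 → TangentSpace 𝓘(ℝ, EP) q), X.tStar (AB.curvature3 q v) = 0) ∧
    -- if its values are fixed by `G`, it descends to a unique form on `M`
    ((∀ (g : G) (q : P) (v : Fin 3 → TangentSpace 𝓘(ℝ, EP) q),
        X.αStarGroup g (AB.curvature3 q v) = AB.curvature3 q v) →
      ∃! K : MForm EM M 3 EH, K.IsSmooth ∧ (∀ m v, X.tStar (K m v) = 0) ∧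
        ∀ (q : P) (v : Fin 3 → TangentSpace 𝓘(ℝ, EP) q),
          K (Q.proj q) (fun i => mfderiv 𝓘(ℝ, EP) 𝓘(ℝ, EM) Q.proj q (v i)) =
            AB.curvature3 q v) ∧
    ∀ (h : ℝ → ℝ → ℝ → M) (γ₀ γ₁ : ℝ → M) (x y : M) (p : P),
      IsBigonHomotopy EM h γ₀ γ₁ x y → Q.proj p = x →
      -- the Stokes formula on the horizontal lift of the homotopy
      Q.div₁ (AB.tra2 (h 1) p) (AB.tra2 (h 0) p) =
        SemidirectProduct.inl (lieExp (E := EH) (H := H)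
          (-cubeIntegral (V := EH) AB.curvature3 fun u s t => AB.horLift (h u s) p t : EH)) ∧
      -- the Stokes formula on the base
      ∀ K : MForm EM M 3 EH, K.IsSmooth → (∀ m v, X.tStar (K m v) = 0) →
        (∀ (q : P) (v : Fin 3 → TangentSpace 𝓘(ℝ, EP) q),
          K (Q.proj q) (fun i => mfderiv 𝓘(ℝ, EP) 𝓘(ℝ, EM) Q.proj q (v i)) =
            AB.curvature3 q v) →
        Q.div₁ (AB.tra2 (h 1) p) (AB.tra2 (h 0) p) =
          SemidirectProduct.inl (lieExp (E := EH) (H := H)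
            (-cubeIntegral (V := EH) (fun m v => K m v) h : EH)) :=
  ⟨AB.tStar_curvature3, AB.exists_unique_descent, fun h γ₀ γ₁ x y p hh hp => by
    obtain ⟨I, h1, h2, h3⟩ := AB.stokes hh hp
    exact ⟨by rw [h2]; exact h1, fun K _ _ hK => by rw [h3 K hK]; exact h1⟩⟩
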